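/- **Setting.** Algorithms: PPT / QPT means probabilistic / quantum polynomial time (uniform polynomial-size circuits). A function $\varepsilon:\mathbb N\to\mathbb R$ is negligible, $\varepsilon\le\mathrm{negl}(n)$, if for every positive polynomial $p$ there is $n_0$ with $\varepsilon(n)<1/p(n)$ for all $n\ge n_0$. Let $\Pi=(\mathsf{KeyGen},\mathsf{Enc},\mathsf{Dec})$ be a fixed-length public-key quantum encryption scheme with classical input and output: $\mathsf{KeyGen}$ is PPT and outputs $k=(pk,sk)$ on input $1^n$; $\mathsf{Enc}$ and $\mathsf{Dec}$ are QPT algorithms, $\mathsf{Enc}_{pk}$ mapping plaintexts in $\{0,1\}^{m(n)}$ to ciphertexts in $\{0,1\}^{m(n)+t(n)}$, and $\mathsf{Dec}_{sk}$ mapping ciphertexts to plaintexts or $\bot$; the lengths are polynomially bounded and computable from $1^n$ in polynomial time; and there is a negligible function bounding $\Pr[\mathsf{Dec}_{sk}(\mathsf{Enc}_{pk}(x))\neq x]$ for all plaintexts $x$ and all keys $(pk,sk)$ in the range of $\mathsf{KeyGen}(1^n)$. Let $M,T$ be registers of $m(n)$ and $t(n)$ qubits, so that a ciphertext register is $C=MT$.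 For all keys $k$, let a unitary $V_k$ on $MT$, a probability distribution $p_k$ on $\{0,1\}^{t(n)}$ and unit vectors $|\psi_{k,r}\rangle$ on $T$ be given such that the algorithm "sample $r\leftarrow p_k$ and apply $X\mapsto V_k(X\otimes|\psi_{k,r}\rangle\langle\psi_{k,r}|)V_k^\dagger$" maps every computational basis state $|x\rangle\langle x|$ to a state that is diagonal in the computational basis and has trace distance at most $\mathrm{negl}(n)$, uniformly in $k$ and $x$, from the output of $\mathsf{Enc}_{pk}(x)$. **$\mathsf{CNM}_{PQ}$.** For $\mathcal A=(\mathcal A_1,\mathcal A_2)$ the experiment $\mathsf{CNM\text{-}Real}(\Pi,\mathcal A,n)$ is: $(pk,sk)\leftarrow\mathsf{KeyGen}(1^n)$; $(M,s)\leftarrow\mathcal A_1(pk)$, where $M$ is (the circuit of) a quantum algorithm sampling plaintexts; $x\leftarrow M$; $y\leftarrow\mathsf{Enc}_{pk}(x)$; $(R,\mathbf y)\leftarrow\mathcal A_2(s,y)$, where $R$ is (the circuit of) a quantum algorithm with one output bit and $\mathbf y$ is a vector of ciphertexts; $\mathbf x\leftarrow\mathsf{Dec}_{sk}(\mathbf y)$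 componentwise; output $1$ iff $y\notin\mathbf y$ and $R(x,\mathbf x)=1$. In $\mathsf{CNM\text{-}Ideal}$ the last condition is replaced by $R(x',\mathbf x)=1$ for an independent sample $x'\leftarrow M$. $\Pi$ is $\mathsf{CNM}_{PQ}$ if $\Pr[\mathsf{CNM\text{-}Real}=1]-\Pr[\mathsf{CNM\text{-}Ideal}=1]\le\mathrm{negl}(n)$ for all QPT $\mathcal A$ with classical outputs for which $\bot\in\mathsf{Dec}_{sk}(\mathbf y)$ has negligible probability. **$\mathsf{QCNM}_{PQ}$.** The experiment $\mathsf{QCNM\text{-}Real}_{PQ}(\Pi,\mathcal A,n)$ is: $k=(pk,sk)\leftarrow\mathsf{KeyGen}(1^n)$; $(U,s)\leftarrow\mathcal A_1(pk)$, where $U$ is a unitary circuit on registers $M$, $R$, $P$ (the sizes of $R$ and $P$ are chosen by $\mathcal A_1$); $r\leftarrow p_k$; prepare $V_k^{MT}(U|0\rangle^{MRP}\otimes|\psi_{k,r}\rangle^T)$ and measure $MTR$ in the computational basis, with outcome $y$ on $MT$ and $z$ on $R$; $(\mathbf C,E)\leftarrow\mathcal A_2(y,s)$, where $\mathbf C=C_1\dots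 C_l$ is a vector of (classical) ciphertexts and $E$ is a POVM element given by a quantum circuit; if some $C_i=y$, output $0$; otherwise let $\mathbf M\leftarrow\mathsf{Dec}_{sk}(\mathbf C)$, measure $\{E,\mathbb 1-E\}$ on $R\mathbf M$, and output $1$ iff the outcome is $E$. In $\mathsf{QCNM\text{-}Ideal}_{PQ}$ the last measurement is made on $\tilde R\mathbf M$ instead, where $U|0\rangle$ is freshly prepared in $\tilde M\tilde R\tilde P$ and $\tilde M\tilde R$ is measured in the computational basis. $\Pi$ is $\mathsf{QCNM}_{PQ}$ if $\Pr[\mathsf{QCNM\text{-}Real}_{PQ}=1]-\Pr[\mathsf{QCNM\text{-}Ideal}_{PQ}=1]\le\mathrm{negl}(n)$ for all QPT $\mathcal A$ with classical outputs for which $\bot\in\mathsf{Dec}_{sk}(\mathbf C)$ has negligible probability. **Theorem.** $\Pi$ is $\mathsf{QCNM}_{PQ}$ if and only if $\Pi$ is $\mathsf{CNM}_{PQ}$. -/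

import Mathlib

open scoped BigOperators

noncomputable section

namespace PQNM

/-! ### Data, bit strings -/

/-- Binary trees, the data handled by classical programs.  A list is coded by its spine. -/
inductive Data : Type where
  | nil : Data
  | cons : Data → Data → Data
  deriving DecidableEq

namespace Data

/-- Number of `cons` cells. -/
def size : Data → ℕ
  | nil => 0
  | cons a b => size a + size b + 1

def hd : Data → Data
  | nil => nil
  | cons a _ => a

def tl : Data → Data
  | nil => nil
  | cons _ b => b

def ofList : List Data → Data
  | [] => nil
  | a :: l => cons a (ofList l)

def toList : Data → List Data
  | nil => []
  | cons a b => a :: toList b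

/-- The unary numeral `1ⁿ`; its size is `n`. -/
def ofNat (n : ℕ) : Data := ofList (List.replicate n nil)

def isTrue : Data → Bool
  | nil => false
  | cons _ _ => true

def ofBit : Bool → Data
  | false => nil
  | true => cons nil nil

end Data

/-- Bit strings of length `k`; also the labels of the computational basis of `k` qubits. -/
abbrev Bits (k : ℕ) : Type := Fin k → Bool

def Data.ofBits {k : ℕ} (x : Bits k) : Data :=
  Data.ofList (List.ofFn fun i => Data.ofBit (x i))

/-- Reads `k` bits; every datum is the code of some `k`-bit string. -/
def Data.toBits (k : ℕ) (d : Data) : Bits k :=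
  fun i => (d.toList.getD (i : ℕ) Data.nil).isTrue

/-! ### Quantum gates

Qubits carry names in a type `W`; qubits that were never touched are in state `|0⟩`.  The basis
state in which exactly the qubits of the finite set `b` are `1` is labelled by `b`. -/

/-- State vectors (possibly unnormalised), as finite combinations of basis states. -/
abbrev QState (W : Type) : Type := Finset W →₀ ℂ

/-- A universal gate set: NOT, Hadamard, `T = diag(1, e^{iπ/4})`, CNOT, Toffoli (target last). -/
inductive Gate (W : Type) : Type where
  | X : W → Gate W
  | H : W → Gate W
  | T : W → Gate W
  | CX : W → W → Gate W
  | CCX : W → W → W → Gate W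

namespace Gate

variable {W : Type}

def map {W' : Type} (f : W → W') : Gate W → Gate W'
  | X a => X (f a)
  | H a => H (f a)
  | T a => T (f a)
  | CX a t => CX (f a) (f t)
  | CCX a b t => CCX (f a) (f b) (f t)

/-- Total size of the qubit names on which a gate acts. -/
def nameSize : Gate Data → ℕ
  | X a => a.size
  | H a => a.size
  | T a => a.size
  | CX a t => a.size + t.size
  | CCX a b t => a.size + b.size + t.size

variable [DecidableEq W]

/-- Image of a basis state.  A controlled gate whose target is one of its controls does nothing,
so that every gate is unitary. -/
def onBasis : Gate W → Finset W → QState W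
  | X a, s => Finsupp.single (symmDiff s {a}) 1
  | H a, s =>
      Finsupp.single (s.erase a) ((1 / Real.sqrt 2 : ℝ) : ℂ) +
        Finsupp.single (insert a s)
          (if a ∈ s then -((1 / Real.sqrt 2 : ℝ) : ℂ) else ((1 / Real.sqrt 2 : ℝ) : ℂ))
  | T a, s =>
      Finsupp.single s (if a ∈ s then Complex.exp (Complex.I * (Real.pi / 4 : ℝ)) else 1)
  | CX a t, s =>
      Finsupp.single (if a ∈ s ∧ a ≠ t then symmDiff s {t} else s) 1
  | CCX a b t, s =>
      Finsupp.single (if a ∈ s ∧ b ∈ s ∧ a ≠ t ∧ b ≠ t then symmDiff s {t} else s) 1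

def apply (g : Gate W) (φ : QState W) : QState W :=
  φ.sum fun s z => z • g.onBasis s

end Gate

namespace QState

variable {W : Type}

/-- Squared norm. -/
def normSq (φ : QState W) : ℝ := φ.sum fun _ z => ‖z‖ ^ 2

/-- Unnormalised state after measuring qubit `a` with outcome `v`. -/
def project [DecidableEq W] (a : W) (v : Bool) (φ : QState W) : QState W :=
  φ.filter fun s => decide (a ∈ s) = v

end QState

/-! ### Programs

A quantum algorithm is a classical program that drives a quantum register gate by gate and may
use measurement outcomes in its further course.  Every command costs one step plus the size of
the data that it handles.  Loops are bounded (the number of rounds is fixed when the loop is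
entered); nested loops provide clocks of arbitrary polynomial length, so that for polynomial
running times this is no restriction. -/

inductive Expr : Type where
  | var : ℕ → Expr
  | nil : Expr
  | cons : Expr → Expr → Expr
  | hd : Expr → Expr
  | tl : Expr → Expr

def Expr.eval (σ : ℕ → Data) : Expr → Data
  | var x => σ x
  | nil => Data.nil
  | cons e f => Data.cons (eval σ e) (eval σ f)
  | hd e => (eval σ e).hd
  | tl e => (eval σ e).tl

inductive Cmd : Type where
  | skip : Cmd
  | assign : ℕ → Expr → Cmd
  | seq : Cmd → Cmd → Cmd
  /-- First branch if the value is not `nil`. -/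
  | ite : Expr → Cmd → Cmd → Cmd
  /-- Repeats the body as many times as the size of the value at the start of the loop. -/
  | loop : Expr → Cmd → Cmd
  /-- Writes a fair coin toss into a variable. -/
  | flip : ℕ → Cmd
  /-- Applies a gate to the qubits named by the values of the expressions. -/
  | gate : Gate Expr → Cmd
  /-- Measures the named qubit in the computational basis and stores the outcome. -/
  | meas : ℕ → Expr → Cmd

/-- One branch of a computation.  The squared norm of `state` is the probability of the branch. -/
structure Config where
  store : ℕ → Data
  state : QState Data
  cost : ℕ

namespace Config

/-- The input is in variable `0`, all other variables are `nil`, all qubits are `|0⟩`. -/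
def init (d : Data) : Config where
  store := Function.update (fun _ => Data.nil) 0 d
  state := Finsupp.single ∅ 1
  cost := 0

def set (s : Config) (x : ℕ) (d : Data) : Config :=
  { s with store := Function.update s.store x d }

def charge (s : Config) (t : ℕ) : Config := { s with cost := s.cost + t }

def mapState (s : Config) (f : QState Data → QState Data) : Config :=
  { s with state := f s.state }

end Config

namespace Cmd

/-- All branches of a computation. -/
def exec : Cmd → Config → List Config
  | skip, s => [s.charge 1]
  | assign x e, s => [(s.set x (e.eval s.store)).charge (1 + (e.eval s.store).size)]
  | seq c d, s => (exec c s).flatMap (exec d)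
  | ite e c d, s =>
      if (e.eval s.store).isTrue then exec c (s.charge (1 + (e.eval s.store).size))
      else exec d (s.charge (1 + (e.eval s.store).size))
  | loop e c, s =>
      (fun L : List Config => L.flatMap (exec c))^[(e.eval s.store).size]
        [s.charge (1 + (e.eval s.store).size)]
  | flip x, s =>
      [false, true].map fun v =>
        ((s.mapState fun φ => ((1 / Real.sqrt 2 : ℝ) : ℂ) • φ).set x (Data.ofBit v)).charge 1
  | gate g, s =>
      [(s.mapState (g.map (Expr.eval s.store)).apply).charge
        (1 + (g.map (Expr.eval s.store)).nameSize)]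
  | meas x e, s =>
      [false, true].map fun v =>
        ((s.mapState (QState.project (e.eval s.store) v)).set x (Data.ofBit v)).charge
          (1 + (e.eval s.store).size)

/-- Expected value of `f` at the output (variable `0` at the end) on input `d`. -/
def expect (c : Cmd) (d : Data) (f : Data → ℝ) : ℝ :=
  ((c.exec (Config.init d)).map fun s => s.state.normSq * f (s.store 0)).sum

/-- The outputs that occur with positive probability. -/
def outputs (c : Cmd) (d : Data) : Set Data :=
  {o | ∃ s ∈ c.exec (Config.init d), s.state ≠ 0 ∧ s.store 0 = o}

/-- Running time polynomial in the size of the input.  For arbitrary programs this is QPT. -/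
def PolyTime (c : Cmd) : Prop :=
  ∃ p : Polynomial ℕ, ∀ d : Data, ∀ s ∈ c.exec (Config.init d), s.cost ≤ p.eval d.size

/-- No quantum operations, only coin tosses.  With `PolyTime` this is PPT. -/
def IsClassical : Cmd → Prop
  | skip => True
  | assign _ _ => True
  | seq c d => IsClassical c ∧ IsClassical d
  | ite _ c d => IsClassical c ∧ IsClassical d
  | loop _ c => IsClassical c
  | flip _ => True
  | gate _ => False
  | meas _ _ => False

end Cmd

/-! ### Circuits as data -/

abbrev Circuit : Type := List (Gate Data)

/-- Reads a gate from a list consisting of a tag and qubit names. -/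
def Data.toGate (d : Data) : Gate Data :=
  match d.hd.size with
  | 0 => Gate.X d.tl.hd
  | 1 => Gate.H d.tl.hd
  | 2 => Gate.T d.tl.hd
  | 3 => Gate.CX d.tl.hd d.tl.tl.hd
  | _ => Gate.CCX d.tl.hd d.tl.tl.hd d.tl.tl.tl.hd

/-- Reads a list of gates; every datum describes some circuit. -/
def Data.toCircuit (d : Data) : Circuit := d.toList.map Data.toGate

/-- The name of qubit `j` of register `i`. -/
def wire (i j : ℕ) : Data := Data.cons (Data.ofNat i) (Data.ofNat j)

/-- Register `i` holding the bit string `x`. -/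
def regSet (i : ℕ) {k : ℕ} (x : Bits k) : Finset Data :=
  (Finset.univ.filter fun j : Fin k => x j = true).image fun j : Fin k => wire i (j : ℕ)

/-- Registers `i, i+1, …` holding the bit strings of a list. -/
def regSets {k : ℕ} : ℕ → List (Bits k) → Finset Data
  | _, [] => ∅
  | i, x :: xs => regSet i x ∪ regSets (i + 1) xs

/-- The content of the `k`-qubit register `i` in a basis state. -/
def readReg (i k : ℕ) (s : Finset Data) : Bits k := fun j => decide (wire i (j : ℕ) ∈ s)

namespace Circuit

def run (C : Circuit) (s : Finset Data) : QState Data :=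
  C.foldl (fun φ g => g.apply φ) (Finsupp.single s 1)

/-- Probability of the outcome `x` when `C` is run on `|0…0⟩` and then the first `k` qubits of
register `i` are measured. -/
def sampleProb (C : Circuit) (i : ℕ) {k : ℕ} (x : Bits k) : ℝ :=
  QState.normSq ((C.run ∅).filter fun s => readReg i k s = x)

/-- `⟨z, x₁, …, x_l| E |z, x₁, …, x_l⟩` for the POVM element `E` implemented by `C`: the
probability to find qubit `nil` in state `1` after running `C` on `z` in register `0`, `x_i` in
register `i`, and all other qubits (ancillas) `|0⟩`. -/
def accept (C : Circuit) {k m : ℕ} (z : Bits k) (xs : List (Bits m)) : ℝ :=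
  QState.normSq (QState.project Data.nil true (C.run (regSet 0 z ∪ regSets 1 xs)))

end Circuit

/-! ### Encryption schemes -/

/-- `ε ≤ negl(n)`. -/
def Negligible (ε : ℕ → ℝ) : Prop :=
  ∀ p : Polynomial ℝ, (∀ n : ℕ, 0 < p.eval (n : ℝ)) →
    ∃ n₀ : ℕ, ∀ n : ℕ, n₀ ≤ n → ε n < 1 / p.eval (n : ℝ)

/-- The algorithms and register sizes of a public-key encryption scheme with classical input and
output whose algorithms may compute quantumly.  Plaintexts have `msgLen n` bits and ciphertexts
`msgLen n + tagLen n` bits (`C = MT`). -/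
structure SchemeData where
  msgLen : ℕ → ℕ
  tagLen : ℕ → ℕ
  keyGen : Cmd
  enc : Cmd
  dec : Cmd

namespace SchemeData

variable (S : SchemeData)

abbrev ctLen (n : ℕ) : ℕ := S.msgLen n + S.tagLen n

abbrev Msg (n : ℕ) : Type := Bits (S.msgLen n)

abbrev Ct (n : ℕ) : Type := Bits (S.ctLen n)

/-- `k = (pk, sk) ← KeyGen(1ⁿ)`; here `pk = k.hd` and `sk = k.tl`. -/
def keyExpect (n : ℕ) (f : Data → ℝ) : ℝ := S.keyGen.expect (Data.ofNat n) f

def keys (n : ℕ) : Set Data := S.keyGen.outputs (Data.ofNat n)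

/-- `y ← Enc_pk(x)`. -/
def encExpect (n : ℕ) (pk : Data) (x : S.Msg n) (f : S.Ct n → ℝ) : ℝ :=
  S.enc.expect (Data.ofList [Data.ofNat n, pk, Data.ofBits x]) fun d => f (d.toBits (S.ctLen n))

/-- `Pr[Enc_pk(x) = y]`. -/
def encProb (n : ℕ) (pk : Data) (x : S.Msg n) (y : S.Ct n) : ℝ :=
  S.encExpect n pk x fun y' => if y' = y then 1 else 0

/-- An output `nil` of the decryption program stands for `⊥` (here `none`). -/
def readPlain (n : ℕ) : Data → Option (S.Msg n)
  | Data.nil => none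
  | Data.cons _ b => some (b.toBits (S.msgLen n))

/-- `x ← Dec_sk(y)`. -/
def decExpect (n : ℕ) (sk : Data) (y : S.Ct n) (f : Option (S.Msg n) → ℝ) : ℝ :=
  S.dec.expect (Data.ofList [Data.ofNat n, sk, Data.ofBits y]) fun d => f (S.readPlain n d)

/-- Componentwise decryption of a vector of ciphertexts. -/
def decVecExpect (n : ℕ) (sk : Data) : List (S.Ct n) → (List (Option (S.Msg n)) → ℝ) → ℝ
  | [], f => f []
  | y :: ys, f => S.decExpect n sk y fun x => decVecExpect n sk ys fun xs => f (x :: xs)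

end SchemeData

/-- Public-key quantum encryption schemes with classical input and output. -/
structure PKQES extends SchemeData where
  keyGen_classical : keyGen.IsClassical
  keyGen_poly : keyGen.PolyTime
  enc_poly : enc.PolyTime
  dec_poly : dec.PolyTime
  ctLen_poly : ∃ q : Polynomial ℕ, ∀ n : ℕ, msgLen n + tagLen n ≤ q.eval n
  /-- The register sizes are computable from `1ⁿ` in polynomial time. -/
  len_uniform : ∃ c : Cmd, c.IsClassical ∧ c.PolyTime ∧ ∀ n : ℕ,
    c.outputs (Data.ofNat n) = {Data.cons (Data.ofNat (msgLen n)) (Data.ofNat (tagLen n))}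
  /-- Decryption inverts encryption up to a negligible error. -/
  correct : ∃ ε : ℕ → ℝ, Negligible ε ∧ ∀ n : ℕ, ∀ k ∈ toSchemeData.keys n,
    ∀ x : toSchemeData.Msg n,
      (toSchemeData.encExpect n k.hd x fun y => toSchemeData.decExpect n k.tl y fun x' =>
        if x' = some x then 0 else 1) ≤ ε n

/-- Unitaries `V_k` on `MT`, distributions `p_k` on `{0,1}^t` and unit vectors `ψ_{k,r}` on `T`,
for `k = (pk, sk)`. -/
structure EncFormData (S : SchemeData) where
  V : (n : ℕ) → Data → Matrix.unitaryGroup (Bits (S.msgLen n) × Bits (S.tagLen n)) ℂ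
  p : (n : ℕ) → Data → Bits (S.tagLen n) → ℝ
  ψ : (n : ℕ) → Data → Bits (S.tagLen n) → Bits (S.tagLen n) → ℂ

namespace EncFormData

variable {S : SchemeData} (D : EncFormData S)

/-- The amplitude `⟨y| V_k (|x⟩ ⊗ |ψ_{k,r}⟩)`. -/
def amp (n : ℕ) (k : Data) (r : Bits (S.tagLen n)) (x : Bits (S.msgLen n))
    (y : Bits (S.msgLen n) × Bits (S.tagLen n)) : ℂ :=
  ∑ τ : Bits (S.tagLen n), (D.V n k).1 y (x, τ) * D.ψ n k r τ

/-- The density matrix `∑_r p_k(r) V_k (|x⟩⟨x| ⊗ |ψ_{k,r}⟩⟨ψ_{k,r}|) V_k†`. -/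
def encState (n : ℕ) (k : Data) (x : Bits (S.msgLen n)) :
    Matrix (Bits (S.msgLen n) × Bits (S.tagLen n)) (Bits (S.msgLen n) × Bits (S.tagLen n)) ℂ :=
  ∑ r : Bits (S.tagLen n),
    (D.p n k r : ℂ) • Matrix.vecMulVec (D.amp n k r x) (star (D.amp n k r x))

end EncFormData

/-- A form of the encryption map: `Enc_pk` is negligibly close to sampling `r` from `p_k` and
applying `X ↦ V_k (X ⊗ ψ_{k,r}) V_k†`, and the latter algorithm maps classical states to classical
states. -/
structure EncForm (S : SchemeData) extends EncFormData S where
  p_nonneg : ∀ n, ∀ k ∈ S.keys n, ∀ r, 0 ≤ p n k r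
  p_sum : ∀ n, ∀ k ∈ S.keys n, ∑ r, p n k r = 1
  ψ_unit : ∀ n, ∀ k ∈ S.keys n, ∀ r, ∑ τ, ‖ψ n k r τ‖ ^ 2 = 1
  classical : ∀ n, ∀ k ∈ S.keys n, ∀ x, (toEncFormData.encState n k x).IsDiag
  close : ∃ ε : ℕ → ℝ, Negligible ε ∧ ∀ n, ∀ k ∈ S.keys n, ∀ x,
    ∑ y, ‖toEncFormData.encState n k x y y
      - (S.encProb n k.hd x (Fin.append y.1 y.2) : ℂ)‖ ≤ ε n

/-! ### Adversaries and experiments -/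

structure Adversary where
  A₁ : Cmd
  A₂ : Cmd

def Adversary.QPT (A : Adversary) : Prop := A.A₁.PolyTime ∧ A.A₂.PolyTime

namespace SchemeData

variable (S : SchemeData)

/-- Input of `A₁`: the security parameter, the public register sizes, and the public key. -/
def input₁ (n : ℕ) (pk : Data) : Data :=
  Data.ofList [Data.ofNat n, Data.ofNat (S.msgLen n), Data.ofNat (S.ctLen n), pk]

/-- The classical output of `A₂`: a circuit (for a relation or a POVM element) and a vector of
ciphertexts. -/
def readOut₂ (n : ℕ) (o : Data) : Circuit × List (S.Ct n) :=
  (o.hd.toCircuit, o.tl.toList.map (Data.toBits (S.ctLen n)))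

/-- The part common to `CNM-Real` and `CNM-Ideal`.  The circuit `M` output by `A₁` samples a
plaintext by measuring register `0`.  `score` receives `M`, the encrypted plaintext `x`, its
encryption `y`, the relation `R`, the ciphertexts output by `A₂` and their decryptions. -/
def cnmRun (A : Adversary) (n : ℕ)
    (score : Circuit → S.Msg n → S.Ct n → Circuit → List (S.Ct n) → List (Option (S.Msg n)) → ℝ) :
    ℝ :=
  S.keyExpect n fun k =>
  A.A₁.expect (S.input₁ n k.hd) fun a =>
  ∑ x : S.Msg n, a.hd.toCircuit.sampleProb 0 x *
  S.encExpect n k.hd x fun y =>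
  A.A₂.expect (Data.cons a.tl (Data.ofBits y)) fun o =>
  S.decVecExpect n k.tl (S.readOut₂ n o).2 fun xs =>
  score a.hd.toCircuit x y (S.readOut₂ n o).1 (S.readOut₂ n o).2 xs

/-- `Pr[CNM-Real = 1]`. -/
def cnmReal (A : Adversary) (n : ℕ) : ℝ :=
  S.cnmRun A n fun _ x y R ys xs =>
    if y ∈ ys ∨ none ∈ xs then 0 else R.accept x xs.reduceOption

/-- `Pr[CNM-Ideal = 1]`. -/
def cnmIdeal (A : Adversary) (n : ℕ) : ℝ :=
  S.cnmRun A n fun M _ y R ys xs =>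
    if y ∈ ys ∨ none ∈ xs then 0
    else ∑ x' : S.Msg n, M.sampleProb 0 x' * R.accept x' xs.reduceOption

/-- The probability that `A₂` outputs an invalid ciphertext. -/
def cnmInvalid (A : Adversary) (n : ℕ) : ℝ :=
  S.cnmRun A n fun _ _ _ _ _ xs => if none ∈ xs then 1 else 0

end SchemeData

/-- Comparison-based non-malleability against post-quantum adversaries. -/
def CNM_PQ (S : SchemeData) : Prop :=
  ∀ A : Adversary, A.QPT → Negligible (S.cnmInvalid A) →
    Negligible fun n => S.cnmReal A n - S.cnmIdeal A n

namespace EncFormData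

variable {S : SchemeData} (D : EncFormData S)

/-- The amplitude of `U_prep|0⟩ = V_k (U|0⟩ ⊗ |ψ_{k,r}⟩)` at `y` in `MT`, `z` in `R`, `e` in `P`.
In the circuit for `U`, register `0` is `M`, the first `ρ` qubits of register `1` are `R`, all
other qubits are `P`. -/
def prepAmp (n : ℕ) (k : Data) (U : Circuit) {ρ : ℕ} (r : Bits (S.tagLen n))
    (y : Bits (S.msgLen n) × Bits (S.tagLen n)) (z : Bits ρ) (e : Finset Data) : ℂ :=
  ∑ x : S.Msg n, U.run ∅ (regSet 0 x ∪ regSet 1 z ∪ e) * D.amp n k r x y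

/-- All qubits of `MR`. -/
def wiresMR (m ρ : ℕ) : Finset Data :=
  regSet 0 (fun _ : Fin m => true) ∪ regSet 1 (fun _ : Fin ρ => true)

/-- Probability of the outcome `y, z` when `MTR` is measured in the state `U_prep|0⟩`. -/
def prepProb (n : ℕ) (k : Data) (U : Circuit) {ρ : ℕ} (r : Bits (S.tagLen n))
    (y : Bits (S.msgLen n) × Bits (S.tagLen n)) (z : Bits ρ) : ℝ :=
  ∑ e ∈ (U.run ∅).support.image (fun s => s \ wiresMR (S.msgLen n) ρ),
    ‖D.prepAmp n k U r y z e‖ ^ 2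

/-- The part common to the real and the ideal experiment.  `A₁` outputs the size `ρ` of the
register `R`, the circuit `U` and the state `s`.  `score` receives `ρ`, `U`, the measured `y` and
`z`, the POVM element `E`, the ciphertexts output by `A₂` and their decryptions. -/
def qcnmRun (A : Adversary) (n : ℕ)
    (score : (ρ : ℕ) → Circuit → S.Ct n → Bits ρ → Circuit → List (S.Ct n) →
      List (Option (S.Msg n)) → ℝ) : ℝ :=
  S.keyExpect n fun k =>
  A.A₁.expect (S.input₁ n k.hd) fun a =>
  ∑ r : Bits (S.tagLen n), D.p n k r *
  ∑ y : Bits (S.msgLen n) × Bits (S.tagLen n), ∑ z : Bits a.hd.size,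
  D.prepProb n k a.tl.hd.toCircuit r y z *
  A.A₂.expect (Data.cons a.tl.tl (Data.ofBits (Fin.append y.1 y.2))) fun o =>
  S.decVecExpect n k.tl (S.readOut₂ n o).2 fun xs =>
  score a.hd.size a.tl.hd.toCircuit (Fin.append y.1 y.2) z (S.readOut₂ n o).1
    (S.readOut₂ n o).2 xs

/-- `Pr[QCNM-Real_PQ = 1]`. -/
def qcnmReal (A : Adversary) (n : ℕ) : ℝ :=
  D.qcnmRun A n fun _ _ y z E ys xs =>
    if y ∈ ys ∨ none ∈ xs then 0 else E.accept z xs.reduceOption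

/-- `Pr[QCNM-Ideal_PQ = 1]`. -/
def qcnmIdeal (A : Adversary) (n : ℕ) : ℝ :=
  D.qcnmRun A n fun ρ U y _ E ys xs =>
    if y ∈ ys ∨ none ∈ xs then 0
    else ∑ z' : Bits ρ, U.sampleProb 1 z' * E.accept z' xs.reduceOption

/-- The probability that `A₂` outputs an invalid ciphertext. -/
def qcnmInvalid (A : Adversary) (n : ℕ) : ℝ :=
  D.qcnmRun A n fun _ _ _ _ _ _ xs => if none ∈ xs then 1 else 0

end EncFormData

/-- Post-quantum quantum comparison-based non-malleability, the encryption being implemented by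
the unitaries, distributions and states of `D`. -/
def QCNM_PQ {S : SchemeData} (D : EncFormData S) : Prop :=
  ∀ A : Adversary, A.QPT → Negligible (D.qcnmInvalid A) →
    Negligible fun n => D.qcnmReal A n - D.qcnmIdeal A n

end PQNM

end

/-!
# Quantum and classical comparison-based non-malleability

The equivalence rests on two facts.

**Coherences do not survive the encryption.** For different plaintexts `x ≠ x'` the states
`encState x` and `encState x'` are orthogonal, being unitary images of states on `MT` that differ in
`M`.  They are also diagonal, so their supports in the computational basis are disjoint: no
ciphertext `y` has a nonzero amplitude for two plaintexts (`EncForm.amp_eq_zero_or`).  The sum over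
`x` that defines an amplitude of the prepared state therefore has at most one nonzero term, and
measuring `MTR` after the encryption is the same as measuring `MR` first and encrypting the outcome
(`EncForm.sum_prepProb`).  So each probability in the quantum experiment is negligibly close to that
of a hybrid experiment in which a pair `(x, z)` is sampled from `U|0⟩` and `x` is encrypted by `enc`
(`EncForm.exists_hybrid_close`).

**Hybrid and classical experiment differ only in the side information.** The relation is applied to
a string `z` sampled with the plaintext `x` in one case and to `x` itself in the other.  From a
classical sampler one obtains a pair `(x, x)`, and from a sampler of pairs one has to recover `z`
from `x`.  Both are possible if the sampler is replaced by the uniform distribution on two samples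
that have been drawn beforehand.  If `G v v'` is the probability of success when the plaintext is
that of the sample `v` and the side information that of `v'`, the advantage is the average of
`G v v - G v v'`, hence half the average of `G v₀ v₀ + G v₁ v₁ - G v₀ v₁ - G v₁ v₀`
(`Circuit.avg_sub_avg`), and the uniform choice between the fixed samples `v₀` and `v₁` has a
quarter of that combination as advantage.  So the reductions lose exactly a factor `2`
(`SchemeData.hybrid_sub_eq`, `SchemeData.cnm_sub_eq`), and at most the same factor for the
probability of invalid ciphertexts (`SchemeData.cnmInvalid_toClassical_le`).

* `Adversary.toQuantum` runs the sampling circuit of a classical adversary twice, and outputs a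
  circuit for a uniform superposition of the two plaintexts, with a copy of the plaintext in `R`.
* `Adversary.toClassical` runs the unitary circuit of a quantum adversary twice, and outputs a
  circuit that samples one of the two plaintexts.  It also hands over a reversible circuit that
  turns `x_b` into `z_b` in place (`Circuit.maps_exchange`), which is put in front of the circuit
  of the POVM element.  If `x₀ = x₁`, the branch `b` cannot be recovered, and if `z₀ = z₁`, it
  cannot be uncomputed; but then the combination of the four probabilities vanishes, so that any
  consistent choice (`SchemeData.exchangeMsg`, `SchemeData.exchangeBranch`) will do.

These adversaries are programs.  Their outputs are computed with the expectation transformer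
`Cmd.wp`; subprograms run on shifted variables and renamed qubits (`Cmd.shield`) to keep them apart
from the rest, and everything done after the simulation of the circuits is a classical computation
on measured bits (`Cmd.readSem`).  Running times are bounded by the syntactic criterion `Cmd.tame`.
-/

noncomputable section

namespace PQNM

/-! ### Expectations in the computational basis -/

namespace QState

variable {W : Type}

/-- Expected value of `h` at the outcome of a measurement of all qubits of the (possibly
unnormalised) state `φ`. -/
def avg (φ : QState W) (h : Finset W → ℝ) : ℝ := φ.sum fun s z => ‖z‖ ^ 2 * h s

theorem normSq_nonneg (φ : QState W) : 0 ≤ φ.normSq :=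
  Finset.sum_nonneg fun _ _ => sq_nonneg _

theorem avg_const (φ : QState W) (r : ℝ) : (φ.avg fun _ => r) = φ.normSq * r := by
  simp [avg, normSq, Finsupp.sum, Finset.sum_mul]

theorem avg_congr {φ : QState W} {h h' : Finset W → ℝ} (H : ∀ s, h s = h' s) :
    φ.avg h = φ.avg h' := by
  rw [funext H]

theorem avg_add (φ : QState W) (h h' : Finset W → ℝ) :
    (φ.avg fun s => h s + h' s) = φ.avg h + φ.avg h' := by
  simp [avg, Finsupp.sum, mul_add, Finset.sum_add_distrib]

theorem avg_sub (φ : QState W) (h h' : Finset W → ℝ) :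
    (φ.avg fun s => h s - h' s) = φ.avg h - φ.avg h' := by
  simp [avg, Finsupp.sum, mul_sub, Finset.sum_sub_distrib]

theorem avg_mul_left (φ : QState W) (r : ℝ) (h : Finset W → ℝ) :
    (φ.avg fun s => r * h s) = r * φ.avg h := by
  simp [avg, Finsupp.sum, Finset.mul_sum, mul_left_comm]

theorem avg_mono (φ : QState W) {h h' : Finset W → ℝ} (H : ∀ s, h s ≤ h' s) :
    φ.avg h ≤ φ.avg h' :=
  Finset.sum_le_sum fun s _ => mul_le_mul_of_nonneg_left (H s) (sq_nonneg _)

theorem avg_comm {W' : Type} (φ : QState W) (χ : QState W') (h : Finset W → Finset W' → ℝ) :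
    (φ.avg fun s => χ.avg fun t => h s t) = χ.avg fun t => φ.avg fun s => h s t := by
  simp only [avg, Finsupp.sum, Finset.mul_sum]
  rw [Finset.sum_comm]
  refine Finset.sum_congr rfl fun _ _ => Finset.sum_congr rfl fun _ _ => by ring

theorem avg_single (s : Finset W) (z : ℂ) (h : Finset W → ℝ) :
    avg (Finsupp.single s z) h = ‖z‖ ^ 2 * h s := by
  simp [avg]

theorem avg_smul (c : ℂ) (φ : QState W) (h : Finset W → ℝ) :
    avg (c • φ) h = ‖c‖ ^ 2 * avg φ h := by
  rw [avg, Finsupp.sum_of_support_subset _ Finsupp.support_smul _ (by simp), avg, Finsupp.sum,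
    Finset.mul_sum]
  refine Finset.sum_congr rfl fun s _ => ?_
  simp [mul_pow]
  ring

theorem avg_filter (φ : QState W) (q : Finset W → Prop) [DecidablePred q] (h : Finset W → ℝ) :
    avg (φ.filter q) h = avg φ fun s => if q s then h s else 0 := by
  rw [avg, Finsupp.sum_of_support_subset (s := φ.support) _
    (by rw [Finsupp.support_filter]; exact Finset.filter_subset _ _) _ (by simp), avg, Finsupp.sum]
  refine Finset.sum_congr rfl fun s _ => ?_
  by_cases hs : q s <;> simp [hs]

theorem avg_mapDomain {W' : Type} {ι : Finset W → Finset W'} (hι : Function.Injective ι)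
    (φ : QState W) (h : Finset W' → ℝ) : avg (φ.mapDomain ι) h = avg φ fun s => h (ι s) := by
  rw [avg, Finsupp.sum_mapDomain_index_inj hι, avg]

theorem avg_add_of_disjoint {φ χ : QState W} (H : Disjoint φ.support χ.support)
    (h : Finset W → ℝ) : avg (φ + χ) h = avg φ h + avg χ h := by
  classical
  rw [avg, Finsupp.sum_add_index_of_disjoint H, avg, avg]

theorem avg_sum_single {ι : Type*} (I : Finset ι)
    (e : ι → Finset W) (a : ι → ℂ) (he : Set.InjOn e I) (h : Finset W → ℝ) :
    avg (∑ i ∈ I, Finsupp.single (e i) (a i)) h = ∑ i ∈ I, ‖a i‖ ^ 2 * h (e i) := by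
  classical
  induction I using Finset.induction_on with
  | empty => simp [avg]
  | insert i I hi ih =>
    rw [Finset.sum_insert hi, Finset.sum_insert hi, avg_add_of_disjoint, avg_single,
      ih (he.mono (by simp))]
    refine Finset.disjoint_left.2 fun s hs hs' => ?_
    have h1 := Finsupp.support_single_subset hs
    obtain ⟨k, hk, hks⟩ := Finset.mem_biUnion.1 (Finsupp.support_finsetSum hs')
    have h2 := Finsupp.support_single_subset hks
    simp only [Finset.mem_singleton] at h1 h2
    have : i = k := he (by simp) (by simp [hk]) (h1.symm.trans h2)
    exact hi (this ▸ hk)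

theorem avg_nonneg (φ : QState W) {h : Finset W → ℝ} (H : ∀ s, 0 ≤ h s) : 0 ≤ φ.avg h :=
  Finset.sum_nonneg fun s _ => mul_nonneg (sq_nonneg _) (H s)

theorem normSq_eq_avg (φ : QState W) : φ.normSq = φ.avg fun _ => 1 := by
  rw [avg_const, mul_one]

variable [DecidableEq W]

/-- A measurement of one qubit splits the expectation over the outcomes of all qubits. -/
theorem avg_project (φ : QState W) (a : W) (h : Bool → Finset W → ℝ) :
    avg (φ.project a false) (h false) + avg (φ.project a true) (h true)
      = avg φ fun s => h (decide (a ∈ s)) s := by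
  rw [project, project, avg_filter, avg_filter, ← avg_add]
  refine avg_congr fun s => ?_
  by_cases hs : a ∈ s <;> simp [hs]

end QState

/-! ### Gates are unitary -/

namespace Gate

variable {W W' : Type}

theorem map_map {W'' : Type} (g : Gate W) (f : W → W') (f' : W' → W'') :
    (g.map f).map f' = g.map fun a => f' (f a) := by
  cases g <;> rfl

variable [DecidableEq W] [DecidableEq W']

theorem apply_eq_linearCombination (g : Gate W) (φ : QState W) :
    g.apply φ = Finsupp.linearCombination ℂ g.onBasis φ := rfl

@[simp] theorem apply_zero (g : Gate W) : g.apply 0 = 0 := by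
  simp [apply_eq_linearCombination]

theorem apply_add (g : Gate W) (φ χ : QState W) : g.apply (φ + χ) = g.apply φ + g.apply χ := by
  simp [apply_eq_linearCombination]

theorem apply_smul (g : Gate W) (c : ℂ) (φ : QState W) : g.apply (c • φ) = c • g.apply φ := by
  simp [apply_eq_linearCombination]

theorem apply_single (g : Gate W) (s : Finset W) (z : ℂ) :
    g.apply (Finsupp.single s z) = z • g.onBasis s := by
  simp [apply_eq_linearCombination]

theorem apply_sum (g : Gate W) {ι : Type*} (I : Finset ι) (φ : ι → QState W) :
    g.apply (∑ i ∈ I, φ i) = ∑ i ∈ I, g.apply (φ i) := by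
  simp [apply_eq_linearCombination]

/-- A gate that permutes the basis states up to phases is unitary. -/
theorem normSq_apply_of_monomial (g : Gate W) (π : Finset W → Finset W) (c : Finset W → ℂ)
    (hπ : Function.Injective π) (hc : ∀ s, ‖c s‖ = 1)
    (hg : ∀ s, g.onBasis s = Finsupp.single (π s) (c s)) (φ : QState W) :
    (g.apply φ).normSq = φ.normSq := by
  have : g.apply φ = ∑ s ∈ φ.support, Finsupp.single (π s) (φ s * c s) := by
    rw [apply, Finsupp.sum]
    refine Finset.sum_congr rfl fun s _ => ?_
    rw [hg, Finsupp.smul_single, smul_eq_mul]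
  rw [this, QState.normSq_eq_avg, QState.avg_sum_single _ _ _ hπ.injOn]
  simp [hc, QState.normSq, Finsupp.sum]

theorem norm_sqrt_two_inv_sq : ‖((1 / Real.sqrt 2 : ℝ) : ℂ)‖ ^ 2 = 1 / 2 := by
  rw [Complex.norm_real, Real.norm_eq_abs, sq_abs, div_pow, Real.sq_sqrt (by norm_num), one_pow]

theorem apply_H (a : W) (φ : QState W) (s : Finset W) :
    (H a).apply φ s = ((1 / Real.sqrt 2 : ℝ) : ℂ) *
      if a ∈ s then φ (s.erase a) - φ s else φ s + φ (insert a s) := by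
  induction φ using Finsupp.induction_linear with
  | zero => simp
  | add f g hf hg =>
    rw [apply_add, Finsupp.add_apply, hf, hg]
    split_ifs <;> simp <;> ring
  | single t z =>
    rw [apply_single]
    by_cases hat : a ∈ t <;> by_cases has : a ∈ s
    · have h1 : t.erase a ≠ s := fun h => by rw [← h] at has; simp at has
      have h2 : t ≠ s.erase a := fun h => by rw [h] at hat; simp at hat
      by_cases hts : t = s
      · subst hts
        simp [onBasis, hat, Finset.insert_eq_of_mem]
        ring
      · simp [onBasis, hat, has, hts, h1, h2, Finset.insert_eq_of_mem]
    · have h1 : t ≠ s := fun h => has (h ▸ hat)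
      by_cases hts : t = insert a s
      · subst hts
        simp [onBasis, has, h1]
        ring
      · have h3 : t.erase a ≠ s := fun h => hts (by rw [← h, Finset.insert_erase hat])
        simp [onBasis, hat, has, hts, h1, h3, Finset.insert_eq_of_mem]
    · have h1 : t ≠ s := fun h => hat (h ▸ has)
      by_cases hts : t = s.erase a
      · subst hts
        simp [onBasis, has, h1, Finset.insert_erase]
        ring
      · have h3 : insert a t ≠ s := fun h => hts (by rw [← h, Finset.erase_insert hat])
        simp [onBasis, hat, has, hts, h1, h3, Finset.erase_eq_of_notMem]
    · have h1 : insert a t ≠ s := fun h => by rw [← h] at has; simp at has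
      have h2 : t ≠ insert a s := fun h => by rw [h] at hat; simp at hat
      by_cases hts : t = s
      · subst hts
        simp [onBasis, hat, h1, h2, Finset.erase_eq_of_notMem]
        ring
      · simp [onBasis, hat, has, hts, h1, h2, Finset.erase_eq_of_notMem]

theorem symmDiff_singleton_of_mem {a : W} {s : Finset W} (h : a ∈ s) :
    symmDiff s {a} = s.erase a := by
  ext b
  by_cases hb : b = a <;> simp [Finset.mem_symmDiff, hb, h]

theorem symmDiff_singleton_of_notMem {a : W} {s : Finset W} (h : a ∉ s) :
    symmDiff s {a} = insert a s := by
  ext b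
  by_cases hb : b = a <;> simp [Finset.mem_symmDiff, hb, h]

theorem normSq_apply_H (a : W) (φ : QState W) : ((H a).apply φ).normSq = φ.normSq := by
  let τ : Finset W → Finset W := fun s => symmDiff s {a}
  have hτ : ∀ s, τ (τ s) = s := fun s => symmDiff_symmDiff_cancel_right _ _
  let I : Finset (Finset W) := φ.support ∪ φ.support.image τ
  have hI : ∀ s ∈ I, τ s ∈ I := by
    intro s hs
    rcases Finset.mem_union.1 hs with hs | hs
    · exact Finset.mem_union_right _ (Finset.mem_image_of_mem _ hs)
    · obtain ⟨t, ht, rfl⟩ := Finset.mem_image.1 hs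
      rw [hτ]
      exact Finset.mem_union_left _ ht
  have hswap : ∀ F : Finset W → ℝ, ∑ s ∈ I, F s = ∑ s ∈ I, F (τ s) := fun F =>
    Finset.sum_bij' (fun s _ => τ s) (fun s _ => τ s) hI hI (fun s _ => hτ s) (fun s _ => hτ s)
      (fun s _ => by rw [hτ])
  have h0 : ∀ s, s ∉ I → φ s = 0 ∧ φ (τ s) = 0 := by
    intro s hs
    refine ⟨?_, ?_⟩
    · by_contra h
      exact hs (Finset.mem_union_left _ (Finsupp.mem_support_iff.2 h))
    · by_contra h
      exact hs (Finset.mem_union_right _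
        (Finset.mem_image.2 ⟨_, Finsupp.mem_support_iff.2 h, hτ s⟩))
  have hsub : ((H a).apply φ).support ⊆ I := by
    intro s hs
    by_contra hsI
    obtain ⟨h1, h2⟩ := h0 s hsI
    rw [Finsupp.mem_support_iff, apply_H] at hs
    apply hs
    by_cases has : a ∈ s
    · have h2' : φ (s.erase a) = 0 := by rw [← h2, ← symmDiff_singleton_of_mem has]
      rw [if_pos has, h1, h2', sub_zero, mul_zero]
    · have h2' : φ (insert a s) = 0 := by rw [← h2, ← symmDiff_singleton_of_notMem has]
      rw [if_neg has, h1, h2', add_zero, mul_zero]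
  have e1 : ((H a).apply φ).normSq = ∑ s ∈ I, ‖(H a).apply φ s‖ ^ 2 :=
    Finsupp.sum_of_support_subset _ hsub _ (by simp)
  have e2 : φ.normSq = ∑ s ∈ I, ‖φ s‖ ^ 2 :=
    Finsupp.sum_of_support_subset _ Finset.subset_union_left _ (by simp)
  -- The parallelogram law on each pair of basis states that differ in the qubit `a`.
  have key : ∀ s, ‖(H a).apply φ s‖ ^ 2 + ‖(H a).apply φ (τ s)‖ ^ 2
      = ‖φ s‖ ^ 2 + ‖φ (τ s)‖ ^ 2 := by
    have main : ∀ s, a ∉ s → ‖(H a).apply φ s‖ ^ 2 + ‖(H a).apply φ (insert a s)‖ ^ 2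
        = ‖φ s‖ ^ 2 + ‖φ (insert a s)‖ ^ 2 := by
      intro s hs
      rw [apply_H, apply_H, if_neg hs, if_pos (Finset.mem_insert_self _ _),
        Finset.erase_insert hs, norm_mul, norm_mul, mul_pow, mul_pow, norm_sqrt_two_inv_sq]
      have := parallelogram_law_with_norm ℝ (φ s) (φ (insert a s))
      nlinarith [this]
    intro s
    by_cases has : a ∈ s
    · have := main (s.erase a) (by simp)
      rw [Finset.insert_erase has] at this
      simp only [τ, symmDiff_singleton_of_mem has]
      linarith
    · simp only [τ, symmDiff_singleton_of_notMem has]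
      exact main s has
  have : 2 * ((H a).apply φ).normSq = 2 * φ.normSq := by
    rw [e1, e2, two_mul, two_mul]
    nth_rewrite 2 [hswap]
    nth_rewrite 4 [hswap]
    rw [← Finset.sum_add_distrib, ← Finset.sum_add_distrib]
    exact Finset.sum_congr rfl fun s _ => key s
  linarith

theorem normSq_apply (g : Gate W) (φ : QState W) : (g.apply φ).normSq = φ.normSq := by
  cases g with
  | X a =>
    exact normSq_apply_of_monomial _ (fun s => symmDiff s {a}) (fun _ => 1)
      (symmDiff_left_injective _) (by simp) (fun s => rfl) φ
  | H a => exact normSq_apply_H a φ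
  | T a =>
    refine normSq_apply_of_monomial _ id
      (fun s => if a ∈ s then Complex.exp (Complex.I * (Real.pi / 4 : ℝ)) else 1)
      Function.injective_id (fun s => ?_) (fun s => rfl) φ
    split_ifs
    · rw [mul_comm, Complex.norm_exp_ofReal_mul_I]
    · simp
  | CX a t =>
    refine normSq_apply_of_monomial _ (fun s => if a ∈ s ∧ a ≠ t then symmDiff s {t} else s)
      (fun _ => 1) (Function.LeftInverse.injective
        (g := fun s => if a ∈ s ∧ a ≠ t then symmDiff s {t} else s) fun s => ?_)
      (by simp) (fun s => rfl) φ
    by_cases h : a ∈ s ∧ a ≠ t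
    · have : a ∈ symmDiff s {t} := by simp [Finset.mem_symmDiff, h.1, h.2]
      simp only [if_pos h]
      rw [if_pos ⟨this, h.2⟩]
      exact symmDiff_symmDiff_cancel_right _ _
    · simp only [if_neg h]
  | CCX a b t =>
    refine normSq_apply_of_monomial _
      (fun s => if a ∈ s ∧ b ∈ s ∧ a ≠ t ∧ b ≠ t then symmDiff s {t} else s)
      (fun _ => 1) (Function.LeftInverse.injective
        (g := fun s => if a ∈ s ∧ b ∈ s ∧ a ≠ t ∧ b ≠ t then symmDiff s {t} else s) fun s => ?_)
      (by simp) (fun s => rfl) φ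
    by_cases h : a ∈ s ∧ b ∈ s ∧ a ≠ t ∧ b ≠ t
    · have h1 : a ∈ symmDiff s {t} := by simp [Finset.mem_symmDiff, h.1, h.2.2.1]
      have h2 : b ∈ symmDiff s {t} := by simp [Finset.mem_symmDiff, h.2.1, h.2.2.2]
      simp only [if_pos h]
      rw [if_pos ⟨h1, h2, h.2.2⟩]
      exact symmDiff_symmDiff_cancel_right _ _
    · simp only [if_neg h]

end Gate

/-! ### Renamed qubits and product states -/

section Place

variable {W W' : Type} [DecidableEq W']

/-- The basis state `s` on renamed qubits next to the basis state `u`. -/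
def place (f : W → W') (u : Finset W') (s : Finset W) : Finset W' := u ∪ s.image f

theorem place_injective {f : W → W'} (hf : Function.Injective f) {u : Finset W'}
    (hu : ∀ a, f a ∉ u) : Function.Injective (place f u) := by
  intro s t h
  ext a
  have : f a ∈ place f u s ↔ f a ∈ place f u t := by rw [h]
  simpa [place, hu, hf.eq_iff] using this

theorem mem_place {f : W → W'} (hf : Function.Injective f) {u : Finset W'}
    (hu : ∀ a, f a ∉ u) {a : W} {s : Finset W} : f a ∈ place f u s ↔ a ∈ s := by
  simp [place, hu, hf.eq_iff]

theorem Gate.onBasis_place [DecidableEq W] (g : Gate W) {f : W → W'}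
    (hf : Function.Injective f) {u : Finset W'}
    (hu : ∀ a, f a ∉ u) (s : Finset W) :
    (g.map f).onBasis (place f u s) = (g.onBasis s).mapDomain (place f u) := by
  have hm : ∀ a s, f a ∈ place f u s ↔ a ∈ s := fun a s => mem_place hf hu
  have hins : ∀ a s, insert (f a) (place f u s) = place f u (insert a s) := by
    intro a s
    simp [place, Finset.image_insert]
  have hera : ∀ a s, (place f u s).erase (f a) = place f u (s.erase a) := by
    intro a s
    rw [place, place, Finset.erase_union_distrib, Finset.erase_eq_of_notMem (hu a),
      Finset.image_erase hf]
  have hsym : ∀ a s, symmDiff (place f u s) {f a} = place f u (symmDiff s {a}) := by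
    intro a s
    by_cases has : a ∈ s
    · rw [Gate.symmDiff_singleton_of_mem ((hm a s).2 has), Gate.symmDiff_singleton_of_mem has, hera]
    · rw [Gate.symmDiff_singleton_of_notMem (fun h => has ((hm a s).1 h)),
        Gate.symmDiff_singleton_of_notMem has, hins]
  cases g with
  | X a => simp [Gate.map, Gate.onBasis, hsym]
  | H a => simp [Gate.map, Gate.onBasis, hins, hera, hm, Finsupp.mapDomain_add]
  | T a => simp [Gate.map, Gate.onBasis, hm]
  | CX a t =>
    simp only [Gate.map, Gate.onBasis, hm, hf.ne_iff, hsym, Finsupp.mapDomain_single]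
    split_ifs <;> rfl
  | CCX a b t =>
    simp only [Gate.map, Gate.onBasis, hm, hf.ne_iff, hsym, Finsupp.mapDomain_single]
    split_ifs <;> rfl

theorem Gate.apply_place [DecidableEq W] (g : Gate W) {f : W → W'}
    (hf : Function.Injective f) {u : Finset W'}
    (hu : ∀ a, f a ∉ u) (φ : QState W) :
    (g.map f).apply (φ.mapDomain (place f u)) = (g.apply φ).mapDomain (place f u) := by
  induction φ using Finsupp.induction_linear with
  | zero => simp
  | add φ χ h1 h2 => rw [Finsupp.mapDomain_add, apply_add, h1, h2, apply_add, Finsupp.mapDomain_add]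
  | single s z =>
    rw [Finsupp.mapDomain_single, apply_single, apply_single, onBasis_place g hf hu,
      Finsupp.mapDomain_smul]

theorem QState.project_place [DecidableEq W] {f : W → W'} (hf : Function.Injective f)
    {u : Finset W'}
    (hu : ∀ a, f a ∉ u) (a : W) (v : Bool) (φ : QState W) :
    QState.project (f a) v (φ.mapDomain (place f u))
      = (QState.project a v φ).mapDomain (place f u) := by
  simp only [QState.project]
  induction φ using Finsupp.induction_linear with
  | zero =>
    rw [Finsupp.mapDomain_zero, Finsupp.filter_zero, Finsupp.filter_zero, Finsupp.mapDomain_zero]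
  | add φ χ h1 h2 =>
    rw [Finsupp.mapDomain_add, Finsupp.filter_add, h1, h2, Finsupp.filter_add,
      Finsupp.mapDomain_add]
  | single s z =>
    rw [Finsupp.mapDomain_single]
    by_cases h : decide (a ∈ s) = v
    · rw [Finsupp.filter_single_of_pos (a := s) _ h, Finsupp.filter_single_of_pos,
        Finsupp.mapDomain_single]
      simpa [mem_place hf hu] using h
    · rw [Finsupp.filter_single_of_neg (a := s) _ h, Finsupp.filter_single_of_neg,
        Finsupp.mapDomain_zero]
      simpa [mem_place hf hu] using h

/-- The product of the state `c` with the state `φ` on renamed qubits. -/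
def tens (f : W → W') (c : QState W') (φ : QState W) : QState W' :=
  ∑ u ∈ c.support, c u • φ.mapDomain (place f u)

theorem Gate.apply_tens [DecidableEq W] (g : Gate W) {f : W → W'} (hf : Function.Injective f)
    {c : QState W'}
    (hc : ∀ u ∈ c.support, ∀ a, f a ∉ u) (φ : QState W) :
    (g.map f).apply (tens f c φ) = tens f c (g.apply φ) := by
  rw [tens, tens, apply_sum]
  exact Finset.sum_congr rfl fun u hu => by rw [apply_smul, apply_place g hf (hc u hu)]

theorem tens_single_empty (f : W → W') (c : QState W') : tens f c (Finsupp.single ∅ 1) = c := by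
  rw [tens]
  conv_rhs => rw [← Finsupp.sum_single c]
  simp [Finsupp.sum, place]

theorem tens_eq_sum_single (f : W → W') (c : QState W') (φ : QState W) :
    tens f c φ = ∑ i ∈ c.support ×ˢ φ.support,
      Finsupp.single (place f i.1 i.2) (c i.1 * φ i.2) := by
  rw [tens, Finset.sum_product]
  refine Finset.sum_congr rfl fun u _ => ?_
  rw [Finsupp.mapDomain, Finsupp.sum, Finset.smul_sum]
  simp

/-- The product of two states is measured by measuring both of them independently. -/
theorem QState.avg_tens {f : W → W'} (hf : Function.Injective f) {c : QState W'}
    (hc : ∀ u ∈ c.support, ∀ a, f a ∉ u) (φ : QState W) (h : Finset W' → ℝ) :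
    avg (tens f c φ) h = avg c fun u => avg φ fun s => h (place f u s) := by
  rw [tens_eq_sum_single, avg_sum_single]
  · rw [Finset.sum_product]
    simp [avg, Finsupp.sum, Finset.mul_sum, mul_pow, mul_assoc]
  · rintro ⟨u, s⟩ hus ⟨u', s'⟩ hus' h
    simp only [Finset.coe_product, Set.mem_prod, Finset.mem_coe] at hus hus' h
    have hu := hc _ hus.1
    have hu' := hc _ hus'.1
    have h1 : u = u' := by
      ext b
      by_cases hb : ∃ a, f a = b
      · obtain ⟨a, rfl⟩ := hb
        simp [hu, hu']
      · have : b ∈ place f u s ↔ b ∈ place f u' s' := by rw [h]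
        have hn : ∀ s : Finset W, b ∉ s.image f := fun s hbs =>
          hb (by obtain ⟨a, _, ha⟩ := Finset.mem_image.1 hbs; exact ⟨a, ha⟩)
        simpa only [place, Finset.mem_union, hn, or_false] using this
    subst h1
    rw [place_injective hf hu h]

theorem support_tens {f : W → W'} {c : QState W'} {φ : QState W} {t : Finset W'}
    (ht : t ∈ (tens f c φ).support) : ∃ u ∈ c.support, ∃ s, t = place f u s := by
  rw [tens_eq_sum_single] at ht
  obtain ⟨⟨u, s⟩, hi, ht⟩ := Finset.mem_biUnion.1 (Finsupp.support_finsetSum ht)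
  refine ⟨u, (Finset.mem_product.1 hi).1, s, ?_⟩
  simpa using Finsupp.support_single_subset ht

end Place

/-! ### Circuits -/

namespace Circuit

theorem normSq_foldl (C : Circuit) (φ : QState Data) :
    QState.normSq (C.foldl (fun φ g => g.apply φ) φ) = φ.normSq := by
  induction C generalizing φ with
  | nil => rfl
  | cons g C ih => rw [List.foldl_cons, ih, Gate.normSq_apply]

theorem normSq_run (C : Circuit) (s : Finset Data) : (C.run s).normSq = 1 := by
  rw [run, normSq_foldl]
  simp [QState.normSq]

theorem avg_run_const (C : Circuit) (r : ℝ) : ((C.run ∅).avg fun _ => r) = r := by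
  rw [QState.avg_const, normSq_run, one_mul]

theorem accept_nonneg (C : Circuit) {k m : ℕ} (z : Bits k) (xs : List (Bits m)) :
    0 ≤ C.accept z xs := QState.normSq_nonneg _

theorem accept_le_one (C : Circuit) {k m : ℕ} (z : Bits k) (xs : List (Bits m)) :
    C.accept z xs ≤ 1 := by
  rw [accept, ← normSq_run C (regSet 0 z ∪ regSets 1 xs), QState.normSq_eq_avg, QState.project,
    QState.avg_filter, QState.normSq_eq_avg]
  exact QState.avg_mono _ fun s => by split_ifs <;> norm_num

theorem sum_sampleProb_mul (C : Circuit) (i : ℕ) {k : ℕ} (h : Bits k → ℝ) :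
    ∑ x, C.sampleProb i x * h x = (C.run ∅).avg fun s => h (readReg i k s) := by
  simp only [sampleProb, QState.normSq_eq_avg, QState.avg_filter]
  simp only [QState.avg, Finsupp.sum, Finset.sum_mul]
  rw [Finset.sum_comm]
  refine Finset.sum_congr rfl fun s _ => ?_
  rw [Finset.sum_eq_single (readReg i k s)] <;> simp +contextual [eq_comm]

end Circuit

/-! ### Expectation transformers of programs -/

/-- The values of the variables of a program. -/
abbrev Store : Type := ℕ → Data

namespace Cmd

/-- The expectation transformer of a program: `c.wp F σ φ` is the sum of `F` over all branches of
`c` started with store `σ` and quantum state `φ`. -/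
def wp : Cmd → (Store → QState Data → ℝ) → Store → QState Data → ℝ
  | skip, F => F
  | assign x e, F => fun σ φ => F (Function.update σ x (e.eval σ)) φ
  | seq c d, F => wp c (wp d F)
  | ite e c d, F => fun σ φ => if (e.eval σ).isTrue then wp c F σ φ else wp d F σ φ
  | loop e c, F => fun σ φ => (wp c)^[(e.eval σ).size] F σ φ
  | flip x, F => fun σ φ =>
      F (Function.update σ x (Data.ofBit false)) (((1 / Real.sqrt 2 : ℝ) : ℂ) • φ) +
      F (Function.update σ x (Data.ofBit true)) (((1 / Real.sqrt 2 : ℝ) : ℂ) • φ)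
  | gate g, F => fun σ φ => F σ ((g.map (Expr.eval σ)).apply φ)
  | meas x e, F => fun σ φ =>
      F (Function.update σ x (Data.ofBit false)) (QState.project (e.eval σ) false φ) +
      F (Function.update σ x (Data.ofBit true)) (QState.project (e.eval σ) true φ)

theorem sum_map_flatMap {α β : Type*} (L : List α) (f : α → List β) (F : β → ℝ) :
    ((L.flatMap f).map F).sum = (L.map fun a => ((f a).map F).sum).sum := by
  induction L with
  | nil => rfl
  | cons a L ih => simp [ih]

/-- The expectation transformer is compatible with the enumeration of the branches. -/
theorem sum_exec (c : Cmd) (F : Store → QState Data → ℝ) (s : Config) :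
    ((c.exec s).map fun t => F t.store t.state).sum = c.wp F s.store s.state := by
  induction c generalizing F s with
  | skip => simp [exec, wp, Config.charge]
  | assign x e => simp [exec, wp, Config.charge, Config.set]
  | seq c d ihc ihd =>
    simp only [exec, wp]
    rw [sum_map_flatMap, ← ihc]
    simp only [ihd]
  | ite e c d ihc ihd =>
    simp only [exec, wp]
    split_ifs
    · rw [ihc]; rfl
    · rw [ihd]; rfl
  | loop e c ih =>
    simp only [exec, wp]
    have key : ∀ (k : ℕ) (L : List Config),
        ((((fun L : List Config => L.flatMap (exec c))^[k]) L).map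
          fun t => F t.store t.state).sum
        = (L.map fun t => ((wp c)^[k] F) t.store t.state).sum := by
      intro k
      induction k with
      | zero => simp
      | succ k ihk =>
        intro L
        rw [Function.iterate_succ_apply, ihk, sum_map_flatMap, Function.iterate_succ_apply']
        simp only [ih]
    rw [key]
    simp [Config.charge]
  | flip x => simp [exec, wp, Config.charge, Config.set, Config.mapState]
  | gate g => simp [exec, wp, Config.charge, Config.mapState]
  | meas x e => simp [exec, wp, Config.charge, Config.set, Config.mapState]

theorem expect_eq_wp (c : Cmd) (d : Data) (f : Data → ℝ) :
    c.expect d f = c.wp (fun σ φ => φ.normSq * f (σ 0))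
      (Config.init d).store (Finsupp.single ∅ 1) :=
  sum_exec c (fun σ φ => φ.normSq * f (σ 0)) (Config.init d)

/-- The squared norms of the branches add up to the squared norm of the initial state. -/
theorem wp_normSq (c : Cmd) : (c.wp fun _ φ => φ.normSq) = fun _ φ => φ.normSq := by
  induction c with
  | skip => rfl
  | assign x e => rfl
  | seq c d ihc ihd => simp only [wp, ihd, ihc]
  | ite e c d ihc ihd => simp only [wp, ihd, ihc, ite_self]
  | loop e c ih =>
    funext σ φ
    simp only [wp]
    rw [Function.iterate_fixed ih]
  | flip x =>
    funext σ φ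
    simp only [wp]
    rw [QState.normSq_eq_avg, QState.avg_smul, Gate.norm_sqrt_two_inv_sq, QState.normSq_eq_avg]
    ring
  | gate g =>
    funext σ φ
    simp only [wp, Gate.normSq_apply]
  | meas x e =>
    funext σ φ
    simp only [wp, QState.normSq_eq_avg]
    exact QState.avg_project φ _ fun _ _ => 1

theorem expect_const (c : Cmd) (d : Data) (r : ℝ) : (c.expect d fun _ => r) = r := by
  have h := congrFun (congrFun c.wp_normSq (Config.init d).store) (Config.init d).state
  rw [← sum_exec] at h
  rw [expect, List.sum_map_mul_right]
  refine (congrArg (· * r) h).trans ?_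
  simp [QState.normSq, Config.init]

theorem expect_add (c : Cmd) (d : Data) (f g : Data → ℝ) :
    (c.expect d fun o => f o + g o) = c.expect d f + c.expect d g := by
  simp only [expect, mul_add, List.sum_map_add]

theorem expect_mul_left (c : Cmd) (d : Data) (r : ℝ) (f : Data → ℝ) :
    (c.expect d fun o => r * f o) = r * c.expect d f := by
  simp only [expect, mul_left_comm, List.sum_map_mul_left]

theorem expect_sub (c : Cmd) (d : Data) (f g : Data → ℝ) :
    (c.expect d fun o => f o - g o) = c.expect d f - c.expect d g := by
  have := expect_add c d f fun o => -1 * g o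
  rw [expect_mul_left] at this
  simpa [sub_eq_add_neg] using this

theorem expect_mono_of_outputs (c : Cmd) (d : Data) {f g : Data → ℝ}
    (h : ∀ o ∈ c.outputs d, f o ≤ g o) : c.expect d f ≤ c.expect d g := by
  refine List.sum_le_sum fun s hs => ?_
  by_cases h0 : s.state = 0
  · simp [h0, QState.normSq]
  · exact mul_le_mul_of_nonneg_left (h _ ⟨s, hs, h0, rfl⟩) (QState.normSq_nonneg _)

theorem expect_mono (c : Cmd) (d : Data) {f g : Data → ℝ} (h : ∀ o, f o ≤ g o) :
    c.expect d f ≤ c.expect d g :=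
  expect_mono_of_outputs c d fun o _ => h o

theorem expect_congr_of_outputs (c : Cmd) (d : Data) {f g : Data → ℝ}
    (h : ∀ o ∈ c.outputs d, f o = g o) : c.expect d f = c.expect d g :=
  le_antisymm (expect_mono_of_outputs c d fun o ho => (h o ho).le)
    (expect_mono_of_outputs c d fun o ho => (h o ho).ge)

theorem expect_nonneg (c : Cmd) (d : Data) {f : Data → ℝ} (h : ∀ o, 0 ≤ f o) :
    0 ≤ c.expect d f := by
  simpa using (expect_const c d 0).symm.le.trans (expect_mono c d h)

theorem expect_le_one (c : Cmd) (d : Data) {f : Data → ℝ} (h : ∀ o, f o ≤ 1) :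
    c.expect d f ≤ 1 :=
  (expect_mono c d h).trans (expect_const c d 1).le

theorem expect_finset_sum (c : Cmd) (d : Data) {ι : Type*} (I : Finset ι) (f : ι → Data → ℝ) :
    (c.expect d fun o => ∑ i ∈ I, f i o) = ∑ i ∈ I, c.expect d (f i) := by
  classical
  induction I using Finset.induction_on with
  | empty => simp [expect_const]
  | insert i I hi ih => simp only [Finset.sum_insert hi, expect_add, ih]

theorem expect_avg (c : Cmd) (d : Data) {W : Type} (χ : QState W) (f : Data → Finset W → ℝ) :
    (c.expect d fun o => χ.avg fun s => f o s) = χ.avg fun s => c.expect d fun o => f o s := by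
  simp only [QState.avg, Finsupp.sum, expect_finset_sum, expect_mul_left]

end Cmd

/-! ### Subprograms on fresh variables and fresh qubits -/

/-- The same expression on variables shifted by `k`. -/
def Expr.shift (k : ℕ) : Expr → Expr
  | var x => var (x + k)
  | nil => nil
  | cons e f => cons (shift k e) (shift k f)
  | hd e => hd (shift k e)
  | tl e => tl (shift k e)

/-- The same program on variables shifted by `k`, with every qubit name `w` replaced by
`cons nil w`: the first `k` variables and all qubits with other names stay untouched. -/
def Cmd.shield (k : ℕ) : Cmd → Cmd
  | skip => skip
  | assign x e => assign (x + k) (e.shift k)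
  | seq c d => seq (shield k c) (shield k d)
  | ite e c d => ite (e.shift k) (shield k c) (shield k d)
  | loop e c => loop (e.shift k) (shield k c)
  | flip x => flip (x + k)
  | gate g => gate (g.map fun e => Expr.cons Expr.nil (e.shift k))
  | meas x e => meas (x + k) (Expr.cons Expr.nil (e.shift k))

/-- The store whose first `k` variables are those of `low` and are followed by those of `τ`. -/
def Store.merge (k : ℕ) (low τ : Store) : Store := fun x => if x < k then low x else τ (x - k)

theorem Store.merge_add (k : ℕ) (low τ : Store) (x : ℕ) : merge k low τ (x + k) = τ x := by
  simp [merge]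

theorem Store.merge_of_lt {k x : ℕ} (h : x < k) (low τ : Store) : merge k low τ x = low x := by
  simp [merge, h]

theorem Store.update_merge (k : ℕ) (low τ : Store) (x : ℕ) (d : Data) :
    Function.update (merge k low τ) (x + k) d = merge k low (Function.update τ x d) := by
  funext y
  by_cases hy : y = x + k
  · subst hy
    rw [Function.update_self, merge_add, Function.update_self]
  · rw [Function.update_of_ne hy]
    simp only [merge]
    split_ifs with h
    · rfl
    · rw [Function.update_of_ne (by omega)]

theorem Expr.eval_shift (k : ℕ) (low τ : Store) (e : Expr) :
    (e.shift k).eval (Store.merge k low τ) = e.eval τ := by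
  induction e with
  | var x => exact Store.merge_add k low τ x
  | nil => rfl
  | cons e f he hf => simp [shift, eval, he, hf]
  | hd e he => simp [shift, eval, he]
  | tl e he => simp [shift, eval, he]

theorem Data.cons_injective (a : Data) : Function.Injective (Data.cons a) := fun _ _ h => by
  injection h

/-- The state with every qubit name `w` replaced by `cons nil w`. -/
def QState.shield (φ : QState Data) : QState Data := φ.mapDomain (place (Data.cons Data.nil) ∅)

theorem QState.avg_shield (φ : QState Data) (h : Finset Data → ℝ) :
    φ.shield.avg h = φ.avg fun s => h (place (Data.cons Data.nil) ∅ s) :=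
  avg_mapDomain (place_injective (Data.cons_injective _) (by simp)) _ _

theorem QState.normSq_shield (φ : QState Data) : φ.shield.normSq = φ.normSq := by
  rw [normSq_eq_avg, avg_shield, normSq_eq_avg]

theorem QState.mem_support_shield {φ : QState Data} {u : Finset Data}
    (hu : u ∈ φ.shield.support) {w : Data} (hw : w ∈ u) : ∃ a, w = Data.cons Data.nil a := by
  obtain ⟨s, _, rfl⟩ := Finset.mem_image.1 (Finsupp.mapDomain_support hu)
  simp only [place, Finset.empty_union, Finset.mem_image] at hw
  obtain ⟨a, _, rfl⟩ := hw
  exact ⟨a, rfl⟩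

/-- A shielded program acts on the shifted variables and renamed qubits as the program itself does
on the original ones. -/
theorem Cmd.wp_shield (k : ℕ) (low : Store) (c : Cmd) (F : Store → QState Data → ℝ) (τ : Store)
    (φ : QState Data) :
    (c.shield k).wp F (Store.merge k low τ) φ.shield
      = c.wp (fun τ φ => F (Store.merge k low τ) φ.shield) τ φ := by
  induction c generalizing F τ φ with
  | skip => rfl
  | assign x e => simp only [shield, wp, Expr.eval_shift, Store.update_merge]
  | seq c d ihc ihd => simp only [shield, wp, ihc, ihd]
  | ite e c d ihc ihd => simp only [shield, wp, Expr.eval_shift, ihc, ihd]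
  | loop e c ih =>
    simp only [shield, wp, Expr.eval_shift]
    generalize (e.eval τ).size = n
    induction n generalizing τ φ with
    | zero => rfl
    | succ n ihn => simp only [Function.iterate_succ_apply', ih, ihn]
  | flip x =>
    have : ∀ z : ℂ, z • φ.shield = QState.shield (z • φ) := fun z =>
      (Finsupp.mapDomain_smul z φ).symm
    simp only [shield, wp, Store.update_merge, this]
  | gate g =>
    simp only [shield, wp]
    rw [Gate.map_map]
    simp only [Expr.eval, Expr.eval_shift]
    rw [← Gate.map_map g (Expr.eval τ) (Data.cons Data.nil), QState.shield,
      Gate.apply_place _ (Data.cons_injective _) (by simp)]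
    rfl
  | meas x e =>
    have : ∀ a v, QState.project (Data.cons Data.nil a) v φ.shield
        = QState.shield (QState.project a v φ) := fun a v =>
      QState.project_place (Data.cons_injective _) (by simp) a v φ
    simp only [shield, wp, Expr.eval, Expr.eval_shift, Store.update_merge, this]

/-! ### Running times -/

theorem _root_.Polynomial.eval_mono_nat (p : Polynomial ℕ) {a b : ℕ} (h : a ≤ b) :
    p.eval a ≤ p.eval b := by
  simp only [Polynomial.eval_eq_sum, Polynomial.sum]
  gcongr

theorem Data.size_hd_le (d : Data) : d.hd.size ≤ d.size := by
  cases d <;> simp [hd, size]; omega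

theorem Data.size_tl_le (d : Data) : d.tl.size ≤ d.size := by
  cases d <;> simp [tl, size]; omega

theorem Data.size_ofBit_le (v : Bool) : (Data.ofBit v).size ≤ 1 := by
  cases v <;> simp [ofBit, size]

namespace Expr

/-- Number of nodes of an expression. -/
def nodes : Expr → ℕ
  | var _ => 1
  | nil => 1
  | cons e f => nodes e + nodes f + 1
  | hd e => nodes e
  | tl e => nodes e

/-- All variables belong to `S`. -/
def within (S : List ℕ) : Expr → Bool
  | var x => S.contains x
  | nil => true
  | cons e f => within S e && within S f
  | hd e => within S e
  | tl e => within S e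

/-- The value is a part of the value of a variable in `S`. -/
def shrink (S : List ℕ) : Expr → Bool
  | var x => S.contains x
  | nil => true
  | cons _ _ => false
  | hd e => shrink S e
  | tl e => shrink S e

/-- At most one variable occurrence outside `S`. -/
def lin (S : List ℕ) : Expr → Bool
  | var _ => true
  | nil => true
  | cons e f => (within S e && lin S f) || (lin S e && within S f)
  | hd e => lin S e
  | tl e => lin S e

theorem size_eval_le_of_within {S : List ℕ} {e : Expr} (h : e.within S = true) {σ : Store} {N : ℕ}
    (hσ : ∀ x ∈ S, (σ x).size ≤ N) : (e.eval σ).size ≤ e.nodes * (N + 1) := by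
  induction e with
  | var x =>
    have := hσ x (by simpa [within] using h)
    simp only [eval, nodes]
    omega
  | nil => simp [eval, Data.size]
  | cons e f he hf =>
    simp only [within, Bool.and_eq_true] at h
    have h1 := he h.1
    have h2 := hf h.2
    simp only [eval, nodes, Data.size, add_mul]
    omega
  | hd e he => exact (Data.size_hd_le _).trans (he h)
  | tl e he => exact (Data.size_tl_le _).trans (he h)

theorem size_eval_le (e : Expr) {σ : Store} {N : ℕ} (hσ : ∀ x, (σ x).size ≤ N) :
    (e.eval σ).size ≤ e.nodes * (N + 1) := by
  induction e with
  | var x =>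
    have := hσ x
    simp only [eval, nodes]
    omega
  | nil => simp [eval, Data.size]
  | cons e f he hf =>
    simp only [eval, nodes, Data.size, add_mul]
    omega
  | hd e he => exact (Data.size_hd_le _).trans he
  | tl e he => exact (Data.size_tl_le _).trans he

theorem size_eval_le_of_shrink {S : List ℕ} {e : Expr} (h : e.shrink S = true) {σ : Store} {N : ℕ}
    (hσ : ∀ x ∈ S, (σ x).size ≤ N) : (e.eval σ).size ≤ N := by
  induction e with
  | var x => exact hσ x (by simpa [shrink] using h)
  | nil => simp [eval, Data.size]
  | cons e f he hf => simp [shrink] at h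
  | hd e he => exact (Data.size_hd_le _).trans (he h)
  | tl e he => exact (Data.size_tl_le _).trans (he h)

theorem size_eval_le_of_lin {S : List ℕ} {e : Expr} (h : e.lin S = true) {σ : Store} {N M : ℕ}
    (hσ : ∀ x ∈ S, (σ x).size ≤ N) (hM : ∀ x, (σ x).size ≤ M) :
    (e.eval σ).size ≤ M + e.nodes * (N + 1) := by
  induction e with
  | var x => exact (hM x).trans (Nat.le_add_right _ _)
  | nil => simp [eval, Data.size]
  | cons e f he hf =>
    simp only [lin, Bool.or_eq_true, Bool.and_eq_true] at h
    simp only [eval, nodes, Data.size, add_mul]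
    rcases h with h | h
    · have h1 := size_eval_le_of_within h.1 hσ
      have h2 := hf h.2
      omega
    · have h1 := size_eval_le_of_within h.2 hσ
      have h2 := he h.1
      omega
  | hd e he => exact (Data.size_hd_le _).trans (he h)
  | tl e he => exact (Data.size_tl_le _).trans (he h)

end Expr

namespace Cmd

/-- Induction within the rounds of a loop. -/
theorem loop_induction {c : Cmd} {s₀ : Config} {n : ℕ} (I : ℕ → Config → Prop) (h0 : I 0 s₀)
    (hs : ∀ i < n, ∀ s, I i s → ∀ t ∈ c.exec s, I (i + 1) t) :
    ∀ t ∈ (fun L : List Config => L.flatMap (exec c))^[n] [s₀], I n t := by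
  induction n with
  | zero => simpa using h0
  | succ n ih =>
    intro t ht
    rw [Function.iterate_succ_apply'] at ht
    obtain ⟨u, hu, htu⟩ := List.mem_flatMap.1 ht
    exact hs n (Nat.lt_succ_self n) u (ih (fun i hi => hs i (by omega)) u hu) t htu

/-- Only data that have been paid for can be in the store. -/
theorem size_store_le_add_cost (c : Cmd) {B : ℕ} {s₀ : Config}
    (h0 : ∀ x, (s₀.store x).size ≤ B + s₀.cost) :
    ∀ s ∈ c.exec s₀, ∀ x, (s.store x).size ≤ B + s.cost := by
  have upd : ∀ (σ : Store) (y : ℕ) (d : Data) (C C' : ℕ), (∀ x, (σ x).size ≤ B + C) → C ≤ C' →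
      d.size ≤ C' → ∀ x, (Function.update σ y d x).size ≤ B + C' := by
    intro σ y d C C' h hC hd x
    by_cases hx : x = y
    · subst hx
      rw [Function.update_self]
      omega
    · rw [Function.update_of_ne hx]
      have := h x
      omega
  induction c generalizing s₀ with
  | skip =>
    intro s hs x
    simp only [exec, List.mem_singleton] at hs
    subst hs
    have := h0 x
    simp only [Config.charge]
    omega
  | assign y e =>
    intro s hs
    simp only [exec, List.mem_singleton] at hs
    subst hs
    exact upd _ _ _ _ _ h0 (by simp [Config.set, Config.charge])
      (by simp [Config.set, Config.charge]; omega)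
  | seq c d ihc ihd =>
    intro s hs
    obtain ⟨u, hu, hs⟩ := List.mem_flatMap.1 hs
    exact ihd (ihc h0 u hu) s hs
  | ite e c d ihc ihd =>
    intro s hs
    have h1 : ∀ x, ((s₀.charge (1 + (e.eval s₀.store).size)).store x).size
        ≤ B + (s₀.charge (1 + (e.eval s₀.store).size)).cost := fun x => by
      have := h0 x
      simp only [Config.charge]
      omega
    simp only [exec] at hs
    split_ifs at hs
    · exact ihc h1 s hs
    · exact ihd h1 s hs
  | loop e c ih =>
    intro s hs
    refine loop_induction (fun _ t => ∀ x, (t.store x).size ≤ B + t.cost) (fun x => ?_)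
      (fun _ _ u hu t ht => ih hu t ht) s hs
    have := h0 x
    simp only [Config.charge]
    omega
  | flip y =>
    intro s hs
    obtain ⟨v, -, rfl⟩ := List.mem_map.1 hs
    have := Data.size_ofBit_le v
    exact upd _ _ _ _ _ h0 (by simp [Config.set, Config.mapState, Config.charge])
      (by simp [Config.set, Config.mapState, Config.charge]; omega)
  | gate g =>
    intro s hs x
    simp only [exec, List.mem_singleton] at hs
    subst hs
    have := h0 x
    simp only [Config.charge, Config.mapState]
    omega
  | meas y e =>
    intro s hs
    obtain ⟨v, -, rfl⟩ := List.mem_map.1 hs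
    have := Data.size_ofBit_le v
    exact upd _ _ _ _ _ h0 (by simp [Config.set, Config.mapState, Config.charge])
      (by simp [Config.set, Config.mapState, Config.charge]; omega)

theorem _root_.PQNM.Gate.nameSize_map_cons_le {W : Type} (g : Gate W) (f : W → Data) :
    (g.map fun w => Data.cons Data.nil (f w)).nameSize ≤ (g.map f).nameSize + 3 := by
  cases g <;> simp [Gate.map, Gate.nameSize, Data.size] <;> omega

/-- Every branch of a shielded program follows a branch of the program itself, at most four times
as expensive. -/
theorem exec_shield (k : ℕ) (low : Store) (t : ℕ) (c : Cmd) {s₀ s₀' : Config}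
    (hst : s₀'.store = Store.merge k low s₀.store) (hco : s₀'.cost ≤ t + 4 * s₀.cost) :
    ∀ s' ∈ (c.shield k).exec s₀', ∃ s ∈ c.exec s₀,
      s'.store = Store.merge k low s.store ∧ s'.cost ≤ t + 4 * s.cost := by
  induction c generalizing s₀ s₀' with
  | skip =>
    intro s' hs'
    simp only [shield, exec, List.mem_singleton] at hs'
    subst hs'
    refine ⟨_, List.mem_singleton_self _, hst, ?_⟩
    simp only [Config.charge]
    omega
  | assign x e =>
    intro s' hs'
    simp only [shield, exec, List.mem_singleton] at hs'
    subst hs'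
    refine ⟨_, List.mem_singleton_self _, ?_, ?_⟩
    · simp only [Config.charge, Config.set, hst, Expr.eval_shift, Store.update_merge]
    · simp only [Config.charge, Config.set, hst, Expr.eval_shift]
      omega
  | seq c d ihc ihd =>
    intro s' hs'
    obtain ⟨u', hu', hs'⟩ := List.mem_flatMap.1 hs'
    obtain ⟨u, hu, h1, h2⟩ := ihc hst hco u' hu'
    obtain ⟨s, hs, h⟩ := ihd h1 h2 s' hs'
    exact ⟨s, List.mem_flatMap.2 ⟨u, hu, hs⟩, h⟩
  | ite e c d ihc ihd =>
    intro s' hs'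
    simp only [shield, exec, hst, Expr.eval_shift] at hs' ⊢
    have h2 : (s₀'.charge (1 + (e.eval s₀.store).size)).cost
        ≤ t + 4 * (s₀.charge (1 + (e.eval s₀.store).size)).cost := by
      simp only [Config.charge]
      omega
    split_ifs at hs' ⊢
    · exact ihc (s₀ := s₀.charge _) (s₀' := s₀'.charge _) hst h2 s' hs'
    · exact ihd (s₀ := s₀.charge _) (s₀' := s₀'.charge _) hst h2 s' hs'
  | loop e c ih =>
    intro s' hs'
    simp only [shield, exec, hst, Expr.eval_shift] at hs' ⊢
    refine loop_induction (fun n s' => ∃ s ∈ (fun L : List Config => L.flatMap (exec c))^[n]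
      [s₀.charge (1 + (e.eval s₀.store).size)], s'.store = Store.merge k low s.store ∧
        s'.cost ≤ t + 4 * s.cost) ?_ ?_ s' hs'
    · refine ⟨_, List.mem_singleton_self _, hst, ?_⟩
      simp only [Config.charge]
      omega
    · rintro i - u' ⟨u, hu, h1, h2⟩ v' hv'
      obtain ⟨v, hv, h⟩ := ih h1 h2 v' hv'
      refine ⟨v, ?_, h⟩
      rw [Function.iterate_succ_apply']
      exact List.mem_flatMap.2 ⟨u, hu, hv⟩
  | flip x =>
    intro s' hs'
    obtain ⟨v, hv, rfl⟩ := List.mem_map.1 hs'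
    refine ⟨_, List.mem_map.2 ⟨v, hv, rfl⟩, ?_, ?_⟩
    · simp only [Config.charge, Config.set, Config.mapState, hst, Store.update_merge]
    · simp only [Config.charge, Config.set, Config.mapState]
      omega
  | gate g =>
    intro s' hs'
    simp only [shield, exec, List.mem_singleton] at hs'
    subst hs'
    refine ⟨_, List.mem_singleton_self _, hst, ?_⟩
    simp only [Config.charge, Config.mapState, hst, Gate.map_map, Expr.eval, Expr.eval_shift]
    have := Gate.nameSize_map_cons_le g (Expr.eval s₀.store)
    omega
  | meas x e =>
    intro s' hs'
    obtain ⟨v, hv, rfl⟩ := List.mem_map.1 hs'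
    refine ⟨_, List.mem_map.2 ⟨v, hv, rfl⟩, ?_, ?_⟩
    · simp only [Config.charge, Config.set, Config.mapState, hst, Store.update_merge]
    · simp only [Config.charge, Config.set, Config.mapState, hst, Expr.eval, Expr.eval_shift,
        Data.size]
      omega

/-- A syntactic criterion for polynomial running time.  The variables in `S` only ever receive
parts of the values of variables in `S`, so that their sizes stay bounded; loops are controlled by
them, and every other assignment adds a bounded amount of data. -/
def tame (S : List ℕ) : Cmd → Bool
  | skip => true
  | assign x e => if S.contains x then e.shrink S else e.lin S
  | seq c d => tame S c && tame S d
  | ite _ c d => tame S c && tame S d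
  | loop e c => e.within S && tame S c
  | flip x => !S.contains x
  | gate _ => true
  | meas x _ => !S.contains x

theorem size_update_le {S : List ℕ} {σ : Store} {y : ℕ} {d : Data} {N M K : ℕ}
    (hN : ∀ x ∈ S, (σ x).size ≤ N) (hM : ∀ x, (σ x).size ≤ M)
    (hd : y ∈ S → d.size ≤ N) (hd' : d.size ≤ M + K) :
    (∀ x ∈ S, (Function.update σ y d x).size ≤ N) ∧
      ∀ x, (Function.update σ y d x).size ≤ M + K := by
  refine ⟨fun x hx => ?_, fun x => ?_⟩ <;> by_cases hxy : x = y
  · subst hxy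
    simpa using hd hx
  · simpa [hxy] using hN x hx
  · subst hxy
    simpa using hd'
  · simpa [hxy] using (hM x).trans (Nat.le_add_right _ _)

/-- The sizes of the variables in `S` never exceed their initial bound `N`.  Therefore the numbers
of rounds of all loops and the amounts of data added by assignments are bounded in terms of `N`
alone, which keeps the growth additive in the bound `M` for all variables and makes it compose. -/
theorem cost_le_of_tame {S : List ℕ} {c : Cmd} (h : c.tame S = true) :
    ∃ p : Polynomial ℕ, ∀ (N M : ℕ) (s₀ : Config), N ≤ M → (∀ x ∈ S, (s₀.store x).size ≤ N) →
      (∀ x, (s₀.store x).size ≤ M) → ∀ s ∈ c.exec s₀,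
        ((∀ x ∈ S, (s.store x).size ≤ N) ∧ ∀ x, (s.store x).size ≤ M + p.eval N) ∧
        s.cost ≤ s₀.cost + p.eval M := by
  induction c with
  | skip =>
    refine ⟨1, fun N M s₀ hNM hN hM s hs => ?_⟩
    simp only [exec, List.mem_singleton] at hs
    subst hs
    exact ⟨⟨hN, fun x => (hM x).trans (Nat.le_add_right _ _)⟩, by simp [Config.charge]⟩
  | assign y e =>
    refine ⟨1 + Polynomial.C e.nodes * (Polynomial.X + 1), fun N M s₀ hNM hN hM s hs => ?_⟩
    simp only [exec, List.mem_singleton] at hs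
    subst hs
    have h1 := e.size_eval_le hM
    refine ⟨size_update_le hN hM (fun hy => ?_) ?_, by simp [Config.charge, Config.set]; omega⟩
    · rw [tame, if_pos (by simpa using hy)] at h
      exact Expr.size_eval_le_of_shrink h hN
    · by_cases hy : y ∈ S
      · rw [tame, if_pos (by simpa using hy)] at h
        have := Expr.size_eval_le_of_shrink h hN
        omega
      · rw [tame, if_neg (by simpa using hy)] at h
        have := Expr.size_eval_le_of_lin h hN hM
        simp
        omega
  | seq c d ihc ihd =>
    simp only [tame, Bool.and_eq_true] at h
    obtain ⟨p, hp⟩ := ihc h.1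
    obtain ⟨q, hq⟩ := ihd h.2
    refine ⟨p + q + q.comp (Polynomial.X + p), fun N M s₀ hNM hN hM s hs => ?_⟩
    obtain ⟨u, hu, hs⟩ := List.mem_flatMap.1 hs
    obtain ⟨⟨hN1, hM1⟩, hc1⟩ := hp N M s₀ hNM hN hM u hu
    obtain ⟨⟨hN2, hM2⟩, hc2⟩ := hq N (M + p.eval N) u (by omega) hN1 hM1 s hs
    have h1 := q.eval_mono_nat (Nat.add_le_add_left (p.eval_mono_nat hNM) M)
    refine ⟨⟨hN2, fun x => (hM2 x).trans ?_⟩, ?_⟩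
    · simp only [Polynomial.eval_add]
      omega
    · simp only [Polynomial.eval_add, Polynomial.eval_comp, Polynomial.eval_X]
      omega
  | ite e c d ihc ihd =>
    simp only [tame, Bool.and_eq_true] at h
    obtain ⟨p, hp⟩ := ihc h.1
    obtain ⟨q, hq⟩ := ihd h.2
    refine ⟨p + q + (1 + Polynomial.C e.nodes * (Polynomial.X + 1)),
      fun N M s₀ hNM hN hM s hs => ?_⟩
    have h1 := e.size_eval_le hM
    simp only [exec] at hs
    simp only [Polynomial.eval_add, Polynomial.eval_one, Polynomial.eval_mul, Polynomial.eval_C,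
      Polynomial.eval_X]
    split_ifs at hs
    · obtain ⟨⟨h2, h3⟩, h4⟩ := hp N M (s₀.charge (1 + (e.eval s₀.store).size)) hNM hN hM s hs
      refine ⟨⟨h2, fun x => (h3 x).trans (by omega)⟩, h4.trans ?_⟩
      simp only [Config.charge]
      omega
    · obtain ⟨⟨h2, h3⟩, h4⟩ := hq N M (s₀.charge (1 + (e.eval s₀.store).size)) hNM hN hM s hs
      refine ⟨⟨h2, fun x => (h3 x).trans (by omega)⟩, h4.trans ?_⟩
      simp only [Config.charge]
      omega
  | loop e c ih =>
    simp only [tame, Bool.and_eq_true] at h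
    obtain ⟨p, hp⟩ := ih h.2
    let b : Polynomial ℕ := Polynomial.C e.nodes * (Polynomial.X + 1)
    refine ⟨1 + b + b * p + b * p.comp (Polynomial.X + b * p), fun N M s₀ hNM hN hM s hs => ?_⟩
    have hn : (e.eval s₀.store).size ≤ b.eval N := by
      simpa [b] using Expr.size_eval_le_of_within h.1 hN
    have hbM := b.eval_mono_nat hNM
    have hpM := p.eval_mono_nat hNM
    have hbp : b.eval N * p.eval N ≤ b.eval M * p.eval M := Nat.mul_le_mul hbM hpM
    have hcomp := p.eval_mono_nat (Nat.add_le_add_left hbp M)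
    generalize hl : (e.eval s₀.store).size = n at hn
    simp only [exec, hl] at hs
    have key := loop_induction (fun i t => ((∀ x ∈ S, (t.store x).size ≤ N) ∧
      ∀ x, (t.store x).size ≤ M + i * p.eval N) ∧
      t.cost ≤ s₀.cost + (1 + n) + i * p.eval (M + b.eval N * p.eval N)) ?_ ?_ s hs
    · obtain ⟨⟨h1, h2⟩, h3⟩ := key
      have e1 : n * p.eval N ≤ b.eval N * p.eval N := Nat.mul_le_mul_right _ hn
      have e2 : n * p.eval (M + b.eval N * p.eval N)
          ≤ b.eval M * p.eval (M + b.eval M * p.eval M) := Nat.mul_le_mul (hn.trans hbM) hcomp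
      simp only [Polynomial.eval_add, Polynomial.eval_one, Polynomial.eval_mul,
        Polynomial.eval_comp, Polynomial.eval_X]
      refine ⟨⟨h1, fun x => (h2 x).trans ?_⟩, h3.trans ?_⟩ <;> omega
    · exact ⟨⟨hN, fun x => by simpa [Config.charge] using hM x⟩, by simp [Config.charge]⟩
    · rintro i hi u ⟨⟨h1, h2⟩, h3⟩ t ht
      obtain ⟨⟨h4, h5⟩, h6⟩ := hp N (M + i * p.eval N) u (by omega) h1 h2 t ht
      have e1 : p.eval (M + i * p.eval N) ≤ p.eval (M + b.eval N * p.eval N) :=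
        p.eval_mono_nat (Nat.add_le_add_left (Nat.mul_le_mul_right _ (by omega)) M)
      refine ⟨⟨h4, fun x => (h5 x).trans ?_⟩, h6.trans ?_⟩
      · rw [add_mul, one_mul]
        omega
      · rw [add_mul, one_mul]
        omega
  | flip y =>
    refine ⟨1, fun N M s₀ hNM hN hM s hs => ?_⟩
    obtain ⟨v, -, rfl⟩ := List.mem_map.1 hs
    have hv := Data.size_ofBit_le v
    refine ⟨size_update_le hN hM (fun hy => ?_) ?_, by simp [Config.charge, Config.set,
      Config.mapState]⟩
    · simp [tame, hy] at h
    · simp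
      omega
  | gate g =>
    cases g with
    | X a =>
      refine ⟨1 + Polynomial.C a.nodes * (Polynomial.X + 1), fun N M s₀ hNM hN hM s hs => ?_⟩
      simp only [exec, List.mem_singleton] at hs
      subst hs
      have h1 := a.size_eval_le hM
      refine ⟨⟨hN, fun x => (hM x).trans (Nat.le_add_right _ _)⟩, ?_⟩
      simp [Config.charge, Config.mapState, Gate.map, Gate.nameSize]
      omega
    | H a =>
      refine ⟨1 + Polynomial.C a.nodes * (Polynomial.X + 1), fun N M s₀ hNM hN hM s hs => ?_⟩
      simp only [exec, List.mem_singleton] at hs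
      subst hs
      have h1 := a.size_eval_le hM
      refine ⟨⟨hN, fun x => (hM x).trans (Nat.le_add_right _ _)⟩, ?_⟩
      simp [Config.charge, Config.mapState, Gate.map, Gate.nameSize]
      omega
    | T a =>
      refine ⟨1 + Polynomial.C a.nodes * (Polynomial.X + 1), fun N M s₀ hNM hN hM s hs => ?_⟩
      simp only [exec, List.mem_singleton] at hs
      subst hs
      have h1 := a.size_eval_le hM
      refine ⟨⟨hN, fun x => (hM x).trans (Nat.le_add_right _ _)⟩, ?_⟩
      simp [Config.charge, Config.mapState, Gate.map, Gate.nameSize]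
      omega
    | CX a t =>
      refine ⟨1 + Polynomial.C a.nodes * (Polynomial.X + 1) +
        Polynomial.C t.nodes * (Polynomial.X + 1), fun N M s₀ hNM hN hM s hs => ?_⟩
      simp only [exec, List.mem_singleton] at hs
      subst hs
      have h1 := a.size_eval_le hM
      have h2 := t.size_eval_le hM
      refine ⟨⟨hN, fun x => (hM x).trans (Nat.le_add_right _ _)⟩, ?_⟩
      simp [Config.charge, Config.mapState, Gate.map, Gate.nameSize]
      omega
    | CCX a b t =>
      refine ⟨1 + Polynomial.C a.nodes * (Polynomial.X + 1) +
        Polynomial.C b.nodes * (Polynomial.X + 1) +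
        Polynomial.C t.nodes * (Polynomial.X + 1), fun N M s₀ hNM hN hM s hs => ?_⟩
      simp only [exec, List.mem_singleton] at hs
      subst hs
      have h1 := a.size_eval_le hM
      have h2 := b.size_eval_le hM
      have h3 := t.size_eval_le hM
      refine ⟨⟨hN, fun x => (hM x).trans (Nat.le_add_right _ _)⟩, ?_⟩
      simp [Config.charge, Config.mapState, Gate.map, Gate.nameSize]
      omega
  | meas y e =>
    refine ⟨1 + Polynomial.C e.nodes * (Polynomial.X + 1), fun N M s₀ hNM hN hM s hs => ?_⟩
    obtain ⟨v, -, rfl⟩ := List.mem_map.1 hs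
    have hv := Data.size_ofBit_le v
    have h1 := e.size_eval_le hM
    refine ⟨size_update_le hN hM (fun hy => ?_) ?_, by
      simp [Config.charge, Config.set, Config.mapState]; omega⟩
    · simp [tame, hy] at h
    · simp
      omega

/-- Running time and data polynomial in the size of the data in the initial store. -/
def PolyGrowth (c : Cmd) : Prop :=
  ∃ p : Polynomial ℕ, ∀ (N : ℕ) (s₀ : Config), (∀ x, (s₀.store x).size ≤ N) → ∀ s ∈ c.exec s₀,
    (∀ x, (s.store x).size ≤ p.eval N) ∧ s.cost ≤ s₀.cost + p.eval N

theorem PolyGrowth.of_tame (S : List ℕ) {c : Cmd} (h : c.tame S = true) : c.PolyGrowth := by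
  obtain ⟨p, hp⟩ := cost_le_of_tame h
  refine ⟨Polynomial.X + p, fun N s₀ h0 s hs => ?_⟩
  obtain ⟨⟨-, h1⟩, h2⟩ := hp N N s₀ le_rfl (fun x _ => h0 x) h0 s hs
  simp only [Polynomial.eval_add, Polynomial.eval_X]
  exact ⟨h1, by omega⟩

theorem PolyGrowth.seq {c d : Cmd} (hc : c.PolyGrowth) (hd : d.PolyGrowth) :
    (c.seq d).PolyGrowth := by
  obtain ⟨p, hp⟩ := hc
  obtain ⟨q, hq⟩ := hd
  refine ⟨p + q.comp p, fun N s₀ h0 s hs => ?_⟩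
  obtain ⟨u, hu, hs⟩ := List.mem_flatMap.1 hs
  obtain ⟨h1, h2⟩ := hp N s₀ h0 u hu
  obtain ⟨h3, h4⟩ := hq _ u h1 s hs
  simp only [Polynomial.eval_add, Polynomial.eval_comp]
  exact ⟨fun x => (h3 x).trans (Nat.le_add_left _ _), by omega⟩

/-- Runs `c` in shielded form on the value of `e₂` and then `post`, which finds the value of `e₁`
in variable `0` and the output of `c` in variable `k`. -/
def around (k : ℕ) (e₁ e₂ : Expr) (c post : Cmd) : Cmd :=
  seq (assign k e₂) (seq (assign 0 e₁) (seq (c.shield k) post))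

/-- The store with which `around` enters the shielded program: `e₁` is evaluated after variable `k`
has been set, and both inputs are those of fresh programs. -/
theorem around_store {k : ℕ} (hk : 0 < k) (d d₁ d₂ : Data) :
    Function.update (Function.update (Config.init d).store k d₂) 0 d₁
      = Store.merge k (Config.init d₁).store (Config.init d₂).store := by
  funext x
  simp only [Config.init, Store.merge, Function.update_apply]
  by_cases h0 : x = 0
  · subst h0; simp [hk]
  · by_cases hx : x = k
    · subst hx; simp [h0]
    · by_cases hlt : x < k
      · simp [h0, hx, hlt]
      · have : x - k ≠ 0 := by omega
        simp [h0, hx, hlt, this]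

theorem wp_around {k : ℕ} (hk : 0 < k) (e₁ e₂ : Expr) (c post : Cmd) (d : Data)
    (h₁ : ∀ d', e₁.eval (Function.update (Config.init d).store k d')
      = e₁.eval (Config.init d).store) (F : Store → QState Data → ℝ) :
    (around k e₁ e₂ c post).wp F (Config.init d).store (Finsupp.single ∅ 1)
      = c.wp (fun τ φ => post.wp F
          (Store.merge k (Config.init (e₁.eval (Config.init d).store)).store τ) φ.shield)
        (Config.init (e₂.eval (Config.init d).store)).store (Finsupp.single ∅ 1) := by
  have h : (Finsupp.single ∅ 1 : QState Data) = QState.shield (Finsupp.single ∅ 1) := by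
    simp [QState.shield, place]
  simp only [around, wp, h₁, around_store hk]
  rw [h, wp_shield]
  simp only [← h]

theorem polyTime_around {k : ℕ} (hk : 0 < k) (e₁ e₂ : Expr) {c post : Cmd} (hc : c.PolyTime)
    (hpost : post.PolyGrowth)
    (h₁ : ∀ d d', e₁.eval (Function.update (Config.init d).store k d')
      = e₁.eval (Config.init d).store) : (around k e₁ e₂ c post).PolyTime := by
  obtain ⟨p, hp⟩ := hc
  obtain ⟨q, hq⟩ := hpost
  let b : Polynomial ℕ := Polynomial.C (e₁.nodes + e₂.nodes) * (Polynomial.X + 1)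
  let t : Polynomial ℕ := 2 + b + 4 * p.comp b
  refine ⟨t + q.comp (b + t), fun d s hs => ?_⟩
  simp only [around, exec, List.flatMap_cons, List.flatMap_nil, List.append_nil] at hs
  set d₁ := e₁.eval (Config.init d).store with hd₁
  set d₂ := e₂.eval (Config.init d).store with hd₂
  obtain ⟨u, hu, hs⟩ := List.mem_flatMap.1 hs
  have hinit : ∀ (d : Data) x, ((Config.init d).store x).size ≤ d.size := by
    intro d x
    by_cases hx : x = 0 <;> simp [Config.init, hx, Data.size]
  have hb : d₁.size + d₂.size ≤ b.eval d.size := by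
    have h1 : d₁.size ≤ _ := e₁.size_eval_le (hinit d)
    have h2 : d₂.size ≤ _ := e₂.size_eval_le (hinit d)
    simp only [b, Polynomial.eval_mul, Polynomial.eval_C, Polynomial.eval_add, Polynomial.eval_X,
      Polynomial.eval_one, add_mul]
    omega
  have hst : ∀ s₀ : Config, s₀ = (((((Config.init d).set k d₂).charge (1 + d₂.size)).set 0
      (e₁.eval (((Config.init d).set k d₂).charge (1 + d₂.size)).store)).charge
        (1 + (e₁.eval (((Config.init d).set k d₂).charge (1 + d₂.size)).store).size)) →
      s₀.store = Store.merge k (Config.init d₁).store (Config.init d₂).store ∧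
      s₀.cost = 1 + d₂.size + (1 + d₁.size) := by
    rintro s₀ rfl
    have e : e₁.eval (Function.update (Config.init d).store k d₂) = d₁ := h₁ d d₂
    simp only [Config.charge, Config.set, e, around_store hk, true_and]
    simp [Config.init]
  obtain ⟨h1, h2⟩ := hst _ rfl
  obtain ⟨v, hv, h3, h4⟩ := exec_shield k (Config.init d₁).store (2 + d₁.size + d₂.size) c
    (s₀ := Config.init d₂) h1 (by rw [h2]; simp [Config.init]; omega) u hu
  have h5 := hp d₂ v hv
  have h6 : p.eval d₂.size ≤ p.eval (b.eval d.size) := p.eval_mono_nat (by omega)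
  have hut : u.cost ≤ t.eval d.size := by
    simp only [t, Polynomial.eval_add, Polynomial.eval_mul, Polynomial.eval_comp,
      Polynomial.eval_ofNat]
    omega
  have h7 : ∀ x, (u.store x).size ≤ b.eval d.size + t.eval d.size := by
    intro x
    have := size_store_le_add_cost (c.shield k) (B := b.eval d.size) ?_ u hu x
    · omega
    · intro x
      rw [h1]
      simp only [Store.merge]
      split_ifs
      · have := hinit d₁ x
        omega
      · have := hinit d₂ (x - k)
        omega
  obtain ⟨-, h8⟩ := hq _ u h7 s hs
  simp only [Polynomial.eval_add, Polynomial.eval_comp]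
  omega

end Cmd

/-! ### Programs that only measure -/

namespace Cmd

/-- No gates and no coin tosses. -/
def readOnly : Cmd → Bool
  | skip => true
  | assign _ _ => true
  | seq c d => readOnly c && readOnly d
  | ite _ c d => readOnly c && readOnly d
  | loop _ c => readOnly c
  | flip _ => false
  | gate _ => false
  | meas _ _ => true

/-- No quantum operations and no coin tosses. -/
def pure : Cmd → Bool
  | skip => true
  | assign _ _ => true
  | seq c d => pure c && pure d
  | ite _ c d => pure c && pure d
  | loop _ c => pure c
  | flip _ => false
  | gate _ => false
  | meas _ _ => false

/-- The final store of a program without gates and coin tosses when the qubits are in the basis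
state `s`. -/
def readSem (s : Finset Data) : Cmd → Store → Store
  | skip => id
  | assign x e => fun σ => Function.update σ x (e.eval σ)
  | seq c d => fun σ => readSem s d (readSem s c σ)
  | ite e c d => fun σ => if (e.eval σ).isTrue then readSem s c σ else readSem s d σ
  | loop e c => fun σ => (readSem s c)^[(e.eval σ).size] σ
  | flip _ => id
  | gate _ => id
  | meas x e => fun σ => Function.update σ x (Data.ofBit (decide (e.eval σ ∈ s)))

/-- Measurements may be postponed: a program that only measures acts as if all qubits had been
measured at its start. -/
theorem wp_readOnly {c : Cmd} (hc : c.readOnly = true) (h : Store → Finset Data → ℝ) :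
    (c.wp fun σ φ => φ.avg (h σ)) = fun σ φ => φ.avg fun s => h (c.readSem s σ) s := by
  induction c generalizing h with
  | skip => rfl
  | assign x e => rfl
  | seq c d ihc ihd =>
    simp only [readOnly, Bool.and_eq_true] at hc
    simp only [wp, readSem, ihd hc.2]
    rw [ihc hc.1 fun σ s => h (d.readSem s σ) s]
  | ite e c d ihc ihd =>
    simp only [readOnly, Bool.and_eq_true] at hc
    funext σ φ
    simp only [wp, readSem, ihd hc.2, ihc hc.1]
    split_ifs <;> rfl
  | loop e c ih =>
    funext σ φ
    simp only [wp, readSem]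
    generalize (e.eval σ).size = n
    have key : ∀ n, (wp c)^[n] (fun σ φ => φ.avg (h σ))
        = fun σ φ => φ.avg fun s => h ((readSem s c)^[n] σ) s := by
      intro n
      induction n with
      | zero => rfl
      | succ n ihn =>
        rw [Function.iterate_succ_apply', ihn, ih hc fun σ s => h ((readSem s c)^[n] σ) s]
        rfl
    rw [key]
  | flip x => simp [readOnly] at hc
  | gate g => simp [readOnly] at hc
  | meas x e =>
    funext σ φ
    exact QState.avg_project φ (e.eval σ) fun v s => h (Function.update σ x (Data.ofBit v)) s

/-- Programs without quantum operations act on the store only; the basis state `s` is irrelevant. -/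
theorem wp_pure {c : Cmd} (hc : c.pure = true) (s : Finset Data) (F : Store → QState Data → ℝ) :
    c.wp F = fun σ φ => F (c.readSem s σ) φ := by
  induction c generalizing F with
  | skip => rfl
  | assign x e => rfl
  | seq c d ihc ihd =>
    simp only [pure, Bool.and_eq_true] at hc
    simp only [wp, readSem, ihd hc.2]
    rw [ihc hc.1]
  | ite e c d ihc ihd =>
    simp only [pure, Bool.and_eq_true] at hc
    funext σ φ
    simp only [wp, readSem, ihd hc.2, ihc hc.1]
    split_ifs <;> rfl
  | loop e c ih =>
    funext σ φ
    simp only [wp, readSem]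
    generalize (e.eval σ).size = n
    have key : ∀ n, (wp c)^[n] F = fun σ φ => F ((readSem s c)^[n] σ) φ := by
      intro n
      induction n with
      | zero => rfl
      | succ n ihn =>
        rw [Function.iterate_succ_apply', ihn, ih hc]
        rfl
    rw [key]
  | flip x => simp [pure] at hc
  | gate g => simp [pure] at hc
  | meas x e => simp [pure] at hc

end Cmd

/-! ### Simulation of a circuit on fresh qubits -/

theorem Data.ofNat_zero : Data.ofNat 0 = Data.nil := rfl

theorem Data.ofNat_succ (n : ℕ) : Data.ofNat (n + 1) = Data.cons Data.nil (Data.ofNat n) := rfl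

theorem Data.size_ofNat (n : ℕ) : (Data.ofNat n).size = n := by
  induction n with
  | zero => rfl
  | succ n ih => simp [ofNat_succ, size, ih]

theorem Data.ofNat_injective : Function.Injective Data.ofNat := fun a b h => by
  rw [← size_ofNat a, h, size_ofNat]

theorem Data.length_toList_le (d : Data) : d.toList.length ≤ d.size := by
  induction d with
  | nil => simp [toList]
  | cons a b _ ih => simp [toList, size]; omega

/-- The unary numeral `n` as an expression. -/
def Expr.num : ℕ → Expr
  | 0 => nil
  | n + 1 => cons nil (num n)

@[simp] theorem Expr.eval_num (n : ℕ) (σ : Store) : (num n).eval σ = Data.ofNat n := by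
  induction n with
  | zero => rfl
  | succ n ih => simp [num, eval, ih, Data.ofNat_succ]

namespace Cmd

/-- Adds the size of the value of `e` to the unary numeral in variable `x`. -/
def count (x : ℕ) (e : Expr) : Cmd := loop e (assign x (Expr.cons Expr.nil (Expr.var x)))

theorem readSem_count (s : Finset Data) (x : ℕ) (e : Expr) (σ : Store) (m : ℕ)
    (h : σ x = Data.ofNat m) :
    (count x e).readSem s σ = Function.update σ x (Data.ofNat (m + (e.eval σ).size)) := by
  simp only [count, readSem]
  generalize (e.eval σ).size = n
  induction n generalizing σ m with
  | zero => simp [← h]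
  | succ n ih =>
    rw [Function.iterate_succ_apply, ih _ (m + 1) (by simp [Expr.eval, h, Data.ofNat_succ])]
    rw [Function.update_idem, Nat.add_right_comm, Nat.add_assoc]

/-- Applies the gate that is coded in variable `2`, the size of its tag being in variable `3`, to
qubits whose names are tagged with `t`. -/
def applyGate (t : ℕ) : Cmd :=
  let q₁ := Expr.cons (Expr.num t) (Expr.hd (Expr.tl (Expr.var 2)))
  let q₂ := Expr.cons (Expr.num t) (Expr.hd (Expr.tl (Expr.tl (Expr.var 2))))
  let q₃ := Expr.cons (Expr.num t) (Expr.hd (Expr.tl (Expr.tl (Expr.tl (Expr.var 2)))))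
  ite (Expr.var 3)
    (ite (Expr.tl (Expr.var 3))
      (ite (Expr.tl (Expr.tl (Expr.var 3)))
        (ite (Expr.tl (Expr.tl (Expr.tl (Expr.var 3)))) (gate (Gate.CCX q₁ q₂ q₃))
          (gate (Gate.CX q₁ q₂)))
        (gate (Gate.T q₁)))
      (gate (Gate.H q₁)))
    (gate (Gate.X q₁))

theorem wp_applyGate (t : ℕ) (F : Store → QState Data → ℝ) (σ : Store) (φ : QState Data)
    (h : σ 3 = Data.ofNat (σ 2).hd.size) :
    (applyGate t).wp F σ φ = F σ (((σ 2).toGate.map (Data.cons (Data.ofNat t))).apply φ) := by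
  rcases hn : (σ 2).hd.size with _ | _ | _ | _ | n <;> rw [hn] at h <;>
    simp [applyGate, wp, Expr.eval, h, Data.ofNat_succ, Data.ofNat_zero, Data.isTrue, Data.tl,
      Data.toGate, hn, Gate.map]

/-- Applies the first gate of the circuit in variable `1` to qubits tagged with `t`. -/
def simStep (t : ℕ) : Cmd :=
  ite (Expr.var 1)
    (seq (seq (assign 2 (Expr.hd (Expr.var 1)))
      (seq (assign 1 (Expr.tl (Expr.var 1)))
        (seq (assign 3 Expr.nil) (count 3 (Expr.hd (Expr.var 2))))))
      (applyGate t))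
    skip

/-- Runs the circuit that is the value of `e` on qubits tagged with `t`. -/
def simulate (t : ℕ) (e : Expr) : Cmd :=
  seq (assign 1 e) (loop (Expr.var 1) (simStep t))

theorem wp_simStep (t : ℕ) (σ : Store) : ∃ σ' : Store, (∀ x, x ≠ 1 → x ≠ 2 → x ≠ 3 → σ' x = σ x) ∧
    σ' 1 = (σ 1).tl ∧ ∀ F φ, (simStep t).wp F σ φ
      = F σ' (((σ 1).toCircuit.take 1).foldl
          (fun φ g => (g.map (Data.cons (Data.ofNat t))).apply φ) φ) := by
  rcases h1 : σ 1 with _ | ⟨g, C⟩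
  · refine ⟨σ, fun _ _ _ _ => rfl, by simp [h1, Data.tl], fun F φ => ?_⟩
    simp [simStep, wp, Expr.eval, h1, Data.isTrue, Data.toCircuit, Data.toList]
  · refine ⟨Function.update (Function.update (Function.update σ 2 g) 1 C) 3
      (Data.ofNat g.hd.size), ?_, ?_, fun F φ => ?_⟩
    · intro x h h' h''
      simp [h, h', h'']
    · simp [Data.tl]
    · have h0 : (simStep t).wp F σ φ = ((seq (assign 2 (Expr.hd (Expr.var 1)))
          (seq (assign 1 (Expr.tl (Expr.var 1)))
            (seq (assign 3 Expr.nil) (count 3 (Expr.hd (Expr.var 2)))))).wp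
              ((applyGate t).wp F)) σ φ := by
        simp [simStep, wp, Expr.eval, h1, Data.isTrue]
      rw [h0, wp_pure (by rfl) ∅]
      simp only [readSem]
      rw [readSem_count ∅ 3 _ _ 0 (by simp [Expr.eval, Data.ofNat_zero]), wp_applyGate]
      · simp [Expr.eval, Function.update_of_ne, h1, Data.hd, Data.tl, Data.toCircuit, Data.toList]
      · simp [Expr.eval, Function.update_of_ne, h1, Data.hd, Data.tl]

/-- More rounds than gates do no harm, because `simStep` does nothing when no gate is left. -/
theorem wp_simulate_loop (t n : ℕ) (σ : Store) (hn : (σ 1).toList.length ≤ n) :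
    ∃ σ' : Store, (∀ x, x ≠ 1 → x ≠ 2 → x ≠ 3 → σ' x = σ x) ∧ ∀ F φ,
      (wp (simStep t))^[n] F σ φ = F σ' ((σ 1).toCircuit.foldl
          (fun φ g => (g.map (Data.cons (Data.ofNat t))).apply φ) φ) := by
  induction n generalizing σ with
  | zero =>
    have : (σ 1).toList = [] := List.length_eq_zero_iff.1 (by omega)
    exact ⟨σ, fun _ _ _ _ => rfl, fun F φ => by simp [Data.toCircuit, this]⟩
  | succ n ih =>
    obtain ⟨σ', h1, h2, h3⟩ := wp_simStep t σ
    have hl : (σ 1).tl.toList = (σ 1).toList.drop 1 := by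
      cases σ 1 <;> simp [Data.tl, Data.toList]
    obtain ⟨σ'', h4, h5⟩ := ih σ' (by rw [h2, hl, List.length_drop]; omega)
    refine ⟨σ'', fun x h h' h'' => (h4 x h h' h'').trans (h1 x h h' h''), fun F φ => ?_⟩
    rw [Function.iterate_succ_apply', h3, h5, ← List.foldl_append, h2, Data.toCircuit,
      Data.toCircuit, hl, List.map_drop, List.take_append_drop]

theorem foldl_tens (C : Circuit) {f : Data → Data} (hf : Function.Injective f)
    {c : QState Data} (hc : ∀ u ∈ c.support, ∀ a, f a ∉ u) (φ : QState Data) :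
    C.foldl (fun φ g => (g.map f).apply φ) (tens f c φ)
      = tens f c (C.foldl (fun φ g => g.apply φ) φ) := by
  induction C generalizing φ with
  | nil => rfl
  | cons g C ih => rw [List.foldl_cons, Gate.apply_tens g hf hc, ih, List.foldl_cons]

/-- Simulating a circuit on qubits that have not been touched puts its state next to the present
one. -/
theorem wp_simulate (t : ℕ) (e : Expr) (σ : Store) : ∃ σ' : Store,
    (∀ x, x ≠ 1 → x ≠ 2 → x ≠ 3 → σ' x = σ x) ∧
    ∀ (F : Store → QState Data → ℝ) (c : QState Data),
      (∀ u ∈ c.support, ∀ a, Data.cons (Data.ofNat t) a ∉ u) →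
      (simulate t e).wp F σ c
        = F σ' (tens (Data.cons (Data.ofNat t)) c ((e.eval σ).toCircuit.run ∅)) := by
  obtain ⟨σ', h1, h2⟩ := wp_simulate_loop t (e.eval σ).size (Function.update σ 1 (e.eval σ))
    (by simpa using Data.length_toList_le _)
  refine ⟨σ', fun x h h' h'' => by rw [h1 x h h' h'', Function.update_of_ne h], fun F c hc => ?_⟩
  have : (simulate t e).wp F σ c = (wp (simStep t))^[(e.eval σ).size] F
      (Function.update σ 1 (e.eval σ)) c := by
    simp [simulate, wp, Expr.eval]
  rw [this, h2]
  conv_lhs => rw [← tens_single_empty (Data.cons (Data.ofNat t)) c]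
  rw [foldl_tens _ (Data.cons_injective _) hc]
  simp [Circuit.run]

/-- Two independent runs of the circuit that is the value of `e`, followed by `c`. -/
def sampleTwice (e : Expr) (c : Cmd) : Cmd := seq (simulate 1 e) (seq (simulate 2 e) c)

/-- The qubits tagged with `1` and `2` are in the basis states `v₀` and `v₁`. -/
def Tagged (s v₀ v₁ : Finset Data) : Prop :=
  (∀ w, Data.cons (Data.ofNat 1) w ∈ s ↔ w ∈ v₀) ∧ ∀ w, Data.cons (Data.ofNat 2) w ∈ s ↔ w ∈ v₁

/-- A program that only measures, after two simulations, acts on two independent samples of all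
qubits of the circuit. -/
theorem wp_sampleTwice {e : Expr} {g : Data → Data} {k : ℕ} (hk : 4 ≤ k)
    (he : ∀ σ : Store, e.eval σ = g (σ k)) {c : Cmd} (hc : c.readOnly = true) (f : Data → ℝ)
    (H : Finset Data → Finset Data → ℝ) (σ : Store)
    (hH : ∀ (σ' : Store) (s v₀ v₁ : Finset Data), σ' 0 = σ 0 → σ' k = σ k → Tagged s v₀ v₁ →
      f (c.readSem s σ' 0) = H v₀ v₁) (φ : QState Data) :
    (sampleTwice e c).wp (fun σ φ => φ.normSq * f (σ 0)) σ φ.shield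
      = φ.normSq * ((g (σ k)).toCircuit.run ∅).avg fun v₀ =>
          ((g (σ k)).toCircuit.run ∅).avg fun v₁ => H v₀ v₁ := by
  have hne : ∀ {a b : ℕ} (x y : Data), a ≠ b →
      Data.cons (Data.ofNat a) x ≠ Data.cons (Data.ofNat b) y := by
    intro a b x y hab h
    injection h with h _
    exact hab (Data.ofNat_injective h)
  set χ := (g (σ k)).toCircuit.run ∅ with hχ
  obtain ⟨σ₁, h1, h2⟩ := wp_simulate 1 e σ
  obtain ⟨σ₂, h3, h4⟩ := wp_simulate 2 e σ₁
  have hk1 : σ₁ k = σ k := h1 k (by omega) (by omega) (by omega)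
  have hk2 : σ₂ k = σ k := (h3 k (by omega) (by omega) (by omega)).trans hk1
  have h02 : σ₂ 0 = σ 0 :=
    (h3 0 (by omega) (by omega) (by omega)).trans (h1 0 (by omega) (by omega) (by omega))
  have hs0 : ∀ u ∈ φ.shield.support, ∀ t ≠ 0, ∀ a, Data.cons (Data.ofNat t) a ∉ u := by
    intro u hu t ht a ha
    obtain ⟨b, hb⟩ := QState.mem_support_shield hu ha
    exact hne a b ht hb
  have hs1 : ∀ u ∈ (tens (Data.cons (Data.ofNat 1)) φ.shield χ).support,
      ∀ a, Data.cons (Data.ofNat 2) a ∉ u := by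
    intro u hu a ha
    obtain ⟨u', hu', v, rfl⟩ := support_tens hu
    simp only [place, Finset.mem_union, Finset.mem_image] at ha
    rcases ha with ha | ⟨b, -, hb⟩
    · exact hs0 u' hu' 2 (by omega) a ha
    · exact hne b a (by omega) hb
  have hi := fun t => Data.cons_injective (Data.ofNat t)
  simp only [sampleTwice, wp]
  rw [h2 _ _ fun u hu => hs0 u hu 1 (by omega), he, ← hχ, h4 _ _ hs1, he, hk1, ← hχ]
  -- The score does not depend on the qubits, so that `c` may find them already measured.
  have : (fun (σ : Store) (φ : QState Data) => φ.normSq * f (σ 0))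
      = fun σ φ => φ.avg fun _ => f (σ 0) := by
    funext σ φ
    rw [QState.avg_const]
  rw [this, wp_readOnly hc fun σ _ => f (σ 0)]
  beta_reduce
  rw [QState.avg_tens (hi 2) hs1,
    QState.avg_tens (hi 1) fun u hu => hs0 u hu 1 (by omega), ← QState.normSq_shield,
    ← QState.avg_const]
  refine Finset.sum_congr rfl fun u hu => ?_
  refine congrArg (‖φ.shield u‖ ^ 2 * ·) ?_
  refine QState.avg_congr fun v₀ => QState.avg_congr fun v₁ => hH _ _ _ _ h02 hk2 ⟨?_, ?_⟩
  · intro w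
    have : ∀ b, Data.cons (Data.ofNat 2) b ≠ Data.cons (Data.ofNat 1) w :=
      fun b => hne _ _ (by omega)
    simp [place, hs0 u hu 1 (by omega), (hi 1).eq_iff, this]
  · intro w
    have : ∀ b, Data.cons (Data.ofNat 1) b ≠ Data.cons (Data.ofNat 2) w :=
      fun b => hne _ _ (by omega)
    simp [place, hs0 u hu 2 (by omega), (hi 2).eq_iff, this]

/-- The expected output of an adversary that first runs `A` and then continues with two samples of
a circuit that is a part of the output of `A`. -/
theorem expect_around_sampleTwice {e e₁ e₂ : Expr} {g : Data → Data} {k : ℕ} (hk : 4 ≤ k)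
    (he : ∀ σ : Store, e.eval σ = g (σ k)) {A c : Cmd} (hc : c.readOnly = true) (f : Data → ℝ)
    (d : Data) (h₁ : ∀ d', e₁.eval (Function.update (Config.init d).store k d')
      = e₁.eval (Config.init d).store)
    (H : Data → Finset Data → Finset Data → ℝ)
    (hH : ∀ (a : Data) (σ : Store) (s v₀ v₁ : Finset Data),
      σ 0 = e₁.eval (Config.init d).store → σ k = a → Tagged s v₀ v₁ →
      f (c.readSem s σ 0) = H a v₀ v₁) :
    (around k e₁ e₂ A (sampleTwice e c)).expect d f
      = A.expect (e₂.eval (Config.init d).store) fun a =>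
          ((g a).toCircuit.run ∅).avg fun v₀ =>
            ((g a).toCircuit.run ∅).avg fun v₁ => H a v₀ v₁ := by
  rw [expect_eq_wp, wp_around (by omega) e₁ e₂ A _ d h₁, expect_eq_wp]
  congr 1
  funext τ φ
  have hk' : Store.merge k (Config.init (e₁.eval (Config.init d).store)).store τ k = τ 0 := by
    simpa using Store.merge_add k (Config.init (e₁.eval (Config.init d).store)).store τ 0
  rw [wp_sampleTwice hk he hc f (H (τ 0)), hk']
  intro σ' s v₀ v₁ h0 hk'' hs
  refine hH _ _ _ _ _ (h0.trans ?_) (hk''.trans hk') hs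
  rw [Store.merge_of_lt (by omega)]
  simp [Config.init]

theorem polyGrowth_simulate (t : ℕ) (S : List ℕ) (e : Expr) (he : (assign 1 e).tame S = true)
    (ht : (simStep t).tame [1, 2] = true) : (simulate t e).PolyGrowth :=
  (PolyGrowth.of_tame S he).seq (PolyGrowth.of_tame [1, 2] (by
    rw [tame, ht]
    rfl))

end Cmd

/-! ### Circuits that load bit strings -/

theorem wire_ne_nil (i j : ℕ) : wire i j ≠ Data.nil := fun h => by cases h

theorem wire_inj {i j i' j' : ℕ} : wire i j = wire i' j' ↔ i = i' ∧ j = j' := by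
  refine ⟨fun h => ?_, by rintro ⟨rfl, rfl⟩; rfl⟩
  injection h with h h'
  exact ⟨Data.ofNat_injective h, Data.ofNat_injective h'⟩

/-- The basis state of register `t` whose first `n` qubits are given by `f`. -/
def loadSet (f : ℕ → Bool) (t n : ℕ) : Finset Data :=
  ((Finset.range n).filter fun j => f j = true).image (wire t)

theorem mem_loadSet {f : ℕ → Bool} {t n t' j : ℕ} :
    wire t' j ∈ loadSet f t n ↔ t' = t ∧ j < n ∧ f j = true := by
  simp only [loadSet, Finset.mem_image, Finset.mem_filter, Finset.mem_range, wire_inj]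
  constructor
  · rintro ⟨a, ⟨h1, h2⟩, rfl, rfl⟩
    exact ⟨rfl, h1, h2⟩
  · rintro ⟨rfl, h1, h2⟩
    exact ⟨j, ⟨h1, h2⟩, rfl, rfl⟩

theorem nil_notMem_loadSet {f : ℕ → Bool} {t n : ℕ} : Data.nil ∉ loadSet f t n := by
  simp [loadSet, wire_ne_nil]

theorem loadSet_congr {f g : ℕ → Bool} {t n : ℕ} (h : ∀ j < n, f j = g j) :
    loadSet f t n = loadSet g t n := by
  rw [loadSet, loadSet]
  congr 1
  exact Finset.filter_congr fun j hj => by rw [h j (Finset.mem_range.1 hj)]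

theorem regSet_eq_loadSet (f : ℕ → Bool) (t n : ℕ) :
    regSet t (fun j : Fin n => f j) = loadSet f t n := by
  ext w
  simp only [regSet, loadSet, Finset.mem_image, Finset.mem_filter, Finset.mem_univ, true_and,
    Finset.mem_range]
  constructor
  · rintro ⟨j, h, rfl⟩
    exact ⟨j, ⟨j.2, h⟩, rfl⟩
  · rintro ⟨j, ⟨h1, h2⟩, rfl⟩
    exact ⟨⟨j, h1⟩, h2, rfl⟩

theorem readReg_eq_of_forall {t n : ℕ} {f : ℕ → Bool} {s : Finset Data}
    (h : ∀ j < n, wire t j ∈ s ↔ f j = true) : readReg t n s = fun j : Fin n => f j := by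
  funext j
  rw [readReg, Bool.eq_iff_iff, decide_eq_true_iff]
  exact h j j.2

theorem loadSet_succ (f : ℕ → Bool) (t n : ℕ) :
    loadSet f t (n + 1) = symmDiff (loadSet f t n) (if f n = true then {wire t n} else ∅) := by
  ext w
  simp only [loadSet, Finset.range_add_one, Finset.filter_insert, Finset.mem_symmDiff]
  have hn : wire t n ∉ loadSet f t n := by simp [mem_loadSet]
  rw [loadSet] at hn
  by_cases hf : f n = true
  · by_cases hw : w = wire t n
    · subst hw
      simp only [hf, if_true, Finset.image_insert, Finset.mem_insert_self, Finset.mem_singleton,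
        true_iff]
      exact Or.inr ⟨trivial, hn⟩
    · simp [hf, hw]
  · simp [hf]

namespace Circuit

/-- The circuit maps the basis state `s` to the basis state `s'`. -/
def Maps (C : Circuit) (s s' : Finset Data) : Prop := C.run s = Finsupp.single s' 1

theorem run_append (C D : Circuit) {s s' : Finset Data} (h : C.Maps s s') :
    Circuit.run (C ++ D) s = D.run s' := by
  rw [Maps, run] at h
  rw [run, List.foldl_append, h, run]

theorem Maps.append {C D : Circuit} {s s' s'' : Finset Data} (h : C.Maps s s')
    (h' : D.Maps s' s'') : Maps (C ++ D) s s'' := (run_append C D h).trans h'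

theorem maps_nil (s : Finset Data) : Maps [] s s := rfl

theorem maps_X (w : Data) (s : Finset Data) : Maps [Gate.X w] s (symmDiff s {w}) := by
  simp [Maps, run, Gate.apply_single, Gate.onBasis]

theorem maps_CX {a w : Data} (h : a ≠ w) (s : Finset Data) :
    Maps [Gate.CX a w] s (if a ∈ s then symmDiff s {w} else s) := by
  simp [Maps, run, Gate.apply_single, Gate.onBasis, h]

/-- Flips the qubit `w` if `b` is true for the value `b` of the qubit `nil`. -/
def loadBit (b : Bool → Bool) (w : Data) : Circuit :=
  (if b false = b true then [] else [Gate.CX Data.nil w]) ++ if b false then [Gate.X w] else []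

theorem maps_loadBit (b : Bool → Bool) {w : Data} (hw : w ≠ Data.nil) (s : Finset Data) :
    (loadBit b w).Maps s
      (symmDiff s (if b (decide (Data.nil ∈ s)) = true then {w} else ∅)) := by
  have e : ∀ s : Finset Data, symmDiff (symmDiff s {w}) {w} = s := fun s =>
    symmDiff_symmDiff_cancel_right _ _
  have e0 : ∀ s : Finset Data, symmDiff s ∅ = s := fun s => symmDiff_bot s
  have h1 := maps_CX hw.symm s
  by_cases hs : Data.nil ∈ s <;> cases h0 : b false <;> cases h1' : b true <;>
    simp only [loadBit, h0, h1', hs, if_true, if_false, reduceCtorEq, List.nil_append,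
      List.append_nil, e0, decide_true, decide_false, Bool.false_eq_true] at h1 ⊢
  · exact maps_nil s
  · exact h1
  · simpa [e] using h1.append (maps_X w _)
  · exact maps_X w s
  · exact maps_nil s
  · exact h1
  · exact h1.append (maps_X w _)
  · exact maps_X w s

/-- Flips the first `n` qubits of register `t` where `b v` is true, `v` being the value of the qubit
`nil`. -/
def load (b : Bool → ℕ → Bool) (t n : ℕ) : Circuit :=
  (List.range n).flatMap fun j => loadBit (fun v => b v j) (wire t j)

theorem maps_load (b : Bool → ℕ → Bool) (t n : ℕ) (s : Finset Data) :
    (load b t n).Maps s (symmDiff s (loadSet (b (decide (Data.nil ∈ s))) t n)) := by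
  induction n with
  | zero =>
    have : symmDiff s ∅ = s := symmDiff_bot s
    simpa [load, loadSet, this] using maps_nil s
  | succ n ih =>
    rw [load, List.range_succ, List.flatMap_append, List.flatMap_singleton]
    refine ih.append ?_
    have h := maps_loadBit (fun v => b v n) (wire_ne_nil t n)
      (symmDiff s (loadSet (b (decide (Data.nil ∈ s))) t n))
    have hnil : Data.nil ∈ symmDiff s (loadSet (b (decide (Data.nil ∈ s))) t n)
        ↔ Data.nil ∈ s := by
      simp [Finset.mem_symmDiff, nil_notMem_loadSet]
    simp only [hnil] at h
    rwa [symmDiff_assoc, ← loadSet_succ (b (decide (Data.nil ∈ s)))] at h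

/-- Flips the qubit `nil` if the qubit `w` differs from `v`. -/
def pivot (w : Data) (v : Bool) : Circuit :=
  Gate.CX w Data.nil :: if v then [Gate.X Data.nil] else []

theorem maps_pivot {w : Data} (hw : w ≠ Data.nil) (v : Bool) (s : Finset Data) :
    (pivot w v).Maps s (symmDiff s (if decide (w ∈ s) = v then ∅ else {Data.nil})) := by
  have e : ∀ s : Finset Data, symmDiff (symmDiff s {Data.nil}) {Data.nil} = s := fun s =>
    symmDiff_symmDiff_cancel_right _ _
  have e0 : ∀ s : Finset Data, symmDiff s ∅ = s := fun s => symmDiff_bot s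
  have h1 := maps_CX hw s
  have hp : pivot w v = [Gate.CX w Data.nil] ++ if v then [Gate.X Data.nil] else [] := rfl
  rw [hp]
  by_cases hs : w ∈ s <;> cases v <;>
    simp only [hs, if_true, if_false, e0, decide_true, decide_false, reduceCtorEq,
      List.append_nil, Bool.false_eq_true] at h1 ⊢
  · exact h1
  · simpa [e] using h1.append (maps_X Data.nil _)
  · exact h1
  · exact h1.append (maps_X Data.nil _)

/-- A Hadamard gate on the qubit `nil` followed by a circuit that permutes basis states prepares a
uniform superposition of two basis states. -/
theorem avg_run_H_cons {C : Circuit} {s₀ s₁ : Finset Data} (h0 : C.Maps ∅ s₀)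
    (h1 : C.Maps {Data.nil} s₁) (hne : s₀ ≠ s₁) (h : Finset Data → ℝ) :
    (Circuit.run (Gate.H Data.nil :: C) ∅).avg h = (h s₀ + h s₁) / 2 := by
  have lin : ∀ (C : Circuit) (z₀ z₁ : ℂ) (t₀ t₁ : QState Data),
      C.foldl (fun φ g => g.apply φ) (z₀ • t₀ + z₁ • t₁)
        = z₀ • C.foldl (fun φ g => g.apply φ) t₀ + z₁ • C.foldl (fun φ g => g.apply φ) t₁ := by
    intro C
    induction C with
    | nil => simp
    | cons g C ih => simp [Gate.apply_add, Gate.apply_smul, ih]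
  have e : (Gate.H Data.nil).apply (Finsupp.single ∅ 1)
      = ((1 / Real.sqrt 2 : ℝ) : ℂ) • Finsupp.single ∅ 1 +
        ((1 / Real.sqrt 2 : ℝ) : ℂ) • Finsupp.single {Data.nil} 1 := by
    rw [Gate.apply_single]
    simp [Gate.onBasis]
  rw [Maps, run] at h0 h1
  rw [run, List.foldl_cons, e, lin, h0, h1, QState.avg_add_of_disjoint, QState.avg_smul,
    QState.avg_smul, QState.avg_single, QState.avg_single, Gate.norm_sqrt_two_inv_sq]
  · simp
    ring
  · rw [Finset.disjoint_left]
    intro s hs hs'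
    have e0 := Finsupp.support_single_subset (Finsupp.support_smul hs)
    have e1 := Finsupp.support_single_subset (Finsupp.support_smul hs')
    rw [Finset.mem_singleton] at e0 e1
    exact hne (e0.symm.trans e1)

end Circuit

/-! ### Programs that write loading circuits -/

/-- The code of the gate `X w`. -/
def Expr.gateX (w : Expr) : Expr := cons nil (cons w nil)

/-- The code of the gate `CX a w`. -/
def Expr.gateCX (a w : Expr) : Expr := cons (num 3) (cons a (cons w nil))

/-- The code of the gate `H nil`. -/
def Expr.gateH : Expr := cons (num 1) nil

theorem Data.toCircuit_cons (g C : Data) : (cons g C).toCircuit = g.toGate :: C.toCircuit := rfl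

theorem Data.toCircuit_nil : nil.toCircuit = [] := rfl

theorem Expr.toGate_gateX (w : Expr) (σ : Store) :
    ((gateX w).eval σ).toGate = Gate.X (w.eval σ) := rfl

theorem Expr.toGate_gateCX (a w : Expr) (σ : Store) :
    ((gateCX a w).eval σ).toGate = Gate.CX (a.eval σ) (w.eval σ) := by
  simp [gateCX, eval, Data.toGate, Data.hd, Data.tl, Data.size_ofNat]

theorem Expr.toGate_gateH (σ : Store) : (gateH.eval σ).toGate = Gate.H Data.nil := by
  simp [gateH, eval, Data.toGate, Data.hd, Data.tl, Data.size_ofNat]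

namespace Cmd

/-- Decrements the counter `j` in variable `4` and measures qubit `j` of register `i` in both
samples, whose qubits are tagged with `1` and `2`.  If variable `9` is `nil`, the second outcome is
replaced by the first. -/
def readBits (i : ℕ) : Cmd :=
  seq (assign 4 (Expr.tl (Expr.var 4)))
  (seq (meas 5 (Expr.cons (Expr.num 1) (Expr.cons (Expr.num i) (Expr.var 4))))
  (seq (meas 6 (Expr.cons (Expr.num 2) (Expr.cons (Expr.num i) (Expr.var 4))))
  (ite (Expr.var 9) skip (assign 6 (Expr.var 5)))))

/-- Prepends gates to the circuit in variable `7` that load the bits in variables `5` and `6` into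
the qubit `w`.  If the bits differ, variable `8` receives a circuit that copies the branch from `w`
to the qubit `nil`. -/
def writeBits (w : Expr) : Cmd :=
  ite (Expr.var 5)
    (seq (assign 7 (Expr.cons (Expr.gateX w) (Expr.var 7)))
      (ite (Expr.var 6) skip
        (seq (assign 7 (Expr.cons (Expr.gateCX Expr.nil w) (Expr.var 7)))
          (assign 8 (Expr.cons (Expr.gateCX w Expr.nil)
            (Expr.cons (Expr.gateX Expr.nil) Expr.nil))))))
    (ite (Expr.var 6)
      (seq (assign 7 (Expr.cons (Expr.gateCX Expr.nil w) (Expr.var 7)))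
        (assign 8 (Expr.cons (Expr.gateCX w Expr.nil) Expr.nil)))
      skip)

/-- One round of `loadReg`. -/
def loadStep (i t : ℕ) : Cmd :=
  seq (readBits i) (writeBits (Expr.cons (Expr.num t) (Expr.var 4)))

/-- Loads both samples of register `i`, whose length is the size of the value of `e`, into
register `t`. -/
def loadReg (i t : ℕ) (e : Expr) : Cmd :=
  seq (seq (assign 4 Expr.nil) (count 4 e)) (loop (Expr.var 4) (loadStep i t))

/-- The bits of register `i` in the two samples `v₀` and `v₁`, the second being replaced by the
first unless `flag` is set. -/
def bits (flag : Bool) (v₀ v₁ : Finset Data) (i : ℕ) (b : Bool) (j : ℕ) : Bool :=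
  decide (wire i j ∈ if flag && b then v₁ else v₀)

theorem readSem_readBits (i : ℕ) {s v₀ v₁ : Finset Data} (hs : Tagged s v₀ v₁) (σ : Store)
    (j : ℕ) (h4 : σ 4 = Data.ofNat (j + 1)) :
    (readBits i).readSem s σ = Function.update (Function.update (Function.update σ 4 (Data.ofNat j))
      5 (Data.ofBit (bits (σ 9).isTrue v₀ v₁ i false j)))
      6 (Data.ofBit (bits (σ 9).isTrue v₀ v₁ i true j)) := by
  have m1 : Data.cons (Data.ofNat 1) (Data.cons (Data.ofNat i) (Data.ofNat j)) ∈ s ↔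
      wire i j ∈ v₀ := hs.1 _
  have m2 : Data.cons (Data.ofNat 2) (Data.cons (Data.ofNat i) (Data.ofNat j)) ∈ s ↔
      wire i j ∈ v₁ := hs.2 _
  rw [Data.ofNat_succ] at h4
  cases h9 : (σ 9).isTrue <;>
    simp [readBits, readSem, Expr.eval, h4, Data.tl, m1, m2, h9, bits]

theorem readSem_writeBits (w : Expr) (s : Finset Data) (σ : Store) (b₀ b₁ : Bool)
    (h5 : σ 5 = Data.ofBit b₀) (h6 : σ 6 = Data.ofBit b₁)
    (hw : ∀ d, w.eval (Function.update σ 7 d) = w.eval σ) :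
    (∀ x, x ∉ [7, 8] → (writeBits w).readSem s σ x = σ x) ∧
    ((writeBits w).readSem s σ 7).toCircuit
      = Circuit.loadBit (fun v => if v then b₁ else b₀) (w.eval σ) ++ (σ 7).toCircuit ∧
    (b₀ = b₁ → (writeBits w).readSem s σ 8 = σ 8) ∧
    (b₀ ≠ b₁ → (writeBits w).readSem s σ 8 ≠ Data.nil ∧
      ((writeBits w).readSem s σ 8).toCircuit = Circuit.pivot (w.eval σ) b₀) := by
  cases b₀ <;> cases b₁ <;>
    simp +contextual [writeBits, readSem, Expr.eval, h5, h6, Data.ofBit, Data.isTrue,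
      Data.toCircuit_cons, Expr.toGate_gateX, Expr.toGate_gateCX, Circuit.loadBit, Circuit.pivot,
      Data.toCircuit_nil, hw]

theorem readSem_loadStep (i t : ℕ) {s v₀ v₁ : Finset Data} (hs : Tagged s v₀ v₁) (σ : Store)
    (j : ℕ) (h4 : σ 4 = Data.ofNat (j + 1)) (B : Bool → ℕ → Bool)
    (hB : B = bits (σ 9).isTrue v₀ v₁ i) :
    (∀ x, x ∉ [4, 5, 6, 7, 8] → (loadStep i t).readSem s σ x = σ x) ∧
    (loadStep i t).readSem s σ 4 = Data.ofNat j ∧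
    ((loadStep i t).readSem s σ 7).toCircuit
      = Circuit.loadBit (fun v => B v j) (wire t j) ++ (σ 7).toCircuit ∧
    (B false j = B true j → (loadStep i t).readSem s σ 8 = σ 8) ∧
    (B false j ≠ B true j → (loadStep i t).readSem s σ 8 ≠ Data.nil ∧
      ((loadStep i t).readSem s σ 8).toCircuit = Circuit.pivot (wire t j) (B false j)) := by
  have hr := readSem_readBits i hs σ j h4
  rw [← hB] at hr
  simp only [loadStep, readSem]
  rw [hr]
  obtain ⟨h1, h2, h3, h4'⟩ := readSem_writeBits (Expr.cons (Expr.num t) (Expr.var 4)) s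
    (Function.update (Function.update (Function.update σ 4 (Data.ofNat j))
      5 (Data.ofBit (B false j))) 6 (Data.ofBit (B true j))) (B false j) (B true j) (by simp)
    (by simp) (by simp [Expr.eval])
  have hw : (Expr.cons (Expr.num t) (Expr.var 4)).eval (Function.update (Function.update
      (Function.update σ 4 (Data.ofNat j)) 5 (Data.ofBit (B false j))) 6 (Data.ofBit (B true j)))
      = wire t j := by
    simp [Expr.eval, wire]
  have hv : (fun v => if v = true then B true j else B false j) = fun v => B v j := by
    funext v
    cases v <;> rfl
  rw [hw] at h2 h4'
  rw [hv] at h2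
  refine ⟨fun x hx => ?_, by rw [h1 4 (by simp)]; simp, by simpa using h2, by simpa using h3, h4'⟩
  simp only [List.mem_cons, List.not_mem_nil, not_or, or_false] at hx
  rw [h1 x (by simp [hx])]
  simp [hx]

theorem readSem_loadLoop (i t : ℕ) {s v₀ v₁ : Finset Data} (hs : Tagged s v₀ v₁) (n : ℕ)
    (σ : Store) (h4 : σ 4 = Data.ofNat n) (B : Bool → ℕ → Bool)
    (hB : B = bits (σ 9).isTrue v₀ v₁ i) (σ' : Store)
    (hσ' : σ' = (readSem s (loadStep i t))^[n] σ) :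
    (∀ x, x ∉ [4, 5, 6, 7, 8] → σ' x = σ x) ∧
    (σ' 7).toCircuit = Circuit.load B t n ++ (σ 7).toCircuit ∧
    ((∀ j < n, B false j = B true j) → σ' 8 = σ 8) ∧
    ((∃ j < n, B false j ≠ B true j) → σ' 8 ≠ Data.nil ∧ ∃ j < n, B false j ≠ B true j ∧
      (σ' 8).toCircuit = Circuit.pivot (wire t j) (B false j)) := by
  induction n generalizing σ with
  | zero => subst hσ'; simp [Circuit.load]
  | succ n ih =>
    rw [Function.iterate_succ_apply] at hσ'
    obtain ⟨a1, a2, a3, a4, a5⟩ := readSem_loadStep i t hs σ n h4 B hB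
    obtain ⟨b1, b2, b3, b4⟩ := ih _ a2 (by rw [a1 9 (by simp)]; exact hB) hσ'
    refine ⟨fun x hx => (b1 x hx).trans (a1 x hx), ?_, fun h => ?_, fun h => ?_⟩
    · rw [b2, a3, Circuit.load, Circuit.load, List.range_succ, List.flatMap_append,
        List.flatMap_singleton, List.append_assoc]
    · rw [b3 fun j hj => h j (by omega), a4 (h n (by omega))]
    · by_cases hn : ∃ j < n, B false j ≠ B true j
      · obtain ⟨c1, j, hj, c2⟩ := b4 hn
        exact ⟨c1, j, by omega, c2⟩
      · have hn' : ∀ j < n, B false j = B true j := by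
          intro j hj
          by_contra hne
          exact hn ⟨j, hj, hne⟩
        obtain ⟨j, hj, hne⟩ := h
        obtain rfl : j = n := by
          by_contra hjn
          exact hne (hn' j (by omega))
        rw [b3 hn']
        exact ⟨(a5 hne).1, j, by omega, hne, (a5 hne).2⟩

/-- Variable `7` receives the loading circuit, and variable `8` a pivot if the two bit strings are
different, otherwise it keeps its value. -/
theorem readSem_loadReg (i t : ℕ) (e : Expr) {s v₀ v₁ : Finset Data} (hs : Tagged s v₀ v₁) (n : ℕ)
    (σ : Store) (he : (e.eval (Function.update σ 4 Data.nil)).size = n) (B : Bool → ℕ → Bool)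
    (hB : B = bits (σ 9).isTrue v₀ v₁ i) (σ' : Store) (hσ' : σ' = readSem s (loadReg i t e) σ) :
    (∀ x, x ∉ [4, 5, 6, 7, 8] → σ' x = σ x) ∧
    (σ' 7).toCircuit = Circuit.load B t n ++ (σ 7).toCircuit ∧
    ((∀ j < n, B false j = B true j) → σ' 8 = σ 8) ∧
    ((∃ j < n, B false j ≠ B true j) → σ' 8 ≠ Data.nil ∧ ∃ j < n, B false j ≠ B true j ∧
      (σ' 8).toCircuit = Circuit.pivot (wire t j) (B false j)) := by
  have h1 : readSem s (seq (assign 4 Expr.nil) (count 4 e)) σ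
      = Function.update σ 4 (Data.ofNat n) := by
    simp only [readSem]
    rw [readSem_count s 4 e _ 0 (by simp [Expr.eval, Data.ofNat_zero])]
    simp [Expr.eval, he]
  have h2 : σ' = (readSem s (loadStep i t))^[n] (Function.update σ 4 (Data.ofNat n)) := by
    have h3 : σ' = readSem s (loop (Expr.var 4) (loadStep i t))
      (readSem s (seq (assign 4 Expr.nil) (count 4 e)) σ) := hσ'
    rw [h3, h1]
    simp [readSem, Expr.eval, Data.size_ofNat]
  have := readSem_loadLoop i t hs n (Function.update σ 4 (Data.ofNat n)) (by simp) B
    (by simpa using hB) σ' h2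
  simp only [List.mem_cons, List.not_mem_nil, not_or, or_false] at this ⊢
  obtain ⟨a1, a2, a3, a4⟩ := this
  refine ⟨fun x hx => ?_, by simpa using a2, by simpa using a3, a4⟩
  rw [a1 x hx, Function.update_of_ne hx.1]

/-- Moves the gates in variable `1` one by one to the front of the circuit in variable `12`. -/
def flush : Cmd :=
  loop (Expr.var 1) (ite (Expr.var 1)
    (seq (assign 12 (Expr.cons (Expr.hd (Expr.var 1)) (Expr.var 12)))
      (assign 1 (Expr.tl (Expr.var 1)))) skip)

theorem readSem_flush (s : Finset Data) (σ : Store) :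
    (∀ x, x ≠ 1 → x ≠ 12 → flush.readSem s σ x = σ x) ∧
    (flush.readSem s σ 12).toCircuit = (σ 1).toCircuit.reverse ++ (σ 12).toCircuit := by
  have key : ∀ (n : ℕ) (σ : Store), (σ 1).toList.length ≤ n →
      (∀ x, x ≠ 1 → x ≠ 12 → (readSem s (ite (Expr.var 1)
        (seq (assign 12 (Expr.cons (Expr.hd (Expr.var 1)) (Expr.var 12)))
          (assign 1 (Expr.tl (Expr.var 1)))) skip))^[n] σ x = σ x) ∧
      ((readSem s (ite (Expr.var 1)
        (seq (assign 12 (Expr.cons (Expr.hd (Expr.var 1)) (Expr.var 12)))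
          (assign 1 (Expr.tl (Expr.var 1)))) skip))^[n] σ 12).toCircuit
        = (σ 1).toCircuit.reverse ++ (σ 12).toCircuit := by
    intro n
    induction n with
    | zero =>
      intro σ hσ
      have : (σ 1).toList = [] := List.length_eq_zero_iff.1 (by omega)
      simp [Data.toCircuit, this]
    | succ n ih =>
      intro σ hσ
      rw [Function.iterate_succ_apply]
      rcases h1 : σ 1 with _ | ⟨g, C⟩
      · have e : readSem s (ite (Expr.var 1)
            (seq (assign 12 (Expr.cons (Expr.hd (Expr.var 1)) (Expr.var 12)))
              (assign 1 (Expr.tl (Expr.var 1)))) skip) σ = σ := by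
          simp [readSem, Expr.eval, h1, Data.isTrue]
        rw [e]
        have := ih σ (by simp [h1, Data.toList])
        rwa [h1] at this
      · have e : readSem s (ite (Expr.var 1)
            (seq (assign 12 (Expr.cons (Expr.hd (Expr.var 1)) (Expr.var 12)))
              (assign 1 (Expr.tl (Expr.var 1)))) skip) σ
            = Function.update (Function.update σ 12 (Data.cons g (σ 12))) 1 C := by
          simp [readSem, Expr.eval, h1, Data.isTrue, Data.hd, Data.tl]
        rw [e]
        rw [h1, Data.toList, List.length_cons] at hσ
        obtain ⟨h2, h3⟩ := ih (Function.update (Function.update σ 12 (Data.cons g (σ 12))) 1 C)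
          (by simpa using by omega)
        refine ⟨fun x hx hx' => ?_, ?_⟩
        · rw [h2 x hx hx', Function.update_of_ne hx, Function.update_of_ne hx']
        · rw [h3]
          simp [Data.toCircuit_cons]
  exact key _ σ (Data.length_toList_le _)

end Cmd

/-! ### Measuring before or after encryption -/

theorem mem_regSet {i i' j k : ℕ} {x : Bits k} :
    wire i j ∈ regSet i' x ↔ i = i' ∧ ∃ h : j < k, x ⟨j, h⟩ = true := by
  simp only [regSet, Finset.mem_image, Finset.mem_filter, Finset.mem_univ, true_and, wire_inj]
  constructor
  · rintro ⟨l, hl, rfl, rfl⟩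
    exact ⟨rfl, l.2, hl⟩
  · rintro ⟨rfl, h, hx⟩
    exact ⟨⟨j, h⟩, hx, rfl, rfl⟩

theorem readReg_regSet_union {i k : ℕ} (x : Bits k) {s : Finset Data}
    (hs : ∀ j < k, wire i j ∉ s) : readReg i k (regSet i x ∪ s) = x := by
  funext j
  rw [readReg, Bool.eq_iff_iff, decide_eq_true_iff]
  simp [mem_regSet, hs j j.2]

/-- A basis state is given by the contents of two registers and its remaining qubits. -/
theorem regSet_union_sdiff (m ρ : ℕ) (s : Finset Data) :
    regSet 0 (readReg 0 m s) ∪ regSet 1 (readReg 1 ρ s) ∪ (s \ EncFormData.wiresMR m ρ) = s := by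
  have h : ∀ i k w, w ∈ regSet i (readReg i k s) ↔
      w ∈ s ∧ w ∈ regSet i (fun _ : Fin k => true) := by
    intro i k w
    simp only [regSet, readReg, Finset.mem_image, Finset.mem_filter, Finset.mem_univ, true_and,
      decide_eq_true_iff]
    constructor
    · rintro ⟨j, hj, rfl⟩
      exact ⟨hj, j, rfl⟩
    · rintro ⟨hw, j, rfl⟩
      exact ⟨j, hw, rfl⟩
  ext w
  simp only [Finset.mem_union, Finset.mem_sdiff, h, EncFormData.wiresMR]
  tauto

/-- Expectation over the contents of two registers, with the remaining qubits summed over the values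
`e` that occur in the support of the state. -/
theorem sum_regSet_eq_avg (m ρ : ℕ) (χ : QState Data) (G : Bits m → Bits ρ → ℝ) :
    ∑ z, ∑ e ∈ χ.support.image (fun s => s \ EncFormData.wiresMR m ρ), ∑ x,
      ‖χ (regSet 0 x ∪ regSet 1 z ∪ e)‖ ^ 2 * G x z
      = χ.avg fun s => G (readReg 0 m s) (readReg 1 ρ s) := by
  rw [← Finset.sum_product', ← Finset.sum_product', QState.avg, Finsupp.sum]
  symm
  refine Finset.sum_of_injOn
    (fun s => ((readReg 1 ρ s, s \ EncFormData.wiresMR m ρ), readReg 0 m s)) ?_ ?_ ?_ ?_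
  · intro s _ t _ h
    simp only [Prod.mk.injEq] at h
    rw [← regSet_union_sdiff m ρ s, h.1.1, h.1.2, h.2, regSet_union_sdiff]
  · intro s hs
    simp only [Finset.coe_product, Set.mem_prod, Finset.mem_coe, Finset.mem_univ, true_and,
      and_true]
    exact Finset.mem_image_of_mem _ hs
  · rintro ⟨⟨z, e⟩, x⟩ h1 h2
    simp only [Finset.mem_product, Finset.mem_univ, true_and, and_true] at h1
    obtain ⟨t, _, rfl⟩ := Finset.mem_image.1 h1
    by_contra hne
    set s := regSet 0 x ∪ regSet 1 z ∪ (t \ EncFormData.wiresMR m ρ) with hs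
    have hmem : s ∈ χ.support := by
      rw [Finsupp.mem_support_iff]
      intro h0
      apply hne
      simp [h0]
    apply h2
    have hw : ∀ w, w ∈ t \ EncFormData.wiresMR m ρ → w ∉ EncFormData.wiresMR m ρ := fun w hw =>
      (Finset.mem_sdiff.1 hw).2
    have n0 : ∀ j < m, wire 0 j ∉ t \ EncFormData.wiresMR m ρ := fun j hj h =>
      hw _ h (Finset.mem_union_left _ (mem_regSet.2 ⟨rfl, hj, rfl⟩))
    have n1 : ∀ j < ρ, wire 1 j ∉ t \ EncFormData.wiresMR m ρ := fun j hj h =>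
      hw _ h (Finset.mem_union_right _ (mem_regSet.2 ⟨rfl, hj, rfl⟩))
    refine ⟨s, hmem, ?_⟩
    simp only [Prod.mk.injEq]
    refine ⟨⟨?_, ?_⟩, ?_⟩
    · rw [hs, Finset.union_comm (regSet 0 x), Finset.union_assoc]
      exact readReg_regSet_union _ fun j hj => by simp [mem_regSet, n1 j hj]
    · ext w
      simp only [hs, Finset.mem_sdiff, Finset.mem_union]
      have h3 : w ∈ regSet 0 x → w ∈ EncFormData.wiresMR m ρ := by
        intro h
        obtain ⟨j, _, rfl⟩ := Finset.mem_image.1 h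
        exact Finset.mem_union_left _ (mem_regSet.2 ⟨rfl, j.2, rfl⟩)
      have h4 : w ∈ regSet 1 z → w ∈ EncFormData.wiresMR m ρ := by
        intro h
        obtain ⟨j, _, rfl⟩ := Finset.mem_image.1 h
        exact Finset.mem_union_right _ (mem_regSet.2 ⟨rfl, j.2, rfl⟩)
      tauto
    · rw [hs, Finset.union_assoc]
      exact readReg_regSet_union _ fun j hj => by simp [mem_regSet, n0 j hj]
  · intro s _
    simp only [regSet_union_sdiff]

namespace EncFormData

variable {S : SchemeData} (D : EncFormData S)

/-- Different plaintexts lead to orthogonal vectors, even for different randomness `r` and `r'`. -/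
theorem sum_star_amp_mul_amp (n : ℕ) (k : Data) (r r' : Bits (S.tagLen n))
    {x x' : Bits (S.msgLen n)} (h : x ≠ x') :
    star (D.amp n k r x) ⬝ᵥ D.amp n k r' x' = 0 := by
  have hV : star (D.V n k).1 * (D.V n k).1 = 1 := (Matrix.mem_unitaryGroup_iff').1 (D.V n k).2
  have e : ∀ r x, D.amp n k r x
      = Matrix.mulVec (D.V n k).1 fun i => if i.1 = x then D.ψ n k r i.2 else 0 := by
    intro r x
    funext y
    rw [amp, Matrix.mulVec, dotProduct, Fintype.sum_prod_type,
      Finset.sum_eq_single x (fun b _ hb => by simp [hb]) (by simp)]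
    simp
  rw [e, e, Matrix.star_mulVec, Matrix.dotProduct_mulVec, Matrix.vecMul_vecMul,
    ← Matrix.star_eq_conjTranspose, hV, Matrix.vecMul_one, dotProduct]
  refine Finset.sum_eq_zero fun i _ => ?_
  by_cases hi : i.1 = x
  · simp [hi, h]
  · simp [hi]

/-- The diagonal of `encState`: the probability that the outcome of sampling `r` and applying the
unitary to `x` is `y`. -/
def encDiag (n : ℕ) (k : Data) (x : Bits (S.msgLen n))
    (y : Bits (S.msgLen n) × Bits (S.tagLen n)) : ℝ :=
  ∑ r, D.p n k r * ‖D.amp n k r x y‖ ^ 2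

theorem encState_apply_self (n : ℕ) (k : Data) (x : Bits (S.msgLen n))
    (y : Bits (S.msgLen n) × Bits (S.tagLen n)) :
    D.encState n k x y y = (D.encDiag n k x y : ℂ) := by
  simp [encState, encDiag, Matrix.sum_apply, Matrix.vecMulVec_apply, Complex.mul_conj']

theorem encState_mul_encState (n : ℕ) (k : Data) {x x' : Bits (S.msgLen n)} (h : x ≠ x') :
    D.encState n k x * D.encState n k x' = 0 := by
  rw [encState, encState, Finset.sum_mul]
  refine Finset.sum_eq_zero fun r _ => ?_
  rw [Finset.mul_sum]
  refine Finset.sum_eq_zero fun r' _ => ?_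
  rw [smul_mul_smul_comm, Matrix.vecMulVec_mul_vecMulVec, D.sum_star_amp_mul_amp n k r r' h]
  simp

end EncFormData

namespace EncForm

variable {S : SchemeData} (D : EncForm S)

/-- Different plaintexts never lead to the same ciphertext: the diagonal states `encState x` and
`encState x'` are orthogonal. -/
theorem amp_eq_zero_or (n : ℕ) {k : Data} (hk : k ∈ S.keys n) (r : Bits (S.tagLen n))
    {x x' : Bits (S.msgLen n)} (h : x ≠ x') (y : Bits (S.msgLen n) × Bits (S.tagLen n)) :
    D.p n k r = 0 ∨ D.amp n k r x y = 0 ∨ D.amp n k r x' y = 0 := by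
  have h1 : (D.encState n k x * D.encState n k x') y y = 0 := by
    rw [D.encState_mul_encState n k h]
    rfl
  rw [Matrix.mul_apply, Finset.sum_eq_single y
    (fun b _ hb => by rw [D.classical n k hk x hb.symm, zero_mul]) (by simp),
    D.encState_apply_self, D.encState_apply_self, ← Complex.ofReal_mul, Complex.ofReal_eq_zero,
    mul_eq_zero] at h1
  have h2 : ∀ x, D.encDiag n k x y = 0 → D.p n k r = 0 ∨ D.amp n k r x y = 0 := by
    intro x hx
    rw [EncFormData.encDiag, Finset.sum_eq_zero_iff_of_nonneg
      fun r _ => mul_nonneg (D.p_nonneg n k hk r) (sq_nonneg _)] at hx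
    simpa using hx r (Finset.mem_univ _)
  rcases h1 with h1 | h1
  · rcases h2 x h1 with h3 | h3
    · exact Or.inl h3
    · exact Or.inr (Or.inl h3)
  · rcases h2 x' h1 with h3 | h3
    · exact Or.inl h3
    · exact Or.inr (Or.inr h3)

theorem norm_sum_sq_of_subsingleton {ι : Type*} [Fintype ι] (f : ι → ℂ)
    (h : ∀ i j, i ≠ j → f i = 0 ∨ f j = 0) : ‖∑ i, f i‖ ^ 2 = ∑ i, ‖f i‖ ^ 2 := by
  by_cases h0 : ∃ i, f i ≠ 0
  · obtain ⟨i, hi⟩ := h0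
    have hz : ∀ j, j ≠ i → f j = 0 := fun j hj => (h i j hj.symm).resolve_left hi
    rw [Finset.sum_eq_single i (fun j _ hj => hz j hj) (by simp),
      Finset.sum_eq_single i (fun j _ hj => by simp [hz j hj]) (by simp)]
  · have hz : ∀ i, f i = 0 := fun i => by
      by_contra hi
      exact h0 ⟨i, hi⟩
    simp [hz]

/-- Coherences between different plaintexts do not matter: encrypting `U|0⟩` and then measuring
`MTR` is the same as measuring `MR` and then encrypting the outcome in `M`. -/
theorem sum_prepProb (n : ℕ) {k : Data} (hk : k ∈ S.keys n) (U : Circuit) {ρ : ℕ}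
    (g : Bits (S.msgLen n) × Bits (S.tagLen n) → Bits ρ → ℝ) :
    ∑ r, D.p n k r * ∑ y, ∑ z, D.prepProb n k U r y z * g y z
      = (U.run ∅).avg fun s => ∑ y, D.encDiag n k (readReg 0 _ s) y * g y (readReg 1 ρ s) := by
  rw [← sum_regSet_eq_avg (S.msgLen n) ρ (U.run ∅) fun x z => ∑ y, D.encDiag n k x y * g y z]
  set E := (U.run ∅).support.image fun s => s \ EncFormData.wiresMR (S.msgLen n) ρ with hE
  have h1 : ∀ r y (z : Bits ρ), D.p n k r * D.prepProb n k U r y z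
      = ∑ e ∈ E, ∑ x, ‖U.run ∅ (regSet 0 x ∪ regSet 1 z ∪ e)‖ ^ 2 *
          (D.p n k r * ‖D.amp n k r x y‖ ^ 2) := by
    intro r y z
    rw [EncFormData.prepProb, Finset.mul_sum]
    refine Finset.sum_congr rfl fun e _ => ?_
    by_cases hp : D.p n k r = 0
    · simp [hp]
    · rw [EncFormData.prepAmp, norm_sum_sq_of_subsingleton, Finset.mul_sum]
      · refine Finset.sum_congr rfl fun x _ => ?_
        rw [norm_mul]
        ring
      · intro x x' hx
        rcases D.amp_eq_zero_or n hk r hx y with h | h | h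
        · exact absurd h hp
        · exact Or.inl (by rw [h, mul_zero])
        · exact Or.inr (by rw [h, mul_zero])
  have h2 : ∀ r, D.p n k r * ∑ y, ∑ z, D.prepProb n k U r y z * g y z
      = ∑ z, ∑ e ∈ E, ∑ x, ∑ y, ‖U.run ∅ (regSet 0 x ∪ regSet 1 z ∪ e)‖ ^ 2 *
          (D.p n k r * ‖D.amp n k r x y‖ ^ 2 * g y z) := by
    intro r
    rw [Finset.sum_comm, Finset.mul_sum]
    refine Finset.sum_congr rfl fun z _ => ?_
    have : ∀ e ∈ E, ∑ x, ∑ y, ‖U.run ∅ (regSet 0 x ∪ regSet 1 z ∪ e)‖ ^ 2 *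
          (D.p n k r * ‖D.amp n k r x y‖ ^ 2 * g y z)
        = ∑ y, ∑ x, ‖U.run ∅ (regSet 0 x ∪ regSet 1 z ∪ e)‖ ^ 2 *
          (D.p n k r * ‖D.amp n k r x y‖ ^ 2 * g y z) := fun e _ => Finset.sum_comm
    rw [Finset.sum_congr rfl this, Finset.sum_comm, Finset.mul_sum]
    refine Finset.sum_congr rfl fun y _ => ?_
    rw [← mul_assoc, h1, Finset.sum_mul]
    refine Finset.sum_congr rfl fun e _ => ?_
    rw [Finset.sum_mul]
    exact Finset.sum_congr rfl fun x _ => by ring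
  simp only [h2]
  rw [Finset.sum_comm]
  refine Finset.sum_congr rfl fun z _ => ?_
  rw [Finset.sum_comm]
  refine Finset.sum_congr rfl fun e _ => ?_
  rw [Finset.sum_comm]
  refine Finset.sum_congr rfl fun x _ => ?_
  rw [Finset.sum_comm, Finset.mul_sum]
  refine Finset.sum_congr rfl fun y _ => ?_
  rw [EncFormData.encDiag, Finset.sum_mul, Finset.mul_sum]

end EncForm

/-! ### A reversible circuit that exchanges plaintexts for register contents -/

namespace Circuit

theorem loadSet_union_eq_symmDiff {f : ℕ → Bool} {n : ℕ} {R : Finset Data}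
    (hR : ∀ j, wire 0 j ∉ R) : loadSet f 0 n ∪ R = symmDiff (loadSet f 0 n) R := by
  refine (Disjoint.symmDiff_eq_sup ?_).symm
  rw [Finset.disjoint_left]
  intro w hw hw'
  obtain ⟨j, _, rfl⟩ := Finset.mem_image.1 hw
  exact hR j hw'

/-- The circuit `p` is a pivot of the pair of bit strings `B false`, `B true` in register `0`. -/
def IsPivot (B : Bool → ℕ → Bool) (n : ℕ) (p : Circuit) : Prop :=
  ((∀ j < n, B false j = B true j) → p = []) ∧
  ((∃ j < n, B false j ≠ B true j) → ∃ j < n, B false j ≠ B true j ∧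
    p = pivot (wire 0 j) (B false j))

theorem IsPivot.maps {B : Bool → ℕ → Bool} {n : ℕ} {p : Circuit} (h : IsPivot B n p) {b β : Bool}
    (hβ : β = if ∀ j < n, B false j = B true j then false else b) {R s : Finset Data}
    (hs : ∀ j < n, wire 0 j ∈ s ↔ B b j = true) (hR : R = if β then {Data.nil} else ∅) :
    p.Maps s (symmDiff s R) := by
  subst hR
  by_cases hB : ∀ j < n, B false j = B true j
  · rw [h.1 hB, hβ, if_pos hB]
    have : symmDiff s ∅ = s := symmDiff_bot s
    simpa [this] using maps_nil s
  · rw [if_neg hB] at hβ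
    subst hβ
    obtain ⟨j, hj, hne, rfl⟩ := h.2 (by
      by_contra hcon
      exact hB fun j hj => by
        by_contra hne
        exact hcon ⟨j, hj, hne⟩)
    have h1 := maps_pivot (wire_ne_nil 0 j) (B false j) s
    have h2 : decide (wire 0 j ∈ s) = B β j := by
      rw [Bool.eq_iff_iff, decide_eq_true_iff]
      exact hs j hj
    rw [h2] at h1
    cases β
    · simpa using h1
    · simpa [hne.symm] using h1

/-- If the bit strings `BX false`, `BX true` are different only when `BZ false`, `BZ true` are, the
circuit replaces `BX b` in register `0` by `BZ b`: the branch is copied to the qubit `nil`, register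
`0` is cleared, then it is loaded, and finally the branch is uncomputed from its new content. -/
theorem maps_exchange {BX BZ : Bool → ℕ → Bool} {m ρ : ℕ} {px pz : Circuit} (hx : IsPivot BX m px)
    (hz : IsPivot BZ ρ pz)
    (hdeg : (∀ j < ρ, BZ false j = BZ true j) → ∀ j < m, BX false j = BX true j) {b β : Bool}
    (hβ : β = if ∀ j < m, BX false j = BX true j then false else b) {R : Finset Data}
    (hnil : Data.nil ∉ R) (hR : ∀ j, wire 0 j ∉ R) :
    Maps (px ++ (load BX 0 m ++ (load BZ 0 ρ ++ pz))) (loadSet (BX b) 0 m ∪ R)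
      (loadSet (BZ β) 0 ρ ∪ R) := by
  rw [loadSet_union_eq_symmDiff hR, loadSet_union_eq_symmDiff hR]
  set N : Finset Data := if β then {Data.nil} else ∅ with hN
  have hNw : ∀ i j, wire i j ∉ N := by
    intro i j
    rw [hN]
    split_ifs <;> simp [wire_ne_nil]
  have hNnil : Data.nil ∈ N ↔ β = true := by
    rw [hN]
    split_ifs with h <;> simp [h]
  have hXb : loadSet (BX b) 0 m = loadSet (BX β) 0 m := by
    by_cases hB : ∀ j < m, BX false j = BX true j
    · refine loadSet_congr fun j hj => ?_
      cases b <;> cases β <;> simp [hB j hj]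
    · rw [if_neg hB] at hβ
      rw [hβ]
  have hββ : β = if ∀ j < ρ, BZ false j = BZ true j then false else β := by
    split_ifs with hB
    · rw [hβ, if_pos (hdeg hB)]
    · rfl
  -- The four steps: copy the branch, clear register `0`, load it, uncompute the branch.
  have e1 := hx.maps hβ (s := symmDiff (loadSet (BX b) 0 m) R) (fun j hj => by
    simp [Finset.mem_symmDiff, mem_loadSet, hR, hj]) hN
  have e2 := maps_load BX 0 m (symmDiff (symmDiff (loadSet (BX b) 0 m) R) N)
  have d2 : decide (Data.nil ∈ symmDiff (symmDiff (loadSet (BX b) 0 m) R) N) = β := by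
    rw [Bool.eq_iff_iff, decide_eq_true_iff]
    simp [Finset.mem_symmDiff, nil_notMem_loadSet, hnil, hNnil]
  rw [d2, ← hXb] at e2
  have c2 : symmDiff (symmDiff (symmDiff (loadSet (BX b) 0 m) R) N) (loadSet (BX b) 0 m)
      = symmDiff R N := by
    rw [symmDiff_comm _ (loadSet (BX b) 0 m), symmDiff_assoc, symmDiff_symmDiff_cancel_left]
  rw [c2] at e2
  have e3 := maps_load BZ 0 ρ (symmDiff R N)
  have d3 : decide (Data.nil ∈ symmDiff R N) = β := by
    rw [Bool.eq_iff_iff, decide_eq_true_iff]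
    simp [Finset.mem_symmDiff, hnil, hNnil]
  rw [d3] at e3
  have e4 := hz.maps hββ (s := symmDiff (symmDiff R N) (loadSet (BZ β) 0 ρ)) (fun j hj => by
    simp [Finset.mem_symmDiff, mem_loadSet, hR, hNw, hj]) hN
  have c4 : symmDiff (symmDiff (symmDiff R N) (loadSet (BZ β) 0 ρ)) N
      = symmDiff (loadSet (BZ β) 0 ρ) R := by
    rw [symmDiff_comm (symmDiff R N), symmDiff_assoc, symmDiff_assoc, symmDiff_self,
      symmDiff_bot]
  rw [c4] at e4
  exact e1.append (e2.append (e3.append e4))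

theorem notMem_regSets {m : ℕ} {w : Data} (i : ℕ) (xs : List (Bits m))
    (hw : ∀ i' j, i ≤ i' → w ≠ wire i' j) : w ∉ regSets i xs := by
  induction xs generalizing i with
  | nil => simp [regSets]
  | cons x xs ih =>
    rw [regSets, Finset.mem_union, not_or]
    refine ⟨fun h => ?_, ih (i + 1) fun i' j h => hw i' j (by omega)⟩
    obtain ⟨j, _, rfl⟩ := Finset.mem_image.1 h
    exact hw i j le_rfl rfl

/-- With the exchanging circuit in front, the measurement `E` on `BX b` becomes one on `BZ b`. -/
theorem accept_exchange {BX BZ : Bool → ℕ → Bool} {m ρ : ℕ} {px pz : Circuit}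
    (hx : IsPivot BX m px) (hz : IsPivot BZ ρ pz)
    (hdeg : (∀ j < ρ, BZ false j = BZ true j) → ∀ j < m, BX false j = BX true j) {b β : Bool}
    (hβ : β = if ∀ j < m, BX false j = BX true j then false else b) (E : Circuit) {l : ℕ}
    (xs : List (Bits l)) :
    accept (px ++ (load BX 0 m ++ (load BZ 0 ρ ++ pz)) ++ E) (fun j : Fin m => BX b j) xs
      = accept E (fun j : Fin ρ => BZ β j) xs := by
  rw [accept, accept, regSet_eq_loadSet, regSet_eq_loadSet, run_append _ E
    (maps_exchange hx hz hdeg hβ (notMem_regSets 1 xs fun i j _ => (wire_ne_nil i j).symm)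
      fun j => notMem_regSets 1 xs fun i' j' hi h => by
        have := (wire_inj.1 h).1
        omega)]

end Circuit

/-! ### The adversaries of the reductions -/

namespace Cmd

/-- Sequential composition of a list of programs. -/
def seqs : List Cmd → Cmd
  | [] => skip
  | c :: l => seq c (seqs l)

theorem PolyGrowth.seqs {l : List Cmd} (h : ∀ c ∈ l, c.PolyGrowth) : (seqs l).PolyGrowth := by
  induction l with
  | nil => exact PolyGrowth.of_tame [] rfl
  | cons c l ih =>
    exact (h c (by simp)).seq (ih fun d hd => h d (by simp [hd]))

/-- Moves the gates in variable `x` to the front of the circuit in variable `12`. -/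
def move (x : ℕ) : Cmd := seq (assign 1 (Expr.var x)) flush

theorem readSem_move (s : Finset Data) (x : ℕ) (σ : Store) :
    (∀ y, y ≠ 1 → y ≠ 12 → (move x).readSem s σ y = σ y) ∧
    ((move x).readSem s σ 12).toCircuit = (σ x).toCircuit.reverse ++ (σ 12).toCircuit := by
  obtain ⟨h1, h2⟩ := readSem_flush s (Function.update σ 1 (σ x))
  refine ⟨fun y hy hy' => ?_, ?_⟩
  · exact (h1 y hy hy').trans (Function.update_of_ne hy _ _)
  · exact h2.trans (by simp)

/-- Having two samples of both registers, outputs a circuit for the uniform distribution on the two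
plaintexts and a circuit that exchanges them for the two contents of register `1`, in reverse order.
The pivot of the latter, which is `nil` if they are equal, is also the flag in variable `9` when the
plaintexts are read: equal contents cause the second plaintext to be replaced by the first one. -/
def exchangeProgram : Cmd :=
  seqs [assign 7 Expr.nil, assign 8 Expr.nil, assign 9 (Expr.num 1),
    loadReg 1 0 (Expr.hd (Expr.var 16)),
    assign 11 (Expr.var 7), assign 10 (Expr.var 8), assign 9 (Expr.var 8), assign 7 Expr.nil,
    assign 8 Expr.nil, loadReg 0 0 (Expr.hd (Expr.tl (Expr.var 0))),
    assign 12 Expr.nil, move 8, move 7, move 11, move 10,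
    assign 0 (Expr.cons (Expr.cons Expr.gateH (Expr.var 7))
      (Expr.cons (Expr.var 12) (Expr.tl (Expr.tl (Expr.var 16)))))]

theorem toCircuit_isPivot {B : Bool → ℕ → Bool} {n : ℕ} {d : Data}
    (h1 : (∀ j < n, B false j = B true j) → d = Data.nil)
    (h2 : (∃ j < n, B false j ≠ B true j) → d ≠ Data.nil ∧ ∃ j < n, B false j ≠ B true j ∧
      d.toCircuit = Circuit.pivot (wire 0 j) (B false j)) : Circuit.IsPivot B n d.toCircuit :=
  ⟨fun h => by rw [h1 h, Data.toCircuit_nil], fun h => (h2 h).2⟩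

theorem readSem_exchangeProgram {s v₀ v₁ : Finset Data} (hs : Tagged s v₀ v₁) (σ : Store)
    (m ρ : ℕ) (hm : (σ 0).tl.hd.size = m) (hρ : (σ 16).hd.size = ρ) (flag : Bool)
    (hflag : flag = !decide (∀ j < ρ, bits true v₀ v₁ 1 false j = bits true v₀ v₁ 1 true j))
    (o : Data) (ho : o = exchangeProgram.readSem s σ 0) :
    ∃ px pz, Circuit.IsPivot (bits flag v₀ v₁ 0) m px ∧
      Circuit.IsPivot (bits true v₀ v₁ 1) ρ pz ∧
      o.hd.toCircuit = Gate.H Data.nil :: Circuit.load (bits flag v₀ v₁ 0) 0 m ∧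
      o.tl.hd.toCircuit.reverse = px ++ (Circuit.load (bits flag v₀ v₁ 0) 0 m ++
        (Circuit.load (bits true v₀ v₁ 1) 0 ρ ++ pz)) ∧
      o.tl.tl = (σ 16).tl.tl := by
  simp only [exchangeProgram, seqs, readSem, id] at ho
  set σ₁ := Function.update (Function.update (Function.update σ 7 (Expr.nil.eval σ)) 8
    (Expr.nil.eval _)) 9 ((Expr.num 1).eval _) with hσ₁
  set σ₂ := readSem s (loadReg 1 0 (Expr.hd (Expr.var 16))) σ₁ with hσ₂
  set σ₃ := Function.update (Function.update (Function.update (Function.update (Function.update σ₂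
    11 ((Expr.var 7).eval _)) 10 ((Expr.var 8).eval _)) 9 ((Expr.var 8).eval _)) 7
    (Expr.nil.eval _)) 8 (Expr.nil.eval _) with hσ₃
  set σ₄ := readSem s (loadReg 0 0 (Expr.hd (Expr.tl (Expr.var 0)))) σ₃ with hσ₄
  set σ₅ := Function.update σ₄ 12 (Expr.nil.eval _) with hσ₅
  have f9 : (σ₁ 9).isTrue = true := by simp [hσ₁, Data.ofNat_succ, Data.isTrue]
  have f16 : σ₁ 16 = σ 16 := by simp [hσ₁]
  have f0 : σ₁ 0 = σ 0 := by simp [hσ₁]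
  obtain ⟨a1, a2, a3, a4⟩ := readSem_loadReg 1 0 (Expr.hd (Expr.var 16)) hs ρ σ₁
    (by simp [Expr.eval, f16, hρ]) (bits true v₀ v₁ 1) (by rw [f9]) σ₂ hσ₂
  have a8 : σ₁ 8 = Data.nil := by simp [hσ₁, Expr.eval]
  have a7 : (σ₁ 7).toCircuit = [] := by simp [hσ₁, Expr.eval, Data.toCircuit_nil]
  rw [a7, List.append_nil] at a2
  rw [a8] at a3
  have hz := toCircuit_isPivot a3 a4
  have g9 : (σ₃ 9).isTrue = flag := by
    have : σ₃ 9 = σ₂ 8 := by simp [hσ₃, Expr.eval]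
    rw [this, hflag]
    by_cases hB : ∀ j < ρ, bits true v₀ v₁ 1 false j = bits true v₀ v₁ 1 true j
    · rw [a3 hB, decide_eq_true hB]
      rfl
    · have hne : σ₂ 8 ≠ Data.nil := (a4 (by
        by_contra hcon
        exact hB fun j hj => by
          by_contra hne
          exact hcon ⟨j, hj, hne⟩)).1
      rw [decide_eq_false hB]
      cases h8 : σ₂ 8 with
      | nil => exact absurd h8 hne
      | cons a b => rfl
  have g0 : σ₃ 0 = σ 0 := by simp [hσ₃, a1 0, f0]
  have g16 : σ₃ 16 = σ 16 := by simp [hσ₃, a1 16, f16]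
  have g11 : σ₃ 11 = σ₂ 7 := by simp [hσ₃, Expr.eval]
  have g10 : σ₃ 10 = σ₂ 8 := by simp [hσ₃, Expr.eval]
  obtain ⟨b1, b2, b3, b4⟩ := readSem_loadReg 0 0 (Expr.hd (Expr.tl (Expr.var 0))) hs m σ₃
    (by simp [Expr.eval, g0, hm]) (bits flag v₀ v₁ 0) (by rw [g9]) σ₄ hσ₄
  have b8 : σ₃ 8 = Data.nil := by simp [hσ₃, Expr.eval]
  have b7 : (σ₃ 7).toCircuit = [] := by simp [hσ₃, Expr.eval, Data.toCircuit_nil]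
  rw [b7, List.append_nil] at b2
  rw [b8] at b3
  have hx := toCircuit_isPivot b3 b4
  have h5 : ∀ y, y ≠ 12 → σ₅ y = σ₄ y := fun y hy => by simp [hσ₅, hy]
  have h512 : (σ₅ 12).toCircuit = [] := by simp [hσ₅, Expr.eval, Data.toCircuit_nil]
  obtain ⟨c1, c2⟩ := readSem_move s 8 σ₅
  set σ₆ := (move 8).readSem s σ₅ with hσ₆
  obtain ⟨d1, d2⟩ := readSem_move s 7 σ₆
  set σ₇ := (move 7).readSem s σ₆ with hσ₇
  obtain ⟨e1, e2⟩ := readSem_move s 11 σ₇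
  set σ₈ := (move 11).readSem s σ₇ with hσ₈
  obtain ⟨k1, k2⟩ := readSem_move s 10 σ₈
  set σ₉ := (move 10).readSem s σ₈ with hσ₉
  have t : ∀ y, y ≠ 1 → y ≠ 12 → σ₉ y = σ₄ y := fun y h1 h12 => by
    rw [k1 y h1 h12, e1 y h1 h12, d1 y h1 h12, c1 y h1 h12, h5 y h12]
  have hP : (σ₉ 12).toCircuit = (σ₂ 8).toCircuit.reverse ++ ((σ₂ 7).toCircuit.reverse ++
      ((σ₄ 7).toCircuit.reverse ++ (σ₄ 8).toCircuit.reverse)) := by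
    rw [k2, e2, d2, c2, h512, List.append_nil, h5 8 (by omega),
      c1 7 (by omega) (by omega), h5 7 (by omega), d1 11 (by omega) (by omega),
      c1 11 (by omega) (by omega), h5 11 (by omega), e1 10 (by omega) (by omega),
      d1 10 (by omega) (by omega), c1 10 (by omega) (by omega), h5 10 (by omega),
      b1 11 (by simp), b1 10 (by simp), g11, g10]
  have ho' : o = Data.cons (Data.cons (Expr.gateH.eval σ₉) (σ₉ 7))
      (Data.cons (σ₉ 12) (σ₉ 16).tl.tl) := by
    rw [ho]
    simp [Expr.eval]
  refine ⟨_, _, hx, hz, ?_, ?_, ?_⟩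
  · rw [ho']
    simp only [Data.hd]
    rw [Data.toCircuit_cons, Expr.toGate_gateH, t 7 (by omega) (by omega), b2]
  · rw [ho']
    simp only [Data.tl, Data.hd]
    rw [hP, b2, a2]
    simp
  · rw [ho', t 16 (by omega) (by omega), b1 16 (by simp), g16]
    rfl

/-- Having two samples of register `0`, outputs a circuit for the uniform distribution on the two
plaintexts, with a copy of the plaintext in register `1`. -/
def copyProgram : Cmd :=
  seqs [assign 7 Expr.nil, assign 9 (Expr.num 1),
    loadReg 0 0 (Expr.hd (Expr.tl (Expr.var 0))), loadReg 0 1 (Expr.hd (Expr.tl (Expr.var 0))),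
    assign 0 (Expr.cons (Expr.hd (Expr.tl (Expr.var 0)))
      (Expr.cons (Expr.cons Expr.gateH (Expr.var 7)) (Expr.tl (Expr.var 16))))]

theorem readSem_copyProgram {s v₀ v₁ : Finset Data} (hs : Tagged s v₀ v₁) (σ : Store)
    (m : ℕ) (hm : (σ 0).tl.hd.size = m) (o : Data) (ho : o = copyProgram.readSem s σ 0) :
    o.hd = (σ 0).tl.hd ∧
    o.tl.hd.toCircuit = Gate.H Data.nil :: (Circuit.load (bits true v₀ v₁ 0) 1 m ++
      Circuit.load (bits true v₀ v₁ 0) 0 m) ∧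
    o.tl.tl = (σ 16).tl := by
  simp only [copyProgram, seqs, readSem, id] at ho
  set σ₁ := Function.update (Function.update σ 7 (Expr.nil.eval σ)) 9 ((Expr.num 1).eval _)
    with hσ₁
  set σ₂ := readSem s (loadReg 0 0 (Expr.hd (Expr.tl (Expr.var 0)))) σ₁ with hσ₂
  set σ₃ := readSem s (loadReg 0 1 (Expr.hd (Expr.tl (Expr.var 0)))) σ₂ with hσ₃
  have f9 : (σ₁ 9).isTrue = true := by simp [hσ₁, Data.ofNat_succ, Data.isTrue]
  have f16 : σ₁ 16 = σ 16 := by simp [hσ₁]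
  have f0 : σ₁ 0 = σ 0 := by simp [hσ₁]
  have f7 : (σ₁ 7).toCircuit = [] := by simp [hσ₁, Expr.eval, Data.toCircuit_nil]
  obtain ⟨a1, a2, -, -⟩ := readSem_loadReg 0 0 (Expr.hd (Expr.tl (Expr.var 0))) hs m σ₁
    (by simp [Expr.eval, f0, hm]) (bits true v₀ v₁ 0) (by rw [f9]) σ₂ hσ₂
  have g9 : (σ₂ 9).isTrue = true := by rw [a1 9 (by simp), f9]
  have g0 : σ₂ 0 = σ 0 := by rw [a1 0 (by simp), f0]
  obtain ⟨b1, b2, -, -⟩ := readSem_loadReg 0 1 (Expr.hd (Expr.tl (Expr.var 0))) hs m σ₂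
    (by simp [Expr.eval, g0, hm]) (bits true v₀ v₁ 0) (by rw [g9]) σ₃ hσ₃
  have h0 : σ₃ 0 = σ 0 := by rw [b1 0 (by simp), g0]
  have h16 : σ₃ 16 = σ 16 := by rw [b1 16 (by simp), a1 16 (by simp), f16]
  have ho' : o = Data.cons (σ₃ 0).tl.hd
      (Data.cons (Data.cons (Expr.gateH.eval σ₃) (σ₃ 7)) (σ₃ 16).tl) := by
    rw [ho]
    simp [Expr.eval]
  refine ⟨by rw [ho', h0]; rfl, ?_, by rw [ho', h16]; rfl⟩
  rw [ho']
  simp only [Data.tl, Data.hd]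
  rw [Data.toCircuit_cons, Expr.toGate_gateH, b2, a2, f7, List.append_nil]

theorem polyGrowth_loadReg (i t : ℕ) (S : List ℕ) (e : Expr)
    (h : (seq (assign 4 Expr.nil) (count 4 e)).tame S = true)
    (h' : (loadStep i t).tame [4] = true) : (loadReg i t e).PolyGrowth :=
  (PolyGrowth.of_tame S h).seq (PolyGrowth.of_tame [4] (by
    rw [tame, h']
    rfl))

theorem polyGrowth_move (x : ℕ) : (move x).PolyGrowth :=
  (PolyGrowth.of_tame [] rfl).seq (PolyGrowth.of_tame [1] rfl)

theorem polyGrowth_exchangeProgram : exchangeProgram.PolyGrowth := by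
  refine PolyGrowth.seqs fun c hc => ?_
  simp only [List.mem_cons, List.not_mem_nil, or_false] at hc
  rcases hc with rfl | rfl | rfl | rfl | rfl | rfl | rfl | rfl | rfl | rfl | rfl | rfl | rfl | rfl |
    rfl | rfl
  case inr.inr.inr.inl => exact polyGrowth_loadReg 1 0 [16] _ rfl rfl
  case inr.inr.inr.inr.inr.inr.inr.inr.inr.inl => exact polyGrowth_loadReg 0 0 [0] _ rfl rfl
  all_goals first
    | exact polyGrowth_move _
    | exact PolyGrowth.of_tame [7, 12, 16] rfl

theorem polyGrowth_copyProgram : copyProgram.PolyGrowth := by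
  refine PolyGrowth.seqs fun c hc => ?_
  simp only [List.mem_cons, List.not_mem_nil, or_false] at hc
  rcases hc with rfl | rfl | rfl | rfl | rfl
  · exact PolyGrowth.of_tame [] rfl
  · exact PolyGrowth.of_tame [] rfl
  · exact polyGrowth_loadReg 0 0 [0] _ rfl rfl
  · exact polyGrowth_loadReg 0 1 [0] _ rfl rfl
  · exact PolyGrowth.of_tame [7, 16] rfl

end Cmd

/-! ### Negligible functions -/

theorem Negligible.mono {f g : ℕ → ℝ} (hf : Negligible f) (h : ∀ n, g n ≤ f n) :
    Negligible g := fun p hp => by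
  obtain ⟨n₀, h₀⟩ := hf p hp
  exact ⟨n₀, fun n hn => (h n).trans_lt (h₀ n hn)⟩

theorem Negligible.add {f g : ℕ → ℝ} (hf : Negligible f) (hg : Negligible g) :
    Negligible fun n => f n + g n := fun p hp => by
  have hp2 : ∀ n : ℕ, 0 < (Polynomial.C 2 * p).eval (n : ℝ) := fun n => by
    have := hp n
    simp only [Polynomial.eval_mul, Polynomial.eval_C]
    linarith
  obtain ⟨n₁, h₁⟩ := hf _ hp2
  obtain ⟨n₂, h₂⟩ := hg _ hp2
  refine ⟨max n₁ n₂, fun n hn => ?_⟩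
  have e1 := h₁ n ((le_max_left _ _).trans hn)
  have e2 := h₂ n ((le_max_right _ _).trans hn)
  have e3 : 1 / (Polynomial.C 2 * p).eval (n : ℝ) = (1 / p.eval (n : ℝ)) / 2 := by
    simp only [Polynomial.eval_mul, Polynomial.eval_C]
    ring
  rw [e3] at e1 e2
  linarith

/-! ### One encryption, attack and decryption -/

namespace SchemeData

variable (S : SchemeData)

theorem decVecExpect_const (n : ℕ) (sk : Data) (ys : List (S.Ct n)) (r : ℝ) :
    (S.decVecExpect n sk ys fun _ => r) = r := by
  induction ys with
  | nil => rfl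
  | cons y ys ih => simp only [decVecExpect, ih, decExpect, Cmd.expect_const]

theorem decVecExpect_mono (n : ℕ) (sk : Data) (ys : List (S.Ct n))
    {f g : List (Option (S.Msg n)) → ℝ} (h : ∀ xs, f xs ≤ g xs) :
    S.decVecExpect n sk ys f ≤ S.decVecExpect n sk ys g := by
  induction ys generalizing f g with
  | nil => exact h []
  | cons y ys ih =>
    simp only [decVecExpect, decExpect]
    exact Cmd.expect_mono _ _ fun o => ih fun xs => h (S.readPlain n o :: xs)

theorem decVecExpect_avg (n : ℕ) (sk : Data) (ys : List (S.Ct n)) (χ : QState Data)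
    (f : Finset Data → List (Option (S.Msg n)) → ℝ) :
    (S.decVecExpect n sk ys fun xs => χ.avg fun v => f v xs)
      = χ.avg fun v => S.decVecExpect n sk ys (f v) := by
  induction ys generalizing f with
  | nil => rfl
  | cons y ys ih =>
    simp only [decVecExpect, decExpect]
    rw [← Cmd.expect_avg]
    congr 1
    funext o
    exact ih fun v xs => f v (S.readPlain n o :: xs)

theorem encExpect_eq_sum (n : ℕ) (pk : Data) (x : S.Msg n) (f : S.Ct n → ℝ) :
    S.encExpect n pk x f = ∑ y, S.encProb n pk x y * f y := by
  simp only [encProb, encExpect]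
  have : (fun d : Data => f (d.toBits (S.ctLen n))) = fun d => ∑ y,
      f y * (if d.toBits (S.ctLen n) = y then 1 else 0) := by
    funext d
    simp
  rw [this, Cmd.expect_finset_sum]
  exact Finset.sum_congr rfl fun y _ => by rw [Cmd.expect_mul_left, mul_comm]

theorem encExpect_eq_sum_append (n : ℕ) (pk : Data) (x : S.Msg n) (f : S.Ct n → ℝ) :
    S.encExpect n pk x f = ∑ y : Bits (S.msgLen n) × Bits (S.tagLen n),
      S.encProb n pk x (Fin.append y.1 y.2) * f (Fin.append y.1 y.2) := by
  rw [encExpect_eq_sum]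
  exact (Fintype.sum_equiv (Fin.appendEquiv (S.msgLen n) (S.tagLen n)) _ _ fun y => rfl).symm

/-- The functions by which an experiment is evaluated, applied to the challenge ciphertext, the
circuit and the ciphertexts from the adversary, and the decryptions. -/
abbrev Score (n : ℕ) : Type :=
  S.Ct n → Circuit → List (S.Ct n) → List (Option (S.Msg n)) → ℝ

/-- The expected score when `A₂`, in state `s`, attacks the ciphertext `y`. -/
def attack (A₂ : Cmd) (n : ℕ) (k s : Data) (y : S.Ct n) (h : S.Score n) : ℝ :=
  A₂.expect (Data.cons s (Data.ofBits y)) fun o =>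
  S.decVecExpect n k.tl (S.readOut₂ n o).2 fun xs =>
  h y (S.readOut₂ n o).1 (S.readOut₂ n o).2 xs

/-- The expected score when `x` is encrypted and `A₂`, in state `s`, attacks the ciphertext. -/
def trial (A₂ : Cmd) (n : ℕ) (k s : Data) (x : S.Msg n) (h : S.Score n) : ℝ :=
  S.encExpect n k.hd x fun y => S.attack A₂ n k s y h

variable {S}

theorem attack_nonneg (A₂ : Cmd) (n : ℕ) (k s : Data) (y : S.Ct n) {h : S.Score n}
    (hh : ∀ y E ys xs, 0 ≤ h y E ys xs) : 0 ≤ S.attack A₂ n k s y h :=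
  Cmd.expect_nonneg _ _ fun _ => (S.decVecExpect_const n _ _ 0).ge.trans
    (S.decVecExpect_mono n _ _ fun _ => hh _ _ _ _)

theorem attack_le_one (A₂ : Cmd) (n : ℕ) (k s : Data) (y : S.Ct n) {h : S.Score n}
    (hh : ∀ y E ys xs, h y E ys xs ≤ 1) : S.attack A₂ n k s y h ≤ 1 :=
  Cmd.expect_le_one _ _ fun _ => (S.decVecExpect_mono n _ _ fun _ => hh _ _ _ _).trans
    (S.decVecExpect_const n _ _ 1).le

theorem trial_nonneg (A₂ : Cmd) (n : ℕ) (k s : Data) (x : S.Msg n) {h : S.Score n}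
    (hh : ∀ y E ys xs, 0 ≤ h y E ys xs) : 0 ≤ S.trial A₂ n k s x h :=
  Cmd.expect_nonneg _ _ fun _ => attack_nonneg _ _ _ _ _ hh

theorem trial_avg (A₂ : Cmd) (n : ℕ) (k s : Data) (x : S.Msg n) (χ : QState Data)
    (h : Finset Data → S.Score n) :
    (S.trial A₂ n k s x fun y E ys xs => χ.avg fun v => h v y E ys xs)
      = χ.avg fun v => S.trial A₂ n k s x (h v) := by
  simp only [trial, attack, decVecExpect_avg, Cmd.expect_avg, encExpect]

/-- Score of the real experiments for the relation (or POVM element) applied to `z`. -/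
def hit {n l : ℕ} (z : Bits l) : S.Score n := fun y E ys xs =>
  if y ∈ ys ∨ none ∈ xs then 0 else E.accept z xs.reduceOption

/-- Score that counts invalid ciphertexts. -/
def invalid {n : ℕ} : S.Score n := fun _ _ _ xs => if none ∈ xs then 1 else 0

theorem invalid_nonneg {n : ℕ} (y : S.Ct n) (E : Circuit) (ys : List (S.Ct n))
    (xs : List (Option (S.Msg n))) : 0 ≤ invalid y E ys xs := by
  rw [invalid]
  split_ifs <;> norm_num

variable (S)

/-- Expectation over the key and the output of the first stage of an adversary. -/
def setup (A₁ : Cmd) (n : ℕ) (F : Data → Data → ℝ) : ℝ :=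
  S.keyExpect n fun k => A₁.expect (S.input₁ n k.hd) fun a => F k a

theorem setup_sub (A₁ : Cmd) (n : ℕ) (F G : Data → Data → ℝ) :
    (S.setup A₁ n fun k a => F k a - G k a) = S.setup A₁ n F - S.setup A₁ n G := by
  simp only [setup, keyExpect, Cmd.expect_sub]

theorem setup_mul_left (A₁ : Cmd) (n : ℕ) (r : ℝ) (F : Data → Data → ℝ) :
    (S.setup A₁ n fun k a => r * F k a) = r * S.setup A₁ n F := by
  simp only [setup, keyExpect, Cmd.expect_mul_left]

theorem setup_mono (A₁ : Cmd) (n : ℕ) {F G : Data → Data → ℝ}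
    (h : ∀ k ∈ S.keys n, ∀ a, F k a ≤ G k a) : S.setup A₁ n F ≤ S.setup A₁ n G := by
  simp only [setup, keyExpect]
  exact Cmd.expect_mono_of_outputs _ _ fun k hk => Cmd.expect_mono _ _ (h k hk)

theorem setup_const (A₁ : Cmd) (n : ℕ) (r : ℝ) : (S.setup A₁ n fun _ _ => r) = r := by
  simp only [setup, keyExpect, Cmd.expect_const]

theorem cnmRun_eq (A : Adversary) (n : ℕ)
    (score : Circuit → S.Msg n → S.Score n) :
    S.cnmRun A n score = S.setup A.A₁ n fun k a => (a.hd.toCircuit.run ∅).avg fun v =>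
      S.trial A.A₂ n k a.tl (readReg 0 _ v) (score a.hd.toCircuit (readReg 0 _ v)) := by
  rw [cnmRun, setup]
  congr 1
  funext k
  congr 1
  funext a
  exact Circuit.sum_sampleProb_mul a.hd.toCircuit 0 fun x =>
    S.trial A.A₂ n k a.tl x (score a.hd.toCircuit x)

theorem hit_avg {n l : ℕ} (C : Circuit) (i : ℕ) (y : S.Ct n) (E : Circuit) (ys : List (S.Ct n))
    (xs : List (Option (S.Msg n))) :
    (if y ∈ ys ∨ none ∈ xs then 0
      else ∑ z : Bits l, C.sampleProb i z * E.accept z xs.reduceOption)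
      = (C.run ∅).avg fun v => hit (readReg i l v) y E ys xs := by
  rw [Circuit.sum_sampleProb_mul C i fun z : Bits l => E.accept z xs.reduceOption]
  simp only [hit]
  split_ifs
  · rw [Circuit.avg_run_const]
  · rfl

theorem cnmReal_eq (A : Adversary) (n : ℕ) :
    S.cnmReal A n = S.setup A.A₁ n fun k a => (a.hd.toCircuit.run ∅).avg fun v =>
      S.trial A.A₂ n k a.tl (readReg 0 _ v) (hit (readReg 0 (S.msgLen n) v)) :=
  S.cnmRun_eq A n fun _ x => hit x

theorem cnmIdeal_eq (A : Adversary) (n : ℕ) :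
    S.cnmIdeal A n = S.setup A.A₁ n fun k a => (a.hd.toCircuit.run ∅).avg fun v =>
      (a.hd.toCircuit.run ∅).avg fun v' =>
      S.trial A.A₂ n k a.tl (readReg 0 _ v) (hit (readReg 0 (S.msgLen n) v')) := by
  rw [cnmIdeal, cnmRun_eq]
  simp only [hit_avg, trial_avg]

theorem cnmInvalid_eq (A : Adversary) (n : ℕ) :
    S.cnmInvalid A n = S.setup A.A₁ n fun k a => (a.hd.toCircuit.run ∅).avg fun v =>
      S.trial A.A₂ n k a.tl (readReg 0 _ v) invalid :=
  S.cnmRun_eq A n fun _ _ => invalid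

/-- The quantum experiment with `MR` measured before the encryption, which is done by `enc`. -/
def hybridRun (A : Adversary) (n : ℕ) (score : (ρ : ℕ) → Circuit → Bits ρ → S.Score n) : ℝ :=
  S.setup A.A₁ n fun k a => (a.tl.hd.toCircuit.run ∅).avg fun v =>
    S.trial A.A₂ n k a.tl.tl (readReg 0 _ v)
      (score a.hd.size a.tl.hd.toCircuit (readReg 1 a.hd.size v))

/-- The real quantum experiment with `MR` measured before the encryption. -/
def hybridReal (A : Adversary) (n : ℕ) : ℝ := S.hybridRun A n fun _ _ z => hit z

/-- The ideal quantum experiment with `MR` measured before the encryption. -/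
def hybridIdeal (A : Adversary) (n : ℕ) : ℝ :=
  S.hybridRun A n fun ρ U _ y E ys xs => (U.run ∅).avg fun v => hit (readReg 1 ρ v) y E ys xs

/-- The probability of an invalid ciphertext with `MR` measured before the encryption. -/
def hybridInvalid (A : Adversary) (n : ℕ) : ℝ := S.hybridRun A n fun _ _ _ => invalid

theorem hybridIdeal_eq (A : Adversary) (n : ℕ) :
    S.hybridIdeal A n = S.setup A.A₁ n fun k a => (a.tl.hd.toCircuit.run ∅).avg fun v =>
      (a.tl.hd.toCircuit.run ∅).avg fun v' =>
      S.trial A.A₂ n k a.tl.tl (readReg 0 _ v) (hit (readReg 1 a.hd.size v')) := by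
  simp only [hybridIdeal, hybridRun, trial_avg]

end SchemeData

/-! ### The quantum experiments and their hybrids -/

namespace EncForm

variable {S : SchemeData} (D : EncForm S)

theorem abs_sum_encDiag_sub_encExpect_le {n : ℕ} {k : Data} {x : S.Msg n} {ε : ℝ}
    (hε : ∑ y, ‖D.encState n k x y y - (S.encProb n k.hd x (Fin.append y.1 y.2) : ℂ)‖ ≤ ε)
    {g : S.Ct n → ℝ} (h0 : ∀ y, 0 ≤ g y) (h1 : ∀ y, g y ≤ 1) :
    |∑ y, D.encDiag n k x y * g (Fin.append y.1 y.2) - S.encExpect n k.hd x g| ≤ ε := by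
  rw [S.encExpect_eq_sum_append, ← Finset.sum_sub_distrib]
  refine (Finset.abs_sum_le_sum_abs _ _).trans ((Finset.sum_le_sum fun y _ => ?_).trans hε)
  rw [← sub_mul, abs_mul, D.encState_apply_self, ← Complex.ofReal_sub, Complex.norm_real,
    Real.norm_eq_abs, abs_of_nonneg (h0 _)]
  exact mul_le_of_le_one_right (abs_nonneg _) (h1 _)

/-- The quantum experiment and its hybrid differ by the distance between `enc` and its form. -/
theorem abs_qcnmRun_sub_hybridRun_le (A : Adversary) (n : ℕ) {ε : ℝ}
    (hε : ∀ k ∈ S.keys n, ∀ x,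
      ∑ y, ‖D.encState n k x y y - (S.encProb n k.hd x (Fin.append y.1 y.2) : ℂ)‖ ≤ ε)
    (score : (ρ : ℕ) → Circuit → Bits ρ → S.Score n)
    (h0 : ∀ ρ U z y E ys xs, 0 ≤ score ρ U z y E ys xs)
    (h1 : ∀ ρ U z y E ys xs, score ρ U z y E ys xs ≤ 1) :
    |D.qcnmRun A n (fun ρ U y z E ys xs => score ρ U z y E ys xs) - S.hybridRun A n score|
      ≤ ε := by
  let att : Data → Data → Finset Data → S.Ct n → ℝ := fun k a v y =>
    S.attack A.A₂ n k a.tl.tl y (score a.hd.size a.tl.hd.toCircuit (readReg 1 a.hd.size v))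
  have hq : D.qcnmRun A n (fun ρ U y z E ys xs => score ρ U z y E ys xs)
      = S.setup A.A₁ n fun k a => (a.tl.hd.toCircuit.run ∅).avg fun v =>
          ∑ y, D.encDiag n k (readReg 0 _ v) y * att k a v (Fin.append y.1 y.2) := by
    rw [EncFormData.qcnmRun, SchemeData.setup]
    refine Cmd.expect_congr_of_outputs _ _ fun k hk => ?_
    congr 1
    funext a
    exact D.sum_prepProb n hk a.tl.hd.toCircuit fun y z =>
      S.attack A.A₂ n k a.tl.tl (Fin.append y.1 y.2) (score a.hd.size a.tl.hd.toCircuit z)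
  have hb : ∀ k ∈ S.keys n, ∀ a v,
      |∑ y, D.encDiag n k (readReg 0 _ v) y * att k a v (Fin.append y.1 y.2)
        - S.encExpect n k.hd (readReg 0 _ v) (att k a v)| ≤ ε := fun k hk a v =>
    D.abs_sum_encDiag_sub_encExpect_le (hε k hk _)
      (fun y => SchemeData.attack_nonneg _ _ _ _ _ (h0 _ _ _))
      (fun y => SchemeData.attack_le_one _ _ _ _ _ (h1 _ _ _))
  have hh : S.hybridRun A n score = S.setup A.A₁ n fun k a =>
      (a.tl.hd.toCircuit.run ∅).avg fun v =>
        S.encExpect n k.hd (readReg 0 _ v) (att k a v) := rfl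
  rw [hq, hh, ← SchemeData.setup_sub, abs_le]
  constructor
  · rw [← S.setup_const A.A₁ n (-ε)]
    refine S.setup_mono _ _ fun k hk a => ?_
    rw [← QState.avg_sub, ← Circuit.avg_run_const a.tl.hd.toCircuit (-ε)]
    exact QState.avg_mono _ fun v => (abs_le.1 (hb k hk a v)).1
  · rw [← S.setup_const A.A₁ n ε]
    refine S.setup_mono _ _ fun k hk a => ?_
    rw [← QState.avg_sub, ← Circuit.avg_run_const a.tl.hd.toCircuit ε]
    exact QState.avg_mono _ fun v => (abs_le.1 (hb k hk a v)).2

theorem hit_nonneg {n l : ℕ} (z : Bits l) (y : S.Ct n) (E : Circuit) (ys : List (S.Ct n))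
    (xs : List (Option (S.Msg n))) : 0 ≤ SchemeData.hit z y E ys xs := by
  rw [SchemeData.hit]
  split_ifs
  · exact le_rfl
  · exact E.accept_nonneg _ _

theorem hit_le_one {n l : ℕ} (z : Bits l) (y : S.Ct n) (E : Circuit) (ys : List (S.Ct n))
    (xs : List (Option (S.Msg n))) : SchemeData.hit z y E ys xs ≤ 1 := by
  rw [SchemeData.hit]
  split_ifs
  · exact zero_le_one
  · exact E.accept_le_one _ _

/-- All three probabilities of the quantum experiments are negligibly close to those of the
hybrids. -/
theorem exists_hybrid_close : ∃ ε : ℕ → ℝ, Negligible ε ∧ ∀ (A : Adversary) (n : ℕ),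
    |D.qcnmReal A n - S.hybridReal A n| ≤ ε n ∧ |D.qcnmIdeal A n - S.hybridIdeal A n| ≤ ε n ∧
    |D.qcnmInvalid A n - S.hybridInvalid A n| ≤ ε n := by
  obtain ⟨ε, hε, hc⟩ := D.close
  refine ⟨ε, hε, fun A n => ⟨?_, ?_, ?_⟩⟩
  · exact D.abs_qcnmRun_sub_hybridRun_le A n (hc n) (fun _ _ z => SchemeData.hit z)
      (fun _ _ _ _ _ _ _ => hit_nonneg _ _ _ _ _) (fun _ _ _ _ _ _ _ => hit_le_one _ _ _ _ _)
  · have := D.abs_qcnmRun_sub_hybridRun_le A n (hc n)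
      (fun ρ U _ y E ys xs => (U.run ∅).avg fun v => SchemeData.hit (readReg 1 ρ v) y E ys xs)
      (fun _ _ _ _ _ _ _ => QState.avg_nonneg _ fun _ => hit_nonneg _ _ _ _ _)
      (fun _ U _ _ _ _ _ => (QState.avg_mono _ fun _ => hit_le_one _ _ _ _ _).trans
        (U.avg_run_const 1).le)
    rw [EncFormData.qcnmIdeal]
    simp only [SchemeData.hit_avg]
    exact this
  · exact D.abs_qcnmRun_sub_hybridRun_le A n (hc n) (fun _ _ _ => SchemeData.invalid)
      (fun _ _ _ _ _ _ _ => SchemeData.invalid_nonneg _ _ _ _) (fun _ _ _ _ _ _ _ => by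
        rw [SchemeData.invalid]
        split_ifs <;> norm_num)

end EncForm

/-! ### The reductions -/

namespace Cmd

theorem expect_sampleTwice_exchangeProgram (A₁ : Cmd) (d : Data) (f : Data → ℝ)
    (H : Data → Finset Data → Finset Data → ℝ)
    (hH : ∀ (a : Data) (s v₀ v₁ : Finset Data) (σ : Store), σ 0 = d → σ 16 = a → Tagged s v₀ v₁ →
      f (exchangeProgram.readSem s σ 0) = H a v₀ v₁) :
    (around 16 (Expr.var 0) (Expr.var 0) A₁ (sampleTwice (Expr.hd (Expr.tl (Expr.var 16)))
      exchangeProgram)).expect d f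
      = A₁.expect d fun a => (a.tl.hd.toCircuit.run ∅).avg fun v₀ =>
          (a.tl.hd.toCircuit.run ∅).avg fun v₁ => H a v₀ v₁ :=
  expect_around_sampleTwice (g := fun a => a.tl.hd) (by omega) (fun _ => rfl) rfl f d
    (fun _ => rfl) H fun a σ s v₀ v₁ h0 h16 hs => hH a s v₀ v₁ σ h0 h16 hs

theorem expect_sampleTwice_copyProgram (A₁ : Cmd) (d : Data) (f : Data → ℝ)
    (H : Data → Finset Data → Finset Data → ℝ)
    (hH : ∀ (a : Data) (s v₀ v₁ : Finset Data) (σ : Store), σ 0 = d → σ 16 = a → Tagged s v₀ v₁ →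
      f (copyProgram.readSem s σ 0) = H a v₀ v₁) :
    (around 16 (Expr.var 0) (Expr.var 0) A₁ (sampleTwice (Expr.hd (Expr.var 16))
      copyProgram)).expect d f
      = A₁.expect d fun a => (a.hd.toCircuit.run ∅).avg fun v₀ =>
          (a.hd.toCircuit.run ∅).avg fun v₁ => H a v₀ v₁ :=
  expect_around_sampleTwice (g := fun a => a.hd) (by omega) (fun _ => rfl) rfl f d
    (fun _ => rfl) H fun a σ s v₀ v₁ h0 h16 hs => hH a s v₀ v₁ σ h0 h16 hs

/-- Puts the gates in variable `0` in front of the circuit in the output of the subprogram. -/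
def prependProgram : Cmd :=
  seqs [assign 12 (Expr.hd (Expr.var 16)), move 0,
    assign 0 (Expr.cons (Expr.var 12) (Expr.tl (Expr.var 16)))]

theorem readSem_prependProgram (s : Finset Data) (σ : Store) :
    (prependProgram.readSem s σ 0).hd.toCircuit
      = (σ 0).toCircuit.reverse ++ (σ 16).hd.toCircuit ∧
    (prependProgram.readSem s σ 0).tl = (σ 16).tl := by
  obtain ⟨h1, h2⟩ := readSem_move s 0 (Function.update σ 12 (σ 16).hd)
  have e : prependProgram.readSem s σ 0
      = Data.cons ((move 0).readSem s (Function.update σ 12 (σ 16).hd) 12)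
        ((move 0).readSem s (Function.update σ 12 (σ 16).hd) 16).tl := by
    simp only [prependProgram, seqs, readSem, id, Expr.eval, Function.update_self]
  rw [e]
  refine ⟨?_, ?_⟩
  · rw [show ∀ x y : Data, (Data.cons x y).hd = x from fun _ _ => rfl, h2]
    simp
  · rw [show ∀ x y : Data, (Data.cons x y).tl = y from fun _ _ => rfl, h1 16 (by omega) (by omega)]
    simp

/-- The second stage `A₂` with the circuit in its output preceded by the circuit that is found,
in reverse order, in front of its state. -/
def prepend (A₂ : Cmd) : Cmd :=
  around 16 (Expr.hd (Expr.hd (Expr.var 0)))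
    (Expr.cons (Expr.tl (Expr.hd (Expr.var 0))) (Expr.tl (Expr.var 0))) A₂ prependProgram

theorem expect_prepend (A₂ : Cmd) (s y : Data) (f H : Data → ℝ)
    (hH : ∀ o o' : Data, o'.hd.toCircuit = s.hd.toCircuit.reverse ++ o.hd.toCircuit →
      o'.tl = o.tl → f o' = H o) :
    (prepend A₂).expect (Data.cons s y) f = A₂.expect (Data.cons s.tl y) H := by
  rw [expect_eq_wp, prepend, wp_around (by omega) _ _ A₂ _ _ (fun _ => by simp [Expr.eval]),
    expect_eq_wp]
  have e2 : (Expr.cons (Expr.tl (Expr.hd (Expr.var 0))) (Expr.tl (Expr.var 0))).eval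
      (Config.init (Data.cons s y)).store = Data.cons s.tl y := by
    simp [Expr.eval, Config.init, Data.hd, Data.tl]
  have e1 : (Expr.hd (Expr.hd (Expr.var 0))).eval (Config.init (Data.cons s y)).store = s.hd := by
    simp [Expr.eval, Config.init, Data.hd]
  rw [e2, e1]
  congr 1
  funext τ φ
  rw [wp_pure rfl ∅]
  beta_reduce
  rw [QState.normSq_shield]
  congr 1
  set σ := Store.merge 16 (Config.init s.hd).store τ with hσ
  have h0 : σ 0 = s.hd := by
    rw [hσ, Store.merge_of_lt (by omega)]
    simp [Config.init]
  have h16 : σ 16 = τ 0 := Store.merge_add 16 _ τ 0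
  obtain ⟨h1, h2⟩ := readSem_prependProgram ∅ σ
  exact hH (τ 0) _ (by rw [h1, h0, h16]) (by rw [h2, h16])

theorem polyTime_prepend {A₂ : Cmd} (h : A₂.PolyTime) : (prepend A₂).PolyTime := by
  refine polyTime_around (by omega) _ _ h (PolyGrowth.seqs fun c hc => ?_) fun _ _ => rfl
  simp only [List.mem_cons, List.not_mem_nil, or_false] at hc
  rcases hc with rfl | rfl | rfl
  · exact PolyGrowth.of_tame [] rfl
  · exact polyGrowth_move 0
  · exact PolyGrowth.of_tame [12, 16] rfl

end Cmd

namespace Adversary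

/-- From an adversary in the quantum experiment, an adversary in the classical experiment: it
samples two pairs of a plaintext and a content of register `1`, lets the plaintext be chosen among
the two and the relation recover the matching content. -/
def toClassical (A : Adversary) : Adversary where
  A₁ := Cmd.around 16 (Expr.var 0) (Expr.var 0) A.A₁
    (Cmd.sampleTwice (Expr.hd (Expr.tl (Expr.var 16))) Cmd.exchangeProgram)
  A₂ := Cmd.prepend A.A₂

/-- From an adversary in the classical experiment, an adversary in the quantum experiment: it
samples two plaintexts and prepares a uniform superposition of them with copies in register `1`. -/
def toQuantum (A : Adversary) : Adversary where
  A₁ := Cmd.around 16 (Expr.var 0) (Expr.var 0) A.A₁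
    (Cmd.sampleTwice (Expr.hd (Expr.var 16)) Cmd.copyProgram)
  A₂ := A.A₂

theorem toClassical_QPT {A : Adversary} (h : A.QPT) : A.toClassical.QPT :=
  ⟨Cmd.polyTime_around (by omega) _ _ h.1
    ((Cmd.polyGrowth_simulate 1 [] _ rfl rfl).seq
      ((Cmd.polyGrowth_simulate 2 [] _ rfl rfl).seq Cmd.polyGrowth_exchangeProgram))
    fun _ _ => rfl, Cmd.polyTime_prepend h.2⟩

theorem toQuantum_QPT {A : Adversary} (h : A.QPT) : A.toQuantum.QPT :=
  ⟨Cmd.polyTime_around (by omega) _ _ h.1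
    ((Cmd.polyGrowth_simulate 1 [] _ rfl rfl).seq
      ((Cmd.polyGrowth_simulate 2 [] _ rfl rfl).seq Cmd.polyGrowth_copyProgram))
    fun _ _ => rfl, h.2⟩

end Adversary

namespace SchemeData

variable (S : SchemeData)

theorem msgLen_eq_size_input₁ (n : ℕ) (pk : Data) :
    (S.input₁ n pk).tl.hd.size = S.msgLen n := Data.size_ofNat _

theorem trial_prepend (A₂ : Cmd) (n : ℕ) (k s : Data) (x : S.Msg n) (h : S.Score n) :
    S.trial (Cmd.prepend A₂) n k s x h = S.trial A₂ n k s.tl x fun y E ys xs =>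
      h y (s.hd.toCircuit.reverse ++ E) ys xs := by
  rw [trial, trial]
  congr 1
  funext y
  refine Cmd.expect_prepend A₂ s (Data.ofBits y) _ _ fun o o' h1 h2 => ?_
  simp only [readOut₂, h1, h2]

/-- The two plaintexts between which `toClassical` leaves the choice.  If register `1`, of length
`ρ`, has the same content in both samples, both are the plaintext of `v₀`. -/
def exchangeMsg (n ρ : ℕ) (v₀ v₁ : Finset Data) (b : Bool) : S.Msg n :=
  readReg 0 _ (if b = true ∧ readReg 1 ρ v₀ ≠ readReg 1 ρ v₁ then v₁ else v₀)

/-- The sample whose register `1` the relation of `toClassical` uses for the plaintext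
`exchangeMsg b`. -/
def exchangeBranch (n ρ : ℕ) (v₀ v₁ : Finset Data) (b : Bool) : Finset Data :=
  if b = true ∧ S.exchangeMsg n ρ v₀ v₁ false ≠ S.exchangeMsg n ρ v₀ v₁ true then v₁ else v₀

/-- Reduces experiments with `toClassical` to the first stage of `A` and two samples `v₀`, `v₁`: the
output `o` of the new first stage samples uniformly from the two plaintexts, and the gates in its
state exchange them for the contents of register `1`. -/
theorem setup_toClassical (A : Adversary) (n : ℕ)
    (F : (k : Data) → Circuit → Data → ℝ) (H : Data → Data → Finset Data → Finset Data → ℝ)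
    (hF : ∀ (k a o : Data) (v₀ v₁ : Finset Data),
      (∀ h : Finset Data → ℝ, ∃ w : Bool → Finset Data,
        (∀ b, readReg 0 (S.msgLen n) (w b) = S.exchangeMsg n a.hd.size v₀ v₁ b) ∧
        (o.hd.toCircuit.run ∅).avg h = (h (w false) + h (w true)) / 2) →
      (∀ (b : Bool) (E : Circuit) (xs : List (S.Msg n)),
        Circuit.accept (o.tl.hd.toCircuit.reverse ++ E) (S.exchangeMsg n a.hd.size v₀ v₁ b) xs
          = E.accept (readReg 1 a.hd.size (S.exchangeBranch n a.hd.size v₀ v₁ b)) xs) →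
      o.tl.tl = a.tl.tl → F k o.hd.toCircuit o.tl = H k a v₀ v₁) :
    (S.setup A.toClassical.A₁ n fun k o => F k o.hd.toCircuit o.tl)
      = S.setup A.A₁ n fun k a => (a.tl.hd.toCircuit.run ∅).avg fun v₀ =>
          (a.tl.hd.toCircuit.run ∅).avg fun v₁ => H k a v₀ v₁ := by
  rw [setup, setup]
  congr 1
  funext k
  refine Cmd.expect_sampleTwice_exchangeProgram A.A₁ (S.input₁ n k.hd) _ _ ?_
  intro a s v₀ v₁ σ h0 h16 hs
  have hbits : ∀ b, (fun j : Fin a.hd.size => Cmd.bits true v₀ v₁ 1 b j)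
      = readReg 1 a.hd.size (if b = true then v₁ else v₀) := by
    intro b
    cases b <;> rfl
  set flag : Bool := !decide (∀ j < a.hd.size, Cmd.bits true v₀ v₁ 1 false j
    = Cmd.bits true v₀ v₁ 1 true j) with hflag
  have hall : ∀ (l : ℕ) (f g : ℕ → Bool), (∀ j < l, f j = g j) ↔
      (fun j : Fin l => f j) = fun j : Fin l => g j := by
    intro l f g
    constructor
    · intro h
      funext j
      exact h j j.2
    · intro h j hj
      exact congrFun h ⟨j, hj⟩
  have hfl : flag = true ↔ readReg 1 a.hd.size v₀ ≠ readReg 1 a.hd.size v₁ := by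
    rw [hflag, Bool.not_eq_true', decide_eq_false_iff_not, hall, hbits, hbits]
    simp
  have hX : ∀ b, (fun j : Fin (S.msgLen n) => Cmd.bits flag v₀ v₁ 0 b j)
      = S.exchangeMsg n a.hd.size v₀ v₁ b := by
    intro b
    funext j
    simp only [Cmd.bits, exchangeMsg, readReg, ← hfl, Bool.and_eq_true, and_comm]
  obtain ⟨px, pz, hpx, hpz, o1, o2, o3⟩ := Cmd.readSem_exchangeProgram hs σ (S.msgLen n) a.hd.size
    (by rw [h0, msgLen_eq_size_input₁]) (by rw [h16]) flag hflag _ rfl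
  generalize Cmd.exchangeProgram.readSem s σ 0 = o at o1 o2 o3 ⊢
  refine hF k a o v₀ v₁ (fun h => ?_) (fun b E xs => ?_) (by rw [o3, h16])
  · have m0 := Circuit.maps_load (Cmd.bits flag v₀ v₁ 0) 0 (S.msgLen n) ∅
    have m1 := Circuit.maps_load (Cmd.bits flag v₀ v₁ 0) 0 (S.msgLen n) {Data.nil}
    rw [show decide (Data.nil ∈ (∅ : Finset Data)) = false by simp] at m0
    rw [show decide (Data.nil ∈ ({Data.nil} : Finset Data)) = true by simp] at m1
    refine ⟨fun b => if b then symmDiff {Data.nil} (loadSet (Cmd.bits flag v₀ v₁ 0 true) 0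
      (S.msgLen n)) else symmDiff ∅ (loadSet (Cmd.bits flag v₀ v₁ 0 false) 0 (S.msgLen n)),
      fun b => ?_, ?_⟩
    · rw [← hX]
      refine readReg_eq_of_forall fun j hj => ?_
      cases b <;> simp [Finset.mem_symmDiff, mem_loadSet, hj, wire_ne_nil]
    · rw [o1, Circuit.avg_run_H_cons m0 m1]
      · rfl
      · intro hcon
        have := Finset.ext_iff.1 hcon Data.nil
        simp [Finset.mem_symmDiff, nil_notMem_loadSet] at this
  · have hdeg : (∀ j < a.hd.size, Cmd.bits true v₀ v₁ 1 false j = Cmd.bits true v₀ v₁ 1 true j) →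
        ∀ j < S.msgLen n, Cmd.bits flag v₀ v₁ 0 false j = Cmd.bits flag v₀ v₁ 0 true j := by
      intro hZ j _
      have hf : flag = false := by
        rw [hflag, decide_eq_true hZ]
        rfl
      rw [hf]
      rfl
    have hbranch : (if (if ∀ j < S.msgLen n,
        Cmd.bits flag v₀ v₁ 0 false j = Cmd.bits flag v₀ v₁ 0 true j then false else b) = true
          then v₁ else v₀) = S.exchangeBranch n a.hd.size v₀ v₁ b := by
      simp only [exchangeBranch, ← hX, ne_eq, ← hall]
      by_cases hB : ∀ j < S.msgLen n,
        Cmd.bits flag v₀ v₁ 0 false j = Cmd.bits flag v₀ v₁ 0 true j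
      · rw [if_pos hB, if_neg (by simp), if_neg fun h => h.2 hB]
      · rw [if_neg hB]
        simp only [hB, not_false_eq_true, and_true]
    rw [o2, ← hX, Circuit.accept_exchange (b := b) hpx hpz hdeg rfl, hbits, hbranch]

theorem hybridReal_eq (A : Adversary) (n : ℕ) :
    S.hybridReal A n = S.setup A.A₁ n fun k a => (a.tl.hd.toCircuit.run ∅).avg fun v =>
      S.trial A.A₂ n k a.tl.tl (readReg 0 _ v) (hit (readReg 1 a.hd.size v)) := rfl

theorem hybridInvalid_eq (A : Adversary) (n : ℕ) :
    S.hybridInvalid A n = S.setup A.A₁ n fun k a => (a.tl.hd.toCircuit.run ∅).avg fun v =>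
      S.trial A.A₂ n k a.tl.tl (readReg 0 _ v) invalid := rfl

theorem trial_prepend_hit (A₂ : Cmd) (n : ℕ) {l : ℕ} (k s : Data) (x x' : S.Msg n) (z : Bits l)
    (h : ∀ (E : Circuit) (xs : List (S.Msg n)),
      Circuit.accept (s.hd.toCircuit.reverse ++ E) x' xs = E.accept z xs) :
    S.trial (Cmd.prepend A₂) n k s x (hit x') = S.trial A₂ n k s.tl x (hit z) := by
  rw [trial_prepend]
  simp only [hit, h]
  rfl

theorem cnmReal_toClassical (A : Adversary) (n : ℕ) :
    S.cnmReal A.toClassical n = S.setup A.A₁ n fun k a =>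
      (a.tl.hd.toCircuit.run ∅).avg fun v₀ => (a.tl.hd.toCircuit.run ∅).avg fun v₁ =>
      let G := fun b b' => S.trial A.A₂ n k a.tl.tl (S.exchangeMsg n a.hd.size v₀ v₁ b)
        (hit (readReg 1 a.hd.size (S.exchangeBranch n a.hd.size v₀ v₁ b')))
      (G false false + G true true) / 2 := by
  rw [cnmReal_eq]
  refine S.setup_toClassical A n (fun k C s => (C.run ∅).avg fun v =>
    S.trial (Cmd.prepend A.A₂) n k s (readReg 0 _ v) (hit (readReg 0 (S.msgLen n) v))) _ ?_
  intro k a o v₀ v₁ h1 h2 h3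
  obtain ⟨w, hw, e⟩ := h1 fun v => S.trial (Cmd.prepend A.A₂) n k o.tl (readReg 0 _ v)
    (hit (readReg 0 (S.msgLen n) v))
  rw [e]
  simp only [hw, S.trial_prepend_hit A.A₂ n k o.tl _ _ _ (h2 _), h3]

theorem cnmIdeal_toClassical (A : Adversary) (n : ℕ) :
    S.cnmIdeal A.toClassical n = S.setup A.A₁ n fun k a =>
      (a.tl.hd.toCircuit.run ∅).avg fun v₀ => (a.tl.hd.toCircuit.run ∅).avg fun v₁ =>
      let G := fun b b' => S.trial A.A₂ n k a.tl.tl (S.exchangeMsg n a.hd.size v₀ v₁ b)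
        (hit (readReg 1 a.hd.size (S.exchangeBranch n a.hd.size v₀ v₁ b')))
      ((G false false + G false true) / 2 + (G true false + G true true) / 2) / 2 := by
  rw [cnmIdeal_eq]
  refine S.setup_toClassical A n (fun k C s => (C.run ∅).avg fun v => (C.run ∅).avg fun v' =>
    S.trial (Cmd.prepend A.A₂) n k s (readReg 0 _ v) (hit (readReg 0 (S.msgLen n) v'))) _ ?_
  intro k a o v₀ v₁ h1 h2 h3
  obtain ⟨w, hw, e⟩ := h1 fun v => (o.hd.toCircuit.run ∅).avg fun v' =>
    S.trial (Cmd.prepend A.A₂) n k o.tl (readReg 0 _ v) (hit (readReg 0 (S.msgLen n) v'))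
  rw [e]
  have e' : ∀ x : S.Msg n, ((o.hd.toCircuit.run ∅).avg fun v' =>
      S.trial (Cmd.prepend A.A₂) n k o.tl x (hit (readReg 0 (S.msgLen n) v')))
      = (S.trial A.A₂ n k a.tl.tl x
          (hit (readReg 1 a.hd.size (S.exchangeBranch n a.hd.size v₀ v₁ false)))
        + S.trial A.A₂ n k a.tl.tl x
          (hit (readReg 1 a.hd.size (S.exchangeBranch n a.hd.size v₀ v₁ true)))) / 2 := by
    intro x
    obtain ⟨w, hw, e⟩ := h1 fun v' =>
      S.trial (Cmd.prepend A.A₂) n k o.tl x (hit (readReg 0 (S.msgLen n) v'))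
    rw [e]
    simp only [hw, S.trial_prepend_hit A.A₂ n k o.tl _ _ _ (h2 _), h3]
  simp only [e', hw]

/-- Each of the two plaintexts is one of two samples from the distribution used by `A`, so that
choosing between them at most doubles the expected number of invalid outputs. -/
theorem cnmInvalid_toClassical_le (A : Adversary) (n : ℕ) :
    S.cnmInvalid A.toClassical n ≤ 2 * S.hybridInvalid A n := by
  have e : S.cnmInvalid A.toClassical n = S.setup A.A₁ n fun k a =>
      (a.tl.hd.toCircuit.run ∅).avg fun v₀ => (a.tl.hd.toCircuit.run ∅).avg fun v₁ =>
      (S.trial A.A₂ n k a.tl.tl (S.exchangeMsg n a.hd.size v₀ v₁ false) invalid +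
        S.trial A.A₂ n k a.tl.tl (S.exchangeMsg n a.hd.size v₀ v₁ true) invalid) / 2 := by
    rw [cnmInvalid_eq]
    refine S.setup_toClassical A n (fun k C s => (C.run ∅).avg fun v =>
      S.trial (Cmd.prepend A.A₂) n k s (readReg 0 _ v) invalid) _ ?_
    intro k a o v₀ v₁ h1 h2 h3
    obtain ⟨w, hw, e⟩ := h1 fun v =>
      S.trial (Cmd.prepend A.A₂) n k o.tl (readReg 0 _ v) invalid
    rw [e]
    simp only [hw, trial_prepend, h3]
    rfl
  rw [e, hybridInvalid_eq, ← setup_mul_left]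
  refine S.setup_mono _ _ fun k _ a => ?_
  set I : Finset Data → ℝ := fun v => S.trial A.A₂ n k a.tl.tl (readReg 0 _ v) invalid with hI
  have hI0 : ∀ v, 0 ≤ I v := fun v => trial_nonneg _ _ _ _ _ invalid_nonneg
  set χ := a.tl.hd.toCircuit.run ∅ with hχ
  have e2 : 2 * χ.avg I = χ.avg fun v₀ => χ.avg fun v₁ => I v₀ + I v₁ := by
    simp only [QState.avg_add]
    rw [hχ]
    simp only [Circuit.avg_run_const]
    ring
  rw [e2]
  refine QState.avg_mono _ fun v₀ => QState.avg_mono _ fun v₁ => ?_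
  have i0 := hI0 v₀
  have i1 := hI0 v₁
  have h1 : S.trial A.A₂ n k a.tl.tl (S.exchangeMsg n a.hd.size v₀ v₁ false) invalid = I v₀ := by
    simp [exchangeMsg, hI]
  rw [h1]
  by_cases hz : readReg 1 a.hd.size v₀ ≠ readReg 1 a.hd.size v₁
  · have h2 : S.trial A.A₂ n k a.tl.tl (S.exchangeMsg n a.hd.size v₀ v₁ true) invalid = I v₁ := by
      simp [exchangeMsg, hI, hz]
    rw [h2]
    linarith
  · have h2 : S.trial A.A₂ n k a.tl.tl (S.exchangeMsg n a.hd.size v₀ v₁ true) invalid = I v₀ := by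
      simp [exchangeMsg, hI, hz]
    rw [h2]
    linarith

/-- The average of `G v v - G v v'` over two independent samples is half the average of its
symmetrisation. -/
theorem _root_.PQNM.Circuit.avg_sub_avg (C : Circuit) (G : Finset Data → Finset Data → ℝ) :
    ((C.run ∅).avg fun v => G v v) - ((C.run ∅).avg fun v => (C.run ∅).avg fun v' => G v v')
      = (C.run ∅).avg fun v₀ => (C.run ∅).avg fun v₁ =>
          (G v₀ v₀ + G v₁ v₁ - G v₀ v₁ - G v₁ v₀) / 2 := by
  have e : ((C.run ∅).avg fun v₀ => (C.run ∅).avg fun v₁ =>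
      (G v₀ v₀ + G v₁ v₁ - G v₀ v₁ - G v₁ v₀) / 2)
      = 1 / 2 * ((C.run ∅).avg fun v₀ => (C.run ∅).avg fun v₁ =>
          (G v₀ v₀ + G v₁ v₁ - G v₀ v₁ - G v₁ v₀)) := by
    rw [← QState.avg_mul_left]
    refine QState.avg_congr fun v₀ => ?_
    rw [← QState.avg_mul_left]
    exact QState.avg_congr fun v₁ => by ring
  rw [e]
  simp only [QState.avg_sub, QState.avg_add, Circuit.avg_run_const]
  rw [QState.avg_comm (C.run ∅) (C.run ∅) fun v₀ v₁ => G v₁ v₀]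
  ring

/-- The advantage of `A` is a symmetrised combination over two samples, and `toClassical` attains
half of it for every pair of samples. -/
theorem hybrid_sub_eq (A : Adversary) (n : ℕ) :
    S.hybridReal A n - S.hybridIdeal A n
      = 2 * (S.cnmReal A.toClassical n - S.cnmIdeal A.toClassical n) := by
  rw [hybridReal_eq, hybridIdeal_eq, cnmReal_toClassical, cnmIdeal_toClassical, ← setup_sub,
    ← setup_sub, ← setup_mul_left]
  congr 1
  funext k a
  rw [Circuit.avg_sub_avg a.tl.hd.toCircuit fun v v' =>
    S.trial A.A₂ n k a.tl.tl (readReg 0 _ v) (hit (readReg 1 a.hd.size v'))]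
  rw [← QState.avg_sub, ← QState.avg_mul_left]
  refine QState.avg_congr fun v₀ => ?_
  rw [← QState.avg_sub, ← QState.avg_mul_left]
  refine QState.avg_congr fun v₁ => ?_
  by_cases hz : readReg 1 a.hd.size v₀ = readReg 1 a.hd.size v₁
  · -- Equal contents of register `1`: both sides vanish.
    simp only [exchangeBranch, exchangeMsg, hz, ne_eq, not_true_eq_false, and_false, if_false]
    ring
  · by_cases hx : readReg 0 (S.msgLen n) v₀ = readReg 0 (S.msgLen n) v₁
    · -- Equal plaintexts: both sides vanish.
      simp [exchangeBranch, exchangeMsg, hz, hx]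
    · simp [exchangeBranch, exchangeMsg, hz, hx]
      ring

/-- Reduces hybrid experiments with `toQuantum` to the first stage of `A` and two samples `v₀` and
`v₁`: the new circuit `U` samples uniformly from the two plaintexts, with a copy in register `1`. -/
theorem setup_toQuantum (A : Adversary) (n : ℕ)
    (F : Data → ℕ → Circuit → Data → ℝ) (H : Data → Data → Finset Data → Finset Data → ℝ)
    (hF : ∀ (k a : Data) (U : Circuit) (v₀ v₁ : Finset Data),
      (∀ h : Finset Data → ℝ, ∃ w : Bool → Finset Data,
        (∀ b, readReg 0 (S.msgLen n) (w b) = readReg 0 (S.msgLen n) (if b then v₁ else v₀)) ∧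
        (∀ b, readReg 1 (S.msgLen n) (w b) = readReg 0 (S.msgLen n) (if b then v₁ else v₀)) ∧
        (U.run ∅).avg h = (h (w false) + h (w true)) / 2) →
      F k (S.msgLen n) U a.tl = H k a v₀ v₁) :
    (S.setup A.toQuantum.A₁ n fun k o => F k o.hd.size o.tl.hd.toCircuit o.tl.tl)
      = S.setup A.A₁ n fun k a => (a.hd.toCircuit.run ∅).avg fun v₀ =>
          (a.hd.toCircuit.run ∅).avg fun v₁ => H k a v₀ v₁ := by
  rw [setup, setup]
  congr 1
  funext k
  refine Cmd.expect_sampleTwice_copyProgram A.A₁ (S.input₁ n k.hd) _ _ ?_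
  intro a s v₀ v₁ σ h0 h16 hs
  obtain ⟨o1, o2, o3⟩ := Cmd.readSem_copyProgram hs σ (S.msgLen n)
    (by rw [h0, msgLen_eq_size_input₁]) _ rfl
  rw [o1, o2, o3, h0, h16, msgLen_eq_size_input₁]
  refine hF k a _ v₀ v₁ fun h => ?_
  set B := Cmd.bits true v₀ v₁ 0 with hB
  have hX : ∀ b, (fun j : Fin (S.msgLen n) => B b j)
      = readReg 0 (S.msgLen n) (if b then v₁ else v₀) := by
    intro b
    cases b <;> rfl
  have hm : ∀ s : Finset Data, Circuit.Maps (Circuit.load B 1 (S.msgLen n) ++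
      Circuit.load B 0 (S.msgLen n)) s (symmDiff (symmDiff s
        (loadSet (B (decide (Data.nil ∈ s))) 1 (S.msgLen n)))
        (loadSet (B (decide (Data.nil ∈ s))) 0 (S.msgLen n))) := by
    intro s
    refine (Circuit.maps_load B 1 (S.msgLen n) s).append ?_
    have := Circuit.maps_load B 0 (S.msgLen n)
      (symmDiff s (loadSet (B (decide (Data.nil ∈ s))) 1 (S.msgLen n)))
    have hnil : Data.nil ∈ symmDiff s (loadSet (B (decide (Data.nil ∈ s))) 1 (S.msgLen n))
        ↔ Data.nil ∈ s := by
      simp [Finset.mem_symmDiff, nil_notMem_loadSet]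
    simpa only [hnil] using this
  have m0 := hm ∅
  have m1 := hm {Data.nil}
  rw [show decide (Data.nil ∈ (∅ : Finset Data)) = false by simp] at m0
  rw [show decide (Data.nil ∈ ({Data.nil} : Finset Data)) = true by simp] at m1
  refine ⟨fun b => if b then _ else _, fun b => ?_, fun b => ?_, (Circuit.avg_run_H_cons m0 m1 ?_
    h)⟩
  · rw [← hX]
    refine readReg_eq_of_forall fun j hj => ?_
    cases b <;> simp [Finset.mem_symmDiff, mem_loadSet, hj, wire_ne_nil]
  · rw [← hX]
    refine readReg_eq_of_forall fun j hj => ?_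
    cases b <;> simp [Finset.mem_symmDiff, mem_loadSet, hj, wire_ne_nil]
  · intro hcon
    have := Finset.ext_iff.1 hcon Data.nil
    simp [Finset.mem_symmDiff, nil_notMem_loadSet] at this

/-- The counterpart of `hybrid_sub_eq`; no degenerate cases arise, as copies of plaintexts need not
be recovered from them. -/
theorem cnm_sub_eq (A : Adversary) (n : ℕ) :
    S.cnmReal A n - S.cnmIdeal A n
      = 2 * (S.hybridReal A.toQuantum n - S.hybridIdeal A.toQuantum n) := by
  have e1 : S.hybridReal A.toQuantum n = S.setup A.A₁ n fun k a =>
      (a.hd.toCircuit.run ∅).avg fun v₀ => (a.hd.toCircuit.run ∅).avg fun v₁ =>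
      let G := fun v v' => S.trial A.A₂ n k a.tl (readReg 0 _ v) (hit (readReg 0 (S.msgLen n) v'))
      (G v₀ v₀ + G v₁ v₁) / 2 := by
    rw [hybridReal_eq]
    refine S.setup_toQuantum A n (fun k ρ U s => (U.run ∅).avg fun v =>
      S.trial A.A₂ n k s (readReg 0 _ v) (hit (readReg 1 ρ v))) _ ?_
    intro k a U v₀ v₁ h1
    obtain ⟨w, hw, hw', e⟩ := h1 fun v =>
      S.trial A.A₂ n k a.tl (readReg 0 _ v) (hit (readReg 1 (S.msgLen n) v))
    rw [e]
    simp only [hw, hw']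
    rfl
  have e2 : S.hybridIdeal A.toQuantum n = S.setup A.A₁ n fun k a =>
      (a.hd.toCircuit.run ∅).avg fun v₀ => (a.hd.toCircuit.run ∅).avg fun v₁ =>
      let G := fun v v' => S.trial A.A₂ n k a.tl (readReg 0 _ v) (hit (readReg 0 (S.msgLen n) v'))
      ((G v₀ v₀ + G v₀ v₁) / 2 + (G v₁ v₀ + G v₁ v₁) / 2) / 2 := by
    rw [hybridIdeal_eq]
    refine S.setup_toQuantum A n (fun k ρ U s => (U.run ∅).avg fun v => (U.run ∅).avg fun v' =>
      S.trial A.A₂ n k s (readReg 0 _ v) (hit (readReg 1 ρ v'))) _ ?_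
    intro k a U v₀ v₁ h1
    obtain ⟨w, hw, hw', e⟩ := h1 fun v => (U.run ∅).avg fun v' =>
      S.trial A.A₂ n k a.tl (readReg 0 _ v) (hit (readReg 1 (S.msgLen n) v'))
    rw [e]
    have e' : ∀ x : S.Msg n, ((U.run ∅).avg fun v' =>
        S.trial A.A₂ n k a.tl x (hit (readReg 1 (S.msgLen n) v')))
        = (S.trial A.A₂ n k a.tl x (hit (readReg 0 (S.msgLen n) v₀)) +
          S.trial A.A₂ n k a.tl x (hit (readReg 0 (S.msgLen n) v₁))) / 2 := by
      intro x
      obtain ⟨w, hw, hw', e⟩ := h1 fun v' =>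
        S.trial A.A₂ n k a.tl x (hit (readReg 1 (S.msgLen n) v'))
      rw [e]
      simp only [hw']
      rfl
    simp only [e', hw]
    rfl
  rw [cnmReal_eq, cnmIdeal_eq, e1, e2, ← setup_sub, ← setup_sub, ← setup_mul_left]
  congr 1
  funext k a
  rw [Circuit.avg_sub_avg a.hd.toCircuit fun v v' =>
    S.trial A.A₂ n k a.tl (readReg 0 _ v) (hit (readReg 0 (S.msgLen n) v'))]
  rw [← QState.avg_sub, ← QState.avg_mul_left]
  refine QState.avg_congr fun v₀ => ?_
  rw [← QState.avg_sub, ← QState.avg_mul_left]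
  refine QState.avg_congr fun v₁ => ?_
  ring

theorem hybridInvalid_toQuantum (A : Adversary) (n : ℕ) :
    S.hybridInvalid A.toQuantum n = S.cnmInvalid A n := by
  have e1 : S.hybridInvalid A.toQuantum n = S.setup A.A₁ n fun k a =>
      (a.hd.toCircuit.run ∅).avg fun v₀ => (a.hd.toCircuit.run ∅).avg fun v₁ =>
      let I := fun v => S.trial A.A₂ n k a.tl (readReg 0 _ v) invalid
      1 / 2 * (I v₀ + I v₁) := by
    rw [hybridInvalid_eq]
    refine S.setup_toQuantum A n (fun k ρ U s => (U.run ∅).avg fun v =>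
      S.trial A.A₂ n k s (readReg 0 _ v) invalid) _ ?_
    intro k a U v₀ v₁ h1
    obtain ⟨w, hw, hw', e⟩ := h1 fun v =>
      S.trial A.A₂ n k a.tl (readReg 0 _ v) invalid
    rw [e]
    simp only [hw, div_eq_inv_mul, mul_one]
    rfl
  rw [e1, cnmInvalid_eq]
  congr 1
  funext k a
  simp only [QState.avg_mul_left, QState.avg_add, Circuit.avg_run_const]
  ring

end SchemeData

end PQNM

end

theorem mainTheorem2 (S : PQNM.PKQES) (D : PQNM.EncForm S.toSchemeData) :
    PQNM.QCNM_PQ D.toEncFormData ↔ PQNM.CNM_PQ S.toSchemeData := by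
  obtain ⟨ε, hε, hclose⟩ := D.exists_hybrid_close
  constructor
  · -- For a classical adversary `A`, the hybrid of `A.toQuantum` is as often invalid as `A`.
    intro h A hA hinv
    have hB := h A.toQuantum (PQNM.Adversary.toQuantum_QPT hA) ((hinv.add hε).mono fun n => by
      have h3 := (abs_le.1 (hclose A.toQuantum n).2.2).2
      rw [PQNM.SchemeData.hybridInvalid_toQuantum] at h3
      linarith)
    refine ((hB.add hB).add ((hε.add hε).add (hε.add hε))).mono fun n => ?_
    rw [PQNM.SchemeData.cnm_sub_eq]
    obtain ⟨h1, h2, -⟩ := hclose A.toQuantum n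
    have h1' := (abs_le.1 h1).1
    have h2' := (abs_le.1 h2).2
    linarith
  · -- For a quantum adversary `A`, `A.toClassical` is at most twice as often invalid as the hybrid.
    intro h A hA hinv
    have hB := h A.toClassical (PQNM.Adversary.toClassical_QPT hA)
      (((hinv.add hinv).add (hε.add hε)).mono fun n => by
        have h3 := (abs_le.1 (hclose A n).2.2).1
        have h4 := S.toSchemeData.cnmInvalid_toClassical_le A n
        linarith)
    refine ((hB.add hB).add (hε.add hε)).mono fun n => ?_
    obtain ⟨h1, h2, -⟩ := hclose A n
    have h1' := (abs_le.1 h1).2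
    have h2' := (abs_le.1 h2).1
    have h3 := S.toSchemeData.hybrid_sub_eq A n
    linarith
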